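/- **Setting.** Let $d,m\in\mathbb N$, let $\alpha:[0,1]\to\mathbb R^{d\times d}$ and $\sqrt\Gamma:[0,1]\to\mathbb R^{d\times m}$ be continuous, and put $\Gamma=\sqrt\Gamma\sqrt\Gamma^{T}$. Let $F(t_0,t)$ be the flow of $\alpha$: $\partial_tF(t_0,t)=\alpha(t)F(t_0,t)$, $F(t_0,t_0)=I_d$. Put $g(t)=F(0,t)$, $f(t)=F(t,0)\sqrt{\Gamma(t)}$, $h_u(s,t)=\int_s^tF(w,u)\Gamma(w)F(w,u)^T\,dw$ and $h=h_0$. Assume that $F(u,v)h_u(u,v)F(u,v)^T$ is positive definite for all $0\le u<v\le1$. Let $W$ be an $m$-dimensional Wiener process on $[0,1]$ and let $X$ be the $\mathbb R^d$-valued process with continuous paths $$X_t=g(t)\int_0^tf(s)\,dW_s=\int_0^1k(t,s)\,dW_s ,\qquad k(t,s)=\mathbf 1_{[0,t]}(s)\,g(t)f(s),$$ (that is, the solution of $dX=\alpha X\,dt+\sqrt\Gamma\,dW$, $X_0=0$). **Supports.** For $n\ge1$, $0\le k<2^{n-1}$ let $l_{n,k}<m_{n,k}<r_{n,k}$ satisfy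 $l_{1,0}=0$, $r_{1,0}=1$, $l_{n+1,2k}=l_{n,k}$, $r_{n+1,2k}=l_{n+1,2k+1}=m_{n,k}$, $r_{n+1,2k+1}=r_{n,k}$, and, for some $\rho\in(0,1)$, $\max(r_{n,k}-m_{n,k},\,m_{n,k}-l_{n,k})<\rho\,(r_{n,k}-l_{n,k})$ for all $(n,k)$. Let $\mathcal I=\{(0,0)\}\cup\{(n,k):n\ge1,\ 0\le k<2^{n-1}\}$ and $\mathcal I_N=\{(n,k)\in\mathcal I:n<N\}$. For $N\ge1$ let $D_N=\{0,1\}\cup\{m_{n,k}:1\le n<N,\ 0\le k<2^{n-1}\}$, let $\mathcal F_N$ be the $\sigma$-algebra generated by $\{X_t:t\in D_N\}$, and let $Z^N_t=\mathbb E[X_t\mid\mathcal F_N]$. **Bases.** Let $\sigma_{n,k}$ be any square roots, $\sigma_{n,k}\sigma_{n,k}^T=\Sigma_{n,k}$ (for instance the Cholesky factors), where $\Sigma_{0,0}=g(1)h(0,1)g(1)^T$ and, for $n\ge1$ and writing $l,m,r$ for $l_{n,k},m_{n,k},r_{n,k}$, $\Sigma_{n,k}=h_m(l,m)\,h_m(l,r)^{-1}h_m(m,r)$.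 Put $L_{0,0}=h(0,1)^{-1}g(1)^{-1}\sigma_{0,0}$ and, for $n\ge1$, $L_{n,k}=h(l,m)^{-1}g(m)^{-1}\sigma_{n,k}$, $R_{n,k}=h(m,r)^{-1}g(m)^{-1}\sigma_{n,k}$, $M_{n,k}=g(m)^T(\sigma_{n,k}^{-1})^T$. Let $\psi_{0,0}(t)=g(t)h(0,t)L_{0,0}$ and $\phi_{0,0}(t)=f(t)^TL_{0,0}$; for $n\ge1$ let $$\psi_{n,k}(t)=\begin{cases}g(t)h(l,t)L_{n,k},&l\le t\le m\\ g(t)h(t,r)R_{n,k},&m\le t\le r\end{cases}\qquad \phi_{n,k}(t)=\begin{cases}f(t)^TL_{n,k},&l\le t<m\\-f(t)^TR_{n,k},&m\le t<r\end{cases}$$ and zero elsewhere. For $u\in C([0,1],\mathbb R^d)$ let $\Delta(u)_{0,0}=L_{0,0}^Tg(1)^{-1}u(1)$ and, for $n\ge1$, $\Delta(u)_{n,k}=M_{n,k}^Tg(m)^{-1}u(m)-L_{n,k}^Tg(l)^{-1}u(l)-R_{n,k}^Tg(r)^{-1}u(r)$. Let $$\mathcal E=\Big\{u\in C([0,1],\mathbb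 R^d):u(0)=0,\ \sum_{\mathcal I}|\Delta(u)_{n,k}|^2<\infty\Big\},\quad \mathcal L[u]=\sum_{\mathcal I}\phi_{n,k}\Delta(u)_{n,k}\in L^2([0,1],\mathbb R^m),$$ $\langle u,v\rangle=\int_0^1\mathcal L[u](t)^T\mathcal L[v](t)\,dt$, and let $\mathcal E_N$ be the set of $u\in\mathcal E$ for which $\mathcal L[u]$ lies in the span of the columns of the $\phi_{n,k}$, $(n,k)\in\mathcal I_N$. For $x$ in the uniform closure $\overline{\mathcal E}$ of $\mathcal E$, $\langle v,x\rangle$ denotes the limit of $\langle v,u\rangle$ as $u\in\mathcal E$ tends to $x$ uniformly (when it exists), and $P\langle\psi_{n,k},x\rangle\in\mathbb R^d$ is the vector with components $\langle c_j(\psi_{n,k}),x\rangle$, $c_j$ denoting the $j$-th column. **Statement.** For $x\in\mathcal E$ and every $(n,k)\in\mathcal I$ the extended pairing $P\langle\psi_{n,k},x\rangle$ exists and agrees with the one given by the inner product of $\mathcal E$. The processes $Z^N$, $N\ge1$, have versions with continuous paths, and for any such versions: 1. for all $N\ge1$ and $t\in[0,1]$, almost surely $$Z^N_t=\int_0^1k_N(t,s)\,dW_s,\qquad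 k_N(t,s)=\sum_{(n,k)\in\mathcal I_N}\psi_{n,k}(t)\,\phi_{n,k}(s)^T ;$$ 2. almost surely, $X\in\overline{\mathcal E}$ and $P\langle\psi_{n,k},X\rangle$ exists for all $(n,k)\in\mathcal I$; moreover $P\langle\psi_{n,k},X\rangle=\int_0^1\phi_{n,k}(s)^T\,dW_s$ almost surely; 3. almost surely, for all $N\ge1$, the path $Z^N$ is the $\langle\,,\rangle$-orthogonal projection of the path $X$ on $\mathcal E_N$, that is, $Z^N\in\mathcal E_N$ and $\langle v,X-Z^N\rangle=0$ for all $v\in\mathcal E_N$, and $$Z^N_t=\sum_{(n,k)\in\mathcal I_N}\psi_{n,k}(t)\,P\langle\psi_{n,k},X\rangle\quad\text{for all }t\in[0,1],$$ with $P\langle\psi_{n,k},Z^N\rangle=P\langle\psi_{n,k},X\rangle$ for all $(n,k)\in\mathcal I_N$. -/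

import Mathlib

open MeasureTheory ProbabilityTheory Filter Set
open scoped Matrix Topology unitInterval

/-! ### The flow of a linear differential equation on `[0,1]` -/

/-- `F` is the flow of `α` on `[0,1]`: for every `t₀ ∈ [0,1]`, the matrix function `F t₀ ·` solves
`∂ₜ F(t₀,t) = α(t) F(t₀,t)` on `[0,1]` (entry by entry, one-sided at the endpoints), and
`F(t₀,t₀) = I`. -/
def IsFlow {d : ℕ} (α : ℝ → Matrix (Fin d) (Fin d) ℝ) (F : ℝ → ℝ → Matrix (Fin d) (Fin d) ℝ) :
    Prop :=
  ∀ t₀ ∈ Icc (0 : ℝ) 1, F t₀ t₀ = 1 ∧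
    ∀ t ∈ Icc (0 : ℝ) 1, ∀ i j,
      HasDerivWithinAt (fun s => F t₀ s i j) ((α t * F t₀ t) i j) (Icc 0 1) t

/-- Successive Picard iterates of `Y' = A Y`, `Y(t₀) = 1`. -/
noncomputable def picardTerm {𝔸 : Type*} [NormedRing 𝔸] [NormedAlgebra ℝ 𝔸] (A : ℝ → 𝔸) (t₀ : ℝ) :
    ℕ → ℝ → 𝔸
  | 0 => fun _ => 1
  | n + 1 => fun t => ∫ s in t₀..t, A s * picardTerm A t₀ n s

theorem continuous_picardTerm {𝔸 : Type*} [NormedRing 𝔸] [NormedAlgebra ℝ 𝔸] [CompleteSpace 𝔸]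
    (A : ℝ → 𝔸) (hA : Continuous A) (t₀ : ℝ) (n : ℕ) : Continuous (picardTerm A t₀ n) := by
  induction n with
  | zero => exact continuous_const
  | succ n ih =>
    exact intervalIntegral.continuous_primitive
      (fun a b => (hA.mul ih).intervalIntegrable a b) t₀

theorem hasDerivAt_picardTerm {𝔸 : Type*} [NormedRing 𝔸] [NormedAlgebra ℝ 𝔸] [CompleteSpace 𝔸]
    (A : ℝ → 𝔸) (hA : Continuous A) (t₀ : ℝ) (n : ℕ) (t : ℝ) :
    HasDerivAt (picardTerm A t₀ (n + 1)) (A t * picardTerm A t₀ n t) t := by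
  have hc := hA.mul (continuous_picardTerm A hA t₀ n)
  exact intervalIntegral.integral_hasDerivAt_right (hc.intervalIntegrable _ _)
    hc.aestronglyMeasurable.stronglyMeasurableAtFilter hc.continuousAt

theorem norm_picardTerm_le {𝔸 : Type*} [NormedRing 𝔸] [NormedAlgebra ℝ 𝔸] [CompleteSpace 𝔸]
    (A : ℝ → 𝔸) (t₀ C : ℝ) (hC : ∀ t, ‖A t‖ ≤ C) (n : ℕ) (t : ℝ) :
    ‖picardTerm A t₀ n t‖ ≤ ‖(1 : 𝔸)‖ * (C * |t - t₀|) ^ n / n.factorial := by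
  have hC0 : 0 ≤ C := (norm_nonneg _).trans (hC 0)
  induction n generalizing t with
  | zero => simp [picardTerm]
  | succ n ih =>
    have h1 : ‖picardTerm A t₀ (n + 1) t‖ ≤
        |∫ s in t₀..t, ‖(1 : 𝔸)‖ * C ^ (n + 1) / n.factorial * |s - t₀| ^ n| := by
      refine intervalIntegral.norm_integral_le_abs_of_norm_le (ae_of_all _ fun s => ?_) ?_
      · refine (norm_mul_le _ _).trans ?_
        calc ‖A s‖ * ‖picardTerm A t₀ n s‖
            ≤ C * (‖(1 : 𝔸)‖ * (C * |s - t₀|) ^ n / n.factorial) :=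
              mul_le_mul (hC s) (ih s) (norm_nonneg _) hC0
          _ = _ := by rw [mul_pow]; ring
      · exact Continuous.intervalIntegrable (by fun_prop) _ _
    refine h1.trans (le_of_eq ?_)
    rw [intervalIntegral.abs_integral_eq_abs_integral_uIoc, MeasureTheory.integral_const_mul,
      integral_pow_abs_sub_uIoc, abs_of_nonneg (by positivity), Nat.factorial_succ, mul_pow]
    push_cast
    field_simp

theorem exists_linear_flow {𝔸 : Type*} [NormedRing 𝔸] [NormedAlgebra ℝ 𝔸] [CompleteSpace 𝔸]
    (A : ℝ → 𝔸) (hA : Continuous A) (C : ℝ) (hC : ∀ t, ‖A t‖ ≤ C) (t₀ : ℝ)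
    (ht₀ : t₀ ∈ Icc (0 : ℝ) 1) :
    ∃ Y : ℝ → 𝔸, Y t₀ = 1 ∧ ∀ t ∈ Icc (0 : ℝ) 1, HasDerivAt Y (A t * Y t) t := by
  have hC0 : 0 ≤ C := (norm_nonneg _).trans (hC 0)
  have hb : ∀ n, ∀ t ∈ Ioo (-1 : ℝ) 2,
      ‖picardTerm A t₀ n t‖ ≤ ‖(1 : 𝔸)‖ * ((C * 3) ^ n / n.factorial) := by
    intro n t ht
    refine (norm_picardTerm_le A t₀ C hC n t).trans ?_
    have : |t - t₀| ≤ 3 := by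
      rw [abs_le]
      constructor <;> linarith [ht.1, ht.2, ht₀.1, ht₀.2]
    rw [mul_div_assoc]
    gcongr
  have hs : Summable fun n : ℕ => ‖(1 : 𝔸)‖ * ((C * 3) ^ n / n.factorial) :=
    (Real.summable_pow_div_factorial _).mul_left _
  have hsum : ∀ t ∈ Ioo (-1 : ℝ) 2, Summable fun n => picardTerm A t₀ n t := fun t ht =>
    Summable.of_norm_bounded hs fun n => hb n t ht
  have ht₀' : t₀ ∈ Ioo (-1 : ℝ) 2 := ⟨by linarith [ht₀.1], by linarith [ht₀.2]⟩
  refine ⟨fun t => 1 + ∑' n, picardTerm A t₀ (n + 1) t, ?_, fun t ht => ?_⟩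
  · simp [picardTerm]
  · have ht' : t ∈ Ioo (-1 : ℝ) 2 := ⟨by linarith [ht.1], by linarith [ht.2]⟩
    have hd := hasDerivAt_tsum_of_isPreconnected
      (g := fun n => picardTerm A t₀ (n + 1)) (g' := fun n s => A s * picardTerm A t₀ n s)
      (hs.mul_left C) isOpen_Ioo isPreconnected_Ioo
      (fun n y _ => hasDerivAt_picardTerm A hA t₀ n y)
      (fun n y hy => (norm_mul_le _ _).trans
        (mul_le_mul (hC y) (hb n y hy) (norm_nonneg _) hC0))
      ht₀' ((summable_nat_add_iff 1).2 (hsum t₀ ht₀')) ht'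
    have he : ∑' n, A t * picardTerm A t₀ n t = A t * (1 + ∑' n, picardTerm A t₀ (n + 1) t) := by
      rw [(hsum t ht').tsum_mul_left, (hsum t ht').tsum_eq_zero_add]
      rfl
    rw [he] at hd
    exact hd.const_add 1

section

attribute [local instance] Matrix.linftyOpNormedRing Matrix.linftyOpNormedAlgebra

theorem exists_isFlow {d : ℕ} (α : ℝ → Matrix (Fin d) (Fin d) ℝ)
    (hα : ContinuousOn α (Icc 0 1)) : ∃ F, IsFlow α F := by
  classical
  have hA : Continuous (IccExtend (zero_le_one' ℝ) ((Icc (0 : ℝ) 1).domRestrict α)) :=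
    (continuousOn_iff_continuous_domRestrict.1 hα).Icc_extend'
  obtain ⟨C, hC⟩ := isCompact_Icc.exists_bound_of_continuousOn hα
  have hC' : ∀ t, ‖IccExtend (zero_le_one' ℝ) ((Icc (0 : ℝ) 1).domRestrict α) t‖ ≤ C :=
    fun t => hC _ (projIcc (0 : ℝ) 1 (zero_le_one' ℝ) t).2
  have : CompleteSpace (Matrix (Fin d) (Fin d) ℝ) := FiniteDimensional.complete ℝ _
  choose! Y hY using exists_linear_flow _ hA C hC'
  refine ⟨Y, fun t₀ ht₀ => ⟨(hY t₀ ht₀).1, fun t ht i j => ?_⟩⟩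
  have h := (hY t₀ ht₀).2 t ht
  have h2 := ((Matrix.entryLinearMap ℝ ℝ i j).toContinuousLinearMap.hasFDerivAt.comp_hasDerivAt
    t h).hasDerivWithinAt (s := Icc 0 1)
  rw [IccExtend_of_mem _ _ ht] at h2
  exact h2

end

/-! ### Coefficients of the Gauss-Markov process -/

/-- Continuous coefficients `α : [0,1] → ℝ^{d×d}` and `√Γ : [0,1] → ℝ^{d×m}` of the linear
stochastic differential equation `dX = α X dt + √Γ dW`. -/
structure GaussMarkov (d m : ℕ) where
  α : ℝ → Matrix (Fin d) (Fin d) ℝ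
  sqrtΓ : ℝ → Matrix (Fin d) (Fin m) ℝ
  continuousOn_α : ContinuousOn α (Icc 0 1)
  continuousOn_sqrtΓ : ContinuousOn sqrtΓ (Icc 0 1)

namespace GaussMarkov

/-- The flow `F(t₀,t)`; its values at times of `[0,1]` are determined by `IsFlow`. -/
noncomputable def F {d m : ℕ} (G : GaussMarkov d m) : ℝ → ℝ → Matrix (Fin d) (Fin d) ℝ :=
  (exists_isFlow G.α G.continuousOn_α).choose

theorem isFlow_F {d m : ℕ} (G : GaussMarkov d m) : IsFlow G.α G.F :=
  (exists_isFlow G.α G.continuousOn_α).choose_spec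

/-- `Γ = √Γ √Γᵀ`. -/
noncomputable def Γ {d m : ℕ} (G : GaussMarkov d m) (t : ℝ) : Matrix (Fin d) (Fin d) ℝ :=
  G.sqrtΓ t * (G.sqrtΓ t)ᵀ

/-- `g(t) = F(0,t)`. -/
noncomputable def g {d m : ℕ} (G : GaussMarkov d m) (t : ℝ) : Matrix (Fin d) (Fin d) ℝ :=
  G.F 0 t

/-- `f(t) = F(t,0) √Γ(t)`. -/
noncomputable def f {d m : ℕ} (G : GaussMarkov d m) (t : ℝ) : Matrix (Fin d) (Fin m) ℝ :=
  G.F t 0 * G.sqrtΓ t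

/-- `h_u(s,t) = ∫_s^t F(w,u) Γ(w) F(w,u)ᵀ dw`, computed entry by entry. -/
noncomputable def hAt {d m : ℕ} (G : GaussMarkov d m) (u s t : ℝ) : Matrix (Fin d) (Fin d) ℝ :=
  Matrix.of fun i j => ∫ w in s..t, (G.F w u * G.Γ w * (G.F w u)ᵀ) i j

/-- `h = h_0`. -/
noncomputable def h {d m : ℕ} (G : GaussMarkov d m) (s t : ℝ) : Matrix (Fin d) (Fin d) ℝ :=
  G.hAt 0 s t

/-- The covariance matrix `C_u(v,v) = F(u,v) h_u(u,v) F(u,v)ᵀ` of `X_v` knowing `X_u`. -/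
noncomputable def condCov {d m : ℕ} (G : GaussMarkov d m) (u v : ℝ) : Matrix (Fin d) (Fin d) ℝ :=
  G.F u v * G.hAt u u v * (G.F u v)ᵀ

/-- The process is never degenerate. -/
def Nondegenerate {d m : ℕ} (G : GaussMarkov d m) : Prop :=
  ∀ u v : ℝ, 0 ≤ u → u < v → v ≤ 1 → (G.condCov u v).PosDef

/-- The Green kernel `k(t,s) = 1_{[0,t]}(s) g(t) f(s)`. -/
noncomputable def k {d m : ℕ} (G : GaussMarkov d m) (t s : ℝ) : Matrix (Fin d) (Fin m) ℝ :=
  if 0 ≤ s ∧ s ≤ t then G.g t * G.f s else 0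

end GaussMarkov

/-! ### Nested supports -/

/-- The index set `{(0,0)} ∪ {(n,k) : 0 < n, 0 ≤ k < 2^(n-1)}`; since `0 - 1 = 0` in `ℕ`, level
`0` has exactly one element. -/
abbrev Idx : Type := Σ n : ℕ, Fin (2 ^ (n - 1))

/-- The indices of level `n < N`. -/
def idxBelow (N : ℕ) : Finset Idx := (Finset.range N).sigma fun _ => Finset.univ

/-- A nested sequence of partitions of `[0,1]`: for `n ≥ 1` and `k < 2^(n-1)` the support
`[l n k, r n k]` is cut at `m n k` into its two children. The values at other indices are
irrelevant. -/
structure NestedSupports where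
  l : ℕ → ℕ → ℝ
  m : ℕ → ℕ → ℝ
  r : ℕ → ℕ → ℝ
  l_root : l 1 0 = 0
  r_root : r 1 0 = 1
  l_lt_m : ∀ n k, 1 ≤ n → k < 2 ^ (n - 1) → l n k < m n k
  m_lt_r : ∀ n k, 1 ≤ n → k < 2 ^ (n - 1) → m n k < r n k
  l_left : ∀ n k, 1 ≤ n → k < 2 ^ (n - 1) → l (n + 1) (2 * k) = l n k
  r_left : ∀ n k, 1 ≤ n → k < 2 ^ (n - 1) → r (n + 1) (2 * k) = m n k
  l_right : ∀ n k, 1 ≤ n → k < 2 ^ (n - 1) → l (n + 1) (2 * k + 1) = m n k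
  r_right : ∀ n k, 1 ≤ n → k < 2 ^ (n - 1) → r (n + 1) (2 * k + 1) = r n k
  shrink : ∃ ρ ∈ Ioo (0 : ℝ) 1, ∀ n k, 1 ≤ n → k < 2 ^ (n - 1) →
    max (r n k - m n k) (m n k - l n k) < ρ * (r n k - l n k)

namespace NestedSupports

/-- The endpoints of the supports of level `N ≥ 1`: `0`, `1` and the midpoints of the levels
`1, …, N - 1`. -/
def endpoints (T : NestedSupports) (N : ℕ) : Set ℝ :=
  {t | ∃ n k, 1 ≤ n ∧ n < N ∧ k < 2 ^ (n - 1) ∧ t = T.m n k} ∪ {0, 1}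

end NestedSupports

/-! ### The bases and the dual generalized functions

Throughout, `sg` is a family `σ_{n,k}` of `d × d` matrices; it is a choice of square roots
`σ_{n,k} σ_{n,k}ᵀ = Σ_{n,k}` of the matrices `bridgeCov`. -/

namespace GaussMarkov

/-- For `n ≥ 1`, `Σ_{n,k} = h_m(l,m) h_m(l,r)⁻¹ h_m(m,r)` with `m = m_{n,k}`, the covariance of
`X_m` knowing `X_l` and `X_r`; for `n = 0`, the covariance `g(1) h(0,1) g(1)ᵀ` of `X_1`. -/
noncomputable def bridgeCov {d m : ℕ} (G : GaussMarkov d m) (T : NestedSupports) (i : Idx) :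
    Matrix (Fin d) (Fin d) ℝ :=
  if i.1 = 0 then G.g 1 * G.h 0 1 * (G.g 1)ᵀ
  else G.hAt (T.m i.1 i.2) (T.l i.1 i.2) (T.m i.1 i.2) *
    (G.hAt (T.m i.1 i.2) (T.l i.1 i.2) (T.r i.1 i.2))⁻¹ *
    G.hAt (T.m i.1 i.2) (T.m i.1 i.2) (T.r i.1 i.2)

/-- `L_{n,k} = h(l,m)⁻¹ g(m)⁻¹ σ_{n,k}` for `n ≥ 1`, and `L_{0,0} = h(0,1)⁻¹ g(1)⁻¹ σ_{0,0}`. -/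
noncomputable def L {d m : ℕ} (G : GaussMarkov d m) (T : NestedSupports)
    (sg : Idx → Matrix (Fin d) (Fin d) ℝ) (i : Idx) : Matrix (Fin d) (Fin d) ℝ :=
  if i.1 = 0 then (G.h 0 1)⁻¹ * (G.g 1)⁻¹ * sg i
  else (G.h (T.l i.1 i.2) (T.m i.1 i.2))⁻¹ * (G.g (T.m i.1 i.2))⁻¹ * sg i

/-- `R_{n,k} = h(m,r)⁻¹ g(m)⁻¹ σ_{n,k}` (used for `n ≥ 1` only). -/
noncomputable def R {d m : ℕ} (G : GaussMarkov d m) (T : NestedSupports)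
    (sg : Idx → Matrix (Fin d) (Fin d) ℝ) (i : Idx) : Matrix (Fin d) (Fin d) ℝ :=
  (G.h (T.m i.1 i.2) (T.r i.1 i.2))⁻¹ * (G.g (T.m i.1 i.2))⁻¹ * sg i

/-- `M_{n,k} = g(m)ᵀ (σ_{n,k}⁻¹)ᵀ` (used for `n ≥ 1` only). -/
noncomputable def M {d m : ℕ} (G : GaussMarkov d m) (T : NestedSupports)
    (sg : Idx → Matrix (Fin d) (Fin d) ℝ) (i : Idx) : Matrix (Fin d) (Fin d) ℝ :=
  (G.g (T.m i.1 i.2))ᵀ * ((sg i)⁻¹)ᵀ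

/-- The Schauder elements `ψ_{n,k} : [0,1] → ℝ^{d×d}`. -/
noncomputable def ψ {d m : ℕ} (G : GaussMarkov d m) (T : NestedSupports)
    (sg : Idx → Matrix (Fin d) (Fin d) ℝ) (i : Idx) (t : ℝ) : Matrix (Fin d) (Fin d) ℝ :=
  if i.1 = 0 then G.g t * G.h 0 t * G.L T sg i
  else if T.l i.1 i.2 ≤ t ∧ t ≤ T.m i.1 i.2 then G.g t * G.h (T.l i.1 i.2) t * G.L T sg i
  else if T.m i.1 i.2 ≤ t ∧ t ≤ T.r i.1 i.2 then G.g t * G.h t (T.r i.1 i.2) * G.R T sg i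
  else 0

/-- The orthonormal functions `φ_{n,k} : [0,1] → ℝ^{m×d}`. -/
noncomputable def φ {d m : ℕ} (G : GaussMarkov d m) (T : NestedSupports)
    (sg : Idx → Matrix (Fin d) (Fin d) ℝ) (i : Idx) (t : ℝ) : Matrix (Fin m) (Fin d) ℝ :=
  if i.1 = 0 then (G.f t)ᵀ * G.L T sg i
  else if T.l i.1 i.2 ≤ t ∧ t < T.m i.1 i.2 then (G.f t)ᵀ * G.L T sg i
  else if T.m i.1 i.2 ≤ t ∧ t < T.r i.1 i.2 then -((G.f t)ᵀ * G.R T sg i)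
  else 0

/-- The `j`-th column of `ψ_{n,k}` as a function on `[0,1]`. -/
noncomputable def ψcol {d m : ℕ} (G : GaussMarkov d m) (T : NestedSupports)
    (sg : Idx → Matrix (Fin d) (Fin d) ℝ) (i : Idx) (j : Fin d) : I → Fin d → ℝ :=
  fun t a => G.ψ T sg i t a j

/-- The `j`-th column of `φ_{n,k}`. -/
noncomputable def φcol {d m : ℕ} (G : GaussMarkov d m) (T : NestedSupports)
    (sg : Idx → Matrix (Fin d) (Fin d) ℝ) (i : Idx) (j : Fin d) : ℝ → Fin m → ℝ :=
  fun t a => G.φ T sg i t a j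

/-- The kernel `k_N(t,s) = ∑_{n < N} ψ_{n,k}(t) φ_{n,k}(s)ᵀ`. -/
noncomputable def kN {d m : ℕ} (G : GaussMarkov d m) (T : NestedSupports)
    (sg : Idx → Matrix (Fin d) (Fin d) ℝ) (N : ℕ) (t s : ℝ) : Matrix (Fin d) (Fin m) ℝ :=
  ∑ i ∈ idxBelow N, G.ψ T sg i t * (G.φ T sg i s)ᵀ

/-- The coefficient `Δ(u)_{n,k}`: the pairing of `u` with the dual generalized function
`(g⁻¹)ᵀ (M δ_m - L δ_l - R δ_r)`, or `(g⁻¹)ᵀ L_{0,0} δ_1` when `n = 0`. -/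
noncomputable def Δ {d m : ℕ} (G : GaussMarkov d m) (T : NestedSupports)
    (sg : Idx → Matrix (Fin d) (Fin d) ℝ) (i : Idx) (u : I → Fin d → ℝ) : Fin d → ℝ :=
  let v : ℝ → Fin d → ℝ := fun t => (G.g t)⁻¹ *ᵥ u (projIcc 0 1 zero_le_one t)
  if i.1 = 0 then (G.L T sg i)ᵀ *ᵥ v 1
  else (G.M T sg i)ᵀ *ᵥ v (T.m i.1 i.2) - (G.L T sg i)ᵀ *ᵥ v (T.l i.1 i.2)
    - (G.R T sg i)ᵀ *ᵥ v (T.r i.1 i.2)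

end GaussMarkov

/-! ### The Hilbert space `E`, its finite-dimensional subspaces, and the extended pairing -/

/-- `L²([0,1], ℝ^m)`. -/
abbrev L2Path (m : ℕ) : Type :=
  Lp (EuclideanSpace ℝ (Fin m)) 2 (volume.restrict (Icc (0 : ℝ) 1))

open Classical in
/-- The class in `L²([0,1], ℝ^m)` of a square integrable function. -/
noncomputable def toL2Path {m : ℕ} (v : ℝ → Fin m → ℝ) : L2Path m :=
  if hv : MemLp (fun t => WithLp.toLp 2 (v t)) 2 (volume.restrict (Icc (0 : ℝ) 1))
  then hv.toLp else 0

namespace GaussMarkov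

/-- The operator `𝓛[u] = ∑_{(n,k)} φ_{n,k} Δ(u)_{n,k}`, the series converging in `L²`. -/
noncomputable def Lop {d m : ℕ} (G : GaussMarkov d m) (T : NestedSupports)
    (sg : Idx → Matrix (Fin d) (Fin d) ℝ) (u : I → Fin d → ℝ) : L2Path m :=
  ∑' i : Idx, toL2Path fun t => G.φ T sg i t *ᵥ G.Δ T sg i u

/-- The space `E` of the continuous `u` with `u(0) = 0` and `Δ(u) ∈ ℓ²`. -/
def E {d m : ℕ} (G : GaussMarkov d m) (T : NestedSupports)
    (sg : Idx → Matrix (Fin d) (Fin d) ℝ) : Set C(I, Fin d → ℝ) :=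
  {u | u 0 = 0 ∧ Summable fun i : Idx => ∑ a, (G.Δ T sg i u a) ^ 2}

/-- The inner product `⟨u,v⟩ = ∫₀¹ 𝓛[u](t)ᵀ 𝓛[v](t) dt`. -/
noncomputable def ip {d m : ℕ} (G : GaussMarkov d m) (T : NestedSupports)
    (sg : Idx → Matrix (Fin d) (Fin d) ℝ) (u v : I → Fin d → ℝ) : ℝ :=
  inner ℝ (G.Lop T sg u) (G.Lop T sg v)

/-- The span of the columns of the `φ_{n,k}` with `n < N`. -/
noncomputable def L2fN {d m : ℕ} (G : GaussMarkov d m) (T : NestedSupports)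
    (sg : Idx → Matrix (Fin d) (Fin d) ℝ) (N : ℕ) : Submodule ℝ (L2Path m) :=
  Submodule.span ℝ {v | ∃ i ∈ idxBelow N, ∃ j, v = toL2Path (G.φcol T sg i j)}

/-- The subspace `E_N = {u ∈ E : 𝓛[u] ∈ span (columns of φ_{n,k}, n < N)}`. -/
def EN {d m : ℕ} (G : GaussMarkov d m) (T : NestedSupports)
    (sg : Idx → Matrix (Fin d) (Fin d) ℝ) (N : ℕ) : Set C(I, Fin d → ℝ) :=
  {u | u ∈ G.E T sg ∧ G.Lop T sg u ∈ G.L2fN T sg N}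

/-- `a` is the value at the path `x` of the extension by continuity of `⟨v, ·⟩`: the path `x` is a
uniform limit of elements of `E`, and `⟨v,u⟩ → a` as `u ∈ E` tends uniformly to `x`. -/
def HasExtInner {d m : ℕ} (G : GaussMarkov d m) (T : NestedSupports)
    (sg : Idx → Matrix (Fin d) (Fin d) ℝ) (v : I → Fin d → ℝ) (x : C(I, Fin d → ℝ)) (a : ℝ) :
    Prop :=
  x ∈ closure (G.E T sg) ∧
    Tendsto (fun u : C(I, Fin d → ℝ) => G.ip T sg v u) (𝓝[G.E T sg] x) (𝓝 a)

/-- The vector `P⟨ψ_{n,k}, x⟩` of the pairings of the columns of `ψ_{n,k}` with `x`, extended by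
continuity from `E` to its uniform closure. -/
noncomputable def extP {d m : ℕ} (G : GaussMarkov d m) (T : NestedSupports)
    (sg : Idx → Matrix (Fin d) (Fin d) ℝ) (i : Idx) (x : C(I, Fin d → ℝ)) : Fin d → ℝ :=
  fun j => extendFrom (G.E T sg) (fun u : C(I, Fin d → ℝ) => G.ip T sg (G.ψcol T sg i j) u) x

/-- `z` is the orthogonal projection of `x` on `E_N`: it lies in `E_N`, and `⟨v, x - z⟩ = 0` for
all `v ∈ E_N`, the pairing being extended by continuity. -/
def IsOrthProj {d m : ℕ} (G : GaussMarkov d m) (T : NestedSupports)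
    (sg : Idx → Matrix (Fin d) (Fin d) ℝ) (N : ℕ) (x z : C(I, Fin d → ℝ)) : Prop :=
  z ∈ G.EN T sg N ∧ ∀ v ∈ G.EN T sg N, G.HasExtInner T sg v (x - z) 0

end GaussMarkov

/-! ### Wiener process, Wiener integral, conditioning -/

/-- `W` is an `m`-dimensional Wiener process on `[0,1]`. -/
structure IsWienerProcess {Ω : Type*} [MeasurableSpace Ω] {m : ℕ} (W : I → Ω → Fin m → ℝ)
    (P : Measure Ω) : Prop where
  zero : ∀ᵐ ω ∂P, W 0 ω = 0
  indep : HasIndepIncrements W P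
  law : ∀ s t : I, s ≤ t → HasLaw (fun ω => W t ω - W s ω)
    (Measure.pi fun _ : Fin m => gaussianReal 0 (Real.toNNReal ((t : ℝ) - s))) P
  cont : ∀ᵐ ω ∂P, Continuous fun t => W t ω

/-- A step function `∑_{i < n} 1_{(τ_i, τ_{i+1}]} c_i` on `[0,1]` with values in `ℝ^m`. -/
structure StepFn (m : ℕ) where
  n : ℕ
  τ : ℕ → I
  mono : Monotone τ
  c : ℕ → Fin m → ℝ

namespace StepFn

noncomputable def eval {m : ℕ} (S : StepFn m) (s : ℝ) : Fin m → ℝ :=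
  ∑ i ∈ Finset.range S.n, (Ioc (S.τ i : ℝ) (S.τ (i + 1))).indicator (fun _ => S.c i) s

/-- The elementary integral `∑_{i < n} c_i · (W_{τ_{i+1}} - W_{τ_i})`. -/
noncomputable def integral {Ω : Type*} {m : ℕ} (S : StepFn m) (W : I → Ω → Fin m → ℝ) (ω : Ω) :
    ℝ :=
  ∑ i ∈ Finset.range S.n, S.c i ⬝ᵥ (W (S.τ (i + 1)) ω - W (S.τ i) ω)

end StepFn

/-- `Y` is a version of the stochastic integral `∫₀¹ v(s)ᵀ dW_s` of the deterministic function
`v : [0,1] → ℝ^m`: the `L²(Ω)`-limit of the elementary integrals of step functions that converge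
to `v` in `L²([0,1])`. -/
def IsWienerIntegral {Ω : Type*} [MeasurableSpace Ω] {m : ℕ} (W : I → Ω → Fin m → ℝ)
    (P : Measure Ω) (v : ℝ → Fin m → ℝ) (Y : Ω → ℝ) : Prop :=
  MemLp Y 2 P ∧ ∃ S : ℕ → StepFn m,
    Tendsto (fun q => eLpNorm (fun s => (S q).eval s - v s) 2 (volume.restrict (Icc (0 : ℝ) 1)))
      atTop (𝓝 0) ∧
    Tendsto (fun q => eLpNorm (fun ω => (S q).integral W ω - Y ω) 2 P) atTop (𝓝 0)

/-- The σ-algebra generated by the values of `X` at the endpoints of the supports of level `N`. -/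
abbrev endpointSigma {Ω : Type*} {d : ℕ} (T : NestedSupports) (X : Ω → C(I, Fin d → ℝ)) (N : ℕ) :
    MeasurableSpace Ω :=
  ⨆ t ∈ {t : I | (t : ℝ) ∈ T.endpoints N},
    MeasurableSpace.comap (fun ω => X ω t) inferInstance

/-- `Z` is a continuous version of the conditioned processes: for every `N ≥ 1` and every time
`t`, `Z^N_t = E[X_t | 𝓕_N]` almost surely, component by component. -/
def IsConditioned {Ω : Type*} [MeasurableSpace Ω] {d : ℕ} (T : NestedSupports) (P : Measure Ω)
    (X : Ω → C(I, Fin d → ℝ)) (Z : ℕ → Ω → C(I, Fin d → ℝ)) : Prop :=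
  ∀ N, 1 ≤ N → ∀ (t : I) (a : Fin d),
    (fun ω => Z N ω t a) =ᵐ[P] P[fun ω => X ω t a | endpointSigma T X N]

/-! The Wiener integral is an isometry from $L^2([0,1],\mathbb R^m)$ onto a Gaussian space, and
component $a$ of $X_t$ is the image of the Green function $s\mapsto 1_{[0,t]}(s)f(s)^Tc$
(`greenL2`), where $c$ is row $a$ of $g(t)$. Since $F(u,v)=g(v)g(u)^{-1}$, each $h_u$ is a conjugate
of $h$, and $h(0,\min(s,t))$ gives all inner products of Green functions (`inner_greenL2`).

The algebraic core is $L+R=M$ (`Matrix.bridge_identity`). It makes each column of $\phi_{n,k}$ the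
combination of Green functions at $m,l,r$ whose coefficients are those of $\Delta_{n,k}$. Writing
`path w` for $t\mapsto g(t)\int_0^t f w$, this gives $\Delta(\mathrm{path}\,w)=\langle\phi,w\rangle$
(`Δ_path`), while $\psi$ is the path of $\phi$ (`ψcol_eq_path`). Orthonormality of the $\phi$ thus
reads $\Delta_{i'}(\psi_i)=\delta_{ii'}$; by symmetry $i'$ may be taken no deeper than $i$, and then
$\psi_i$ vanishes at every point that $\Delta_{i'}$ sees unless $i=i'$. Only orthonormality of the
system is needed, not its completeness.

Three consequences carry the theorem. (a) On $\mathcal E$,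
$\langle\psi_{n,k},u\rangle=\Delta(u)_{n,k}$ involves at most three values of $u$, so it is
uniformly continuous in $u$ and extends to $\overline{\mathcal E}$ as $\Delta$ itself; hence
$P\langle\psi,X\rangle=\Delta(X)=\int\phi^T dW$, and $\sum\psi\Delta(X)$ is the orthogonal
projection. (b) The Green functions at $D_N$ lie in the span of the $\phi$ below level $N$
(`greenL2_mem_L2fN`). So $X_t-\sum\psi(t)\Delta(X)$ is uncorrelated with $X$ on $D_N$, hence
independent of it by joint Gaussianity, while the sum is $\mathcal F_N$-measurable: the sum is
$Z^N_t$ (`condExp_process`). (c) Almost surely $X\in\overline{\mathcal E}$ (`ae_mem_closure_E`). By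
Hahn-Banach and separability it suffices that each continuous functional vanishing on $\mathcal E$
kills $X$ almost surely. Bernstein approximation writes its value at $X$ as a pointwise limit of
Wiener integrals of $w_n$ with $\langle w_n,w_k\rangle\to0$ for each $k$, and such a limit is zero
by characteristic functions (`ae_eq_zero_of_tendsto`). -/

/-! ### Step functions and their elementary integrals -/

namespace StepFn

/-- Evaluation at $s$ is itself an elementary integral, along the path $t\mapsto 1_{s\le t}e_b$.
Linear identities between elementary integrals, valid for all integrators, therefore transfer to
pointwise values. -/
theorem eval_apply {m : ℕ} (S : StepFn m) (s : ℝ) (b : Fin m) :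
    S.eval s b =
      S.integral (fun t (_ : Unit) => if s ≤ (t : ℝ) then Pi.single b 1 else 0) () := by
  simp only [eval, integral, Finset.sum_apply]
  refine Finset.sum_congr rfl fun i _ => ?_
  have h : (S.τ i : ℝ) ≤ S.τ (i + 1) := S.mono (Nat.le_succ i)
  by_cases h1 : s ≤ S.τ (i + 1)
  · by_cases h2 : s ≤ S.τ i
    · have : s ∉ Ioc (S.τ i : ℝ) (S.τ (i + 1)) := fun h' => absurd h'.1 (not_lt.2 h2)
      simp [h1, h2, this]
    · have : s ∈ Ioc (S.τ i : ℝ) (S.τ (i + 1)) := ⟨not_le.1 h2, h1⟩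
      simp [h1, h2, this]
  · have h2 : ¬ s ≤ S.τ i := fun h' => h1 (h'.trans h)
    have : s ∉ Ioc (S.τ i : ℝ) (S.τ (i + 1)) := fun h' => h1 h'.2
    simp [h1, h2, this]

theorem exists_monotone_enumeration (A : Finset I) :
    ∃ (n : ℕ) (τ : ℕ → I), Monotone τ ∧ ∀ a ∈ A, ∃ p ≤ n, τ p = a := by
  -- Beyond the sorted elements the sequence is padded with $1$, the top of `I`, which keeps it
  -- monotone.
  refine ⟨A.card, fun i => if h : i < A.card then A.orderEmbOfFin rfl ⟨i, h⟩ else 1, ?_, ?_⟩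
  · intro i j hij
    by_cases hj : j < A.card
    · have hi : i < A.card := hij.trans_lt hj
      simp only [hi, hj, dite_true]
      exact (A.orderEmbOfFin rfl).monotone hij
    · simp only [hj, dite_false]
      exact unitInterval.le_one'
  · intro a ha
    have : a ∈ Set.range (A.orderEmbOfFin rfl) := by
      rw [Finset.range_orderEmbOfFin]
      exact ha
    obtain ⟨i, hi⟩ := this
    exact ⟨i, i.2.le, by simp [hi]⟩

theorem exists_refinement {m : ℕ} (S : StepFn m) (n : ℕ) (τ : ℕ → I) (hτ : Monotone τ)
    (h : ∀ i ≤ S.n, ∃ p ≤ n, τ p = S.τ i) :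
    ∃ c : ℕ → Fin m → ℝ, ∀ V : I → Fin m → ℝ,
      S.integral (fun t (_ : Unit) => V t) () =
        ∑ j ∈ Finset.range n, c j ⬝ᵥ (V (τ (j + 1)) - V (τ j)) := by
  choose! p hpn hp using h
  -- `p i` is a position of `S.τ i` in the finer subdivision; the coefficient on cell `j` collects
  -- the `S.c i` whose interval covers that cell.
  refine ⟨fun j => ∑ i ∈ Finset.range S.n,
    if p i ≤ j ∧ j < p (i + 1) then S.c i else 0, fun V => ?_⟩
  have key : ∀ i ∈ Finset.range S.n, V (S.τ (i + 1)) - V (S.τ i) =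
      ∑ j ∈ Finset.range n, if p i ≤ j ∧ j < p (i + 1) then V (τ (j + 1)) - V (τ j) else 0 := by
    intro i hi
    have hi' := Finset.mem_range.1 hi
    rw [← hp i hi'.le, ← hp (i + 1) hi', ← Finset.sum_filter]
    have hf : (Finset.range n).filter (fun j => p i ≤ j ∧ j < p (i + 1)) =
        Finset.Ico (p i) (p (i + 1)) := by
      ext j
      have := hpn (i + 1) hi'
      simp only [Finset.mem_filter, Finset.mem_range, Finset.mem_Ico]
      omega
    rw [hf]
    rcases le_total (p i) (p (i + 1)) with hle | hle
    · rw [Finset.sum_Ico_sub (fun j => V (τ j)) hle]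
    -- The chosen positions need not increase with `i`. If they fail to, monotonicity of both
    -- subdivisions forces $\tau_i=\tau_{i+1}$, so both sides vanish.
    · rw [Finset.Ico_eq_empty_of_le hle, Finset.sum_empty]
      have : τ (p i) = τ (p (i + 1)) := by
        refine le_antisymm ?_ (hτ hle)
        rw [hp i hi'.le, hp (i + 1) hi']
        exact S.mono (Nat.le_succ i)
      rw [this, sub_self]
  simp only [integral]
  rw [Finset.sum_congr rfl fun i hi => by rw [key i hi, dotProduct_sum]]
  rw [Finset.sum_comm]
  refine Finset.sum_congr rfl fun j _ => ?_
  rw [sum_dotProduct]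
  refine Finset.sum_congr rfl fun i _ => ?_
  split_ifs <;> simp

theorem exists_add_smul {m : ℕ} (S₁ S₂ : StepFn m) (r : ℝ) :
    ∃ S : StepFn m, ∀ V : I → Fin m → ℝ,
      S.integral (fun t (_ : Unit) => V t) () =
        S₁.integral (fun t (_ : Unit) => V t) () + r * S₂.integral (fun t (_ : Unit) => V t) () := by
  classical
  obtain ⟨n, τ, hτ, h⟩ := exists_monotone_enumeration
    ((Finset.range (S₁.n + 1)).image S₁.τ ∪ (Finset.range (S₂.n + 1)).image S₂.τ)
  obtain ⟨c₁, h₁⟩ := S₁.exists_refinement n τ hτ fun i hi => h _ <|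
    Finset.mem_union_left _ (Finset.mem_image_of_mem _ (Finset.mem_range.2 (Nat.lt_succ_of_le hi)))
  obtain ⟨c₂, h₂⟩ := S₂.exists_refinement n τ hτ fun i hi => h _ <|
    Finset.mem_union_right _ (Finset.mem_image_of_mem _ (Finset.mem_range.2 (Nat.lt_succ_of_le hi)))
  refine ⟨⟨n, τ, hτ, c₁ + r • c₂⟩, fun V => ?_⟩
  rw [h₁, h₂, Finset.mul_sum, ← Finset.sum_add_distrib]
  refine Finset.sum_congr rfl fun i _ => ?_
  simp only [Pi.add_apply, Pi.smul_apply, add_dotProduct, smul_dotProduct, smul_eq_mul]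

theorem eval_eq_of_integral_eq {m : ℕ} {S S₁ S₂ : StepFn m} {r : ℝ}
    (h : ∀ V : I → Fin m → ℝ, S.integral (fun t (_ : Unit) => V t) () =
        S₁.integral (fun t (_ : Unit) => V t) () + r * S₂.integral (fun t (_ : Unit) => V t) ())
    (s : ℝ) : S.eval s = S₁.eval s + r • S₂.eval s := by
  ext b
  simp only [eval_apply, h, Pi.add_apply, Pi.smul_apply, smul_eq_mul]

/-- The squared `L²` norm of a step function. -/
noncomputable def energy {m : ℕ} (S : StepFn m) : ℝ :=
  ∑ i ∈ Finset.range S.n, ((S.τ (i + 1) : ℝ) - S.τ i) * ∑ a, S.c i a ^ 2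

/-- The intervals $(\tau_i,\tau_{i+1}]$ are pairwise disjoint, so there are no cross terms. -/
theorem sum_sq_eval {m : ℕ} (S : StepFn m) (s : ℝ) :
    ∑ a, S.eval s a ^ 2 = ∑ i ∈ Finset.range S.n,
      (Ioc (S.τ i : ℝ) (S.τ (i + 1))).indicator (fun _ => ∑ a, S.c i a ^ 2) s := by
  by_cases h : ∃ i ∈ Finset.range S.n, s ∈ Ioc (S.τ i : ℝ) (S.τ (i + 1))
  · obtain ⟨i, hi, hs⟩ := h
    have hmono : Monotone fun i => (S.τ i : ℝ) := fun _ _ h => S.mono h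
    have hne : ∀ j, j ≠ i → s ∉ Ioc (S.τ j : ℝ) (S.τ (j + 1)) := fun j hj hs' =>
      (Set.disjoint_left.1 (hmono.pairwise_disjoint_on_Ioc_succ hj)) hs' hs
    rw [eval, Finset.sum_eq_single_of_mem i hi fun j _ hj => Set.indicator_of_notMem (hne j hj) _,
      Finset.sum_eq_single_of_mem i hi fun j _ hj => Set.indicator_of_notMem (hne j hj) _,
      Set.indicator_of_mem hs, Set.indicator_of_mem hs]
  · push Not at h
    rw [eval, Finset.sum_eq_zero fun i hi => Set.indicator_of_notMem (h i hi) _,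
      Finset.sum_eq_zero fun i hi => Set.indicator_of_notMem (h i hi) _]
    simp

theorem integral_sum_sq_eval {m : ℕ} (S : StepFn m) :
    ∫ s in Icc (0 : ℝ) 1, ∑ a, S.eval s a ^ 2 = S.energy := by
  simp_rw [sum_sq_eval]
  rw [integral_finsetSum]
  · refine Finset.sum_congr rfl fun i _ => ?_
    rw [integral_indicator measurableSet_Ioc, Measure.restrict_restrict measurableSet_Ioc,
      Set.inter_eq_left.2 (show Ioc (S.τ i : ℝ) (S.τ (i + 1)) ⊆ Icc 0 1 from
        fun x hx => ⟨(S.τ i).2.1.trans hx.1.le, hx.2.trans (S.τ (i + 1)).2.2⟩)]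
    have h : (S.τ i : ℝ) ≤ S.τ (i + 1) := S.mono (Nat.le_succ i)
    simp [h]
  · intro i _
    exact (integrable_const _).indicator measurableSet_Ioc

theorem measurable_eval {m : ℕ} (S : StepFn m) : Measurable S.eval := by
  have (i : ℕ) : Measurable ((Ioc (S.τ i : ℝ) (S.τ (i + 1))).indicator fun _ => S.c i) :=
    measurable_const.indicator measurableSet_Ioc
  unfold eval
  fun_prop

theorem norm_eval_le {m : ℕ} (S : StepFn m) (s : ℝ) :
    ‖S.eval s‖ ≤ ∑ i ∈ Finset.range S.n, ‖S.c i‖ :=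
  (norm_sum_le _ _).trans (Finset.sum_le_sum fun _ _ => norm_indicator_le_norm_self (fun _ => _) _)

end StepFn

/-! ### Gaussian laws of elementary integrals -/

theorem ProbabilityTheory.iIndepFun.hasLaw_gaussianReal_sum {Ω ι : Type*} [MeasurableSpace Ω]
    [Fintype ι] {P : Measure Ω} {Y : ι → Ω → ℝ} {v : ι → NNReal} (hY : iIndepFun Y P)
    (hl : ∀ i, HasLaw (Y i) (gaussianReal 0 (v i)) P) :
    HasLaw (fun ω => ∑ i, Y i ω) (gaussianReal 0 (∑ i, v i)) P := by
  have := hY.isProbabilityMeasure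
  have hm : ∀ i, AEMeasurable (Y i) P := fun i => (hl i).aemeasurable
  have hm' : AEMeasurable (fun ω => ∑ i, Y i ω) P := by fun_prop
  refine ⟨hm', ?_⟩
  have := Measure.isProbabilityMeasure_map (μ := P) hm'
  refine Measure.ext_of_charFun ?_
  have h := hY.charFun_map_fun_sum_eq_prod hm
  rw [h]
  ext t
  simp only [Finset.prod_apply, (hl _).map_eq, charFun_gaussianReal]
  rw [← Complex.exp_sum]
  congr 1
  simp [Finset.sum_mul, Finset.sum_div]

namespace IsWienerProcess

variable {Ω : Type*} [MeasurableSpace Ω] {m : ℕ} {P : Measure Ω} {W : I → Ω → Fin m → ℝ}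

/-- The law of an increment is a product measure, so its coordinates are independent centred
Gaussians and a linear combination of them is Gaussian. -/
theorem hasLaw_dotProduct_sub [IsProbabilityMeasure P] (hW : IsWienerProcess W P) {s t : I}
    (hst : s ≤ t) (c : Fin m → ℝ) :
    HasLaw (fun ω => c ⬝ᵥ (W t ω - W s ω))
      (gaussianReal 0 (Real.toNNReal (((t : ℝ) - s) * ∑ a, c a ^ 2))) P := by
  have hl := hW.law s t hst
  have hm : ∀ a, AEMeasurable (fun ω => (W t ω - W s ω) a) P := fun a =>
    (measurable_pi_apply a).comp_aemeasurable hl.aemeasurable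
  have h1 : ∀ a, HasLaw (fun ω => (W t ω - W s ω) a)
      (gaussianReal 0 (Real.toNNReal ((t : ℝ) - s))) P := fun a => by
    refine ⟨hm a, ?_⟩
    have := AEMeasurable.map_map_of_aemeasurable (measurable_pi_apply a).aemeasurable
      hl.aemeasurable
    rw [hl.map_eq] at this
    rw [show (fun ω => (W t ω - W s ω) a) = (fun x : Fin m → ℝ => x a) ∘ fun ω => W t ω - W s ω
      from rfl, ← this]
    exact (measurePreserving_eval _ a).map_eq
  have h2 : iIndepFun (fun a ω => (W t ω - W s ω) a) P := by
    rw [iIndepFun_iff_map_fun_eq_pi_map hm]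
    simp_rw [fun a => (h1 a).map_eq]
    exact hl.map_eq
  have h0 : ∀ a, HasLaw (fun ω => c a * (W t ω - W s ω) a)
      (gaussianReal 0 (.mk (c a ^ 2) (sq_nonneg _) * Real.toNNReal ((t : ℝ) - s))) P := fun a => by
    simpa only [mul_zero] using gaussianReal_const_mul (h1 a) (c a)
  have h3 := (h2.comp (fun a x => c a * x) fun a => by fun_prop).hasLaw_gaussianReal_sum h0
  convert h3 using 2
  · rfl
  · have hst' : (0 : ℝ) ≤ (t : ℝ) - s := sub_nonneg.2 hst
    rw [← Finset.sum_mul, Real.toNNReal_mul hst', mul_comm,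
      Real.toNNReal_sum_of_nonneg fun a _ => sq_nonneg _]
    congr 1
    refine Finset.sum_congr rfl fun a _ => ?_
    rw [Real.toNNReal_of_nonneg (sq_nonneg _)]

/-- This is the Itô isometry in law for step functions: independent increments add the variances up
to the energy. -/
theorem hasLaw_integral [IsProbabilityMeasure P] (hW : IsWienerProcess W P) (S : StepFn m) :
    HasLaw (S.integral W) (gaussianReal 0 (Real.toNNReal S.energy)) P := by
  have h1 := (hW.indep.nat S.mono).precomp (g := fun i : Fin S.n => (i : ℕ)) Fin.val_injective
  have h2 := (h1.comp (fun (i : Fin S.n) x => S.c i ⬝ᵥ x) fun i => by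
    unfold dotProduct; fun_prop).hasLaw_gaussianReal_sum
    fun i => hW.hasLaw_dotProduct_sub (S.mono (Nat.le_succ i)) (S.c i)
  convert h2 using 1
  · ext ω
    simp [StepFn.integral, Finset.sum_range]
  · congr 1
    rw [StepFn.energy, Real.toNNReal_sum_of_nonneg, Finset.sum_range]
    exact fun i _ => mul_nonneg (sub_nonneg.2 (S.mono (Nat.le_succ i)))
      (Finset.sum_nonneg fun _ _ => sq_nonneg _)

end IsWienerProcess

/-! ### The space `L²([0,1], ℝ^m)` -/

section L2Path

variable {m : ℕ} {v w : ℝ → Fin m → ℝ}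

theorem memLp_toLp (hv : MemLp v 2 (volume.restrict (Icc (0 : ℝ) 1))) :
    MemLp (fun t => WithLp.toLp 2 (v t)) 2 (volume.restrict (Icc (0 : ℝ) 1)) :=
  (EuclideanSpace.equiv (Fin m) ℝ).symm.toContinuousLinearMap.comp_memLp' hv

theorem toL2Path_eq (hv : MemLp v 2 (volume.restrict (Icc (0 : ℝ) 1))) :
    toL2Path v = (memLp_toLp hv).toLp := dif_pos (memLp_toLp hv)

theorem coeFn_toL2Path (hv : MemLp v 2 (volume.restrict (Icc (0 : ℝ) 1))) :
    toL2Path v =ᵐ[volume.restrict (Icc (0 : ℝ) 1)] fun t => WithLp.toLp 2 (v t) := by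
  rw [toL2Path_eq hv]
  exact MemLp.coeFn_toLp _

theorem toL2Path_congr (h : v =ᵐ[volume.restrict (Icc (0 : ℝ) 1)] w) :
    toL2Path v = toL2Path w := by
  have h' : (fun t => WithLp.toLp 2 (v t)) =ᵐ[volume.restrict (Icc (0 : ℝ) 1)]
      fun t => WithLp.toLp 2 (w t) := h.mono fun t ht => by simp only [ht]
  unfold toL2Path
  by_cases hv : MemLp (fun t => WithLp.toLp 2 (v t)) 2 (volume.restrict (Icc (0 : ℝ) 1))
  · rw [dif_pos hv, dif_pos ((memLp_congr_ae h').1 hv), MemLp.toLp_eq_toLp_iff]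
    exact h'
  · rw [dif_neg hv, dif_neg fun hw => hv ((memLp_congr_ae h').2 hw)]

theorem toL2Path_add (hv : MemLp v 2 (volume.restrict (Icc (0 : ℝ) 1)))
    (hw : MemLp w 2 (volume.restrict (Icc (0 : ℝ) 1))) :
    toL2Path (fun t => v t + w t) = toL2Path v + toL2Path w := by
  have h := toL2Path_eq (hv.add hw)
  rw [toL2Path_eq hv, toL2Path_eq hw, ← MemLp.toLp_add]
  exact h

theorem toL2Path_smul (r : ℝ) (hv : MemLp v 2 (volume.restrict (Icc (0 : ℝ) 1))) :
    toL2Path (fun t => r • v t) = r • toL2Path v := by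
  have h := toL2Path_eq (hv.const_smul r)
  rw [toL2Path_eq hv, ← MemLp.toLp_const_smul]
  exact h

theorem toL2Path_zero : toL2Path (fun _ => (0 : Fin m → ℝ)) = 0 := by
  simpa using toL2Path_smul (0 : ℝ) (v := fun _ => (0 : Fin m → ℝ)) MemLp.zero

theorem toL2Path_sum {ι : Type*} (s : Finset ι) {u : ι → ℝ → Fin m → ℝ}
    (hu : ∀ i ∈ s, MemLp (u i) 2 (volume.restrict (Icc (0 : ℝ) 1))) :
    toL2Path (fun t => ∑ i ∈ s, u i t) = ∑ i ∈ s, toL2Path (u i) := by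
  classical
  induction s using Finset.induction_on with
  | empty => simpa using toL2Path_zero
  | insert a s ha ih =>
    simp only [Finset.sum_insert ha]
    rw [toL2Path_add (hu a (Finset.mem_insert_self a s))
      (memLp_finsetSum s fun i hi => hu i (Finset.mem_insert_of_mem hi)),
      ih fun i hi => hu i (Finset.mem_insert_of_mem hi)]

theorem inner_toL2Path (hv : MemLp v 2 (volume.restrict (Icc (0 : ℝ) 1)))
    (hw : MemLp w 2 (volume.restrict (Icc (0 : ℝ) 1))) :
    inner ℝ (toL2Path v) (toL2Path w) = ∫ s in Icc (0 : ℝ) 1, v s ⬝ᵥ w s := by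
  rw [L2.inner_def]
  refine integral_congr_ae ?_
  filter_upwards [coeFn_toL2Path hv, coeFn_toL2Path hw] with s h1 h2
  rw [h1, h2, PiLp.inner_apply]
  simp [dotProduct, mul_comm]

theorem norm_sq_toL2Path (hv : MemLp v 2 (volume.restrict (Icc (0 : ℝ) 1))) :
    ‖toL2Path v‖ ^ 2 = ∫ s in Icc (0 : ℝ) 1, ∑ a, v s a ^ 2 := by
  rw [← real_inner_self_eq_norm_sq, inner_toL2Path hv hv]
  simp [dotProduct, sq]

/-- `L2Path` uses the Euclidean norm on $\mathbb R^m$, while the `eLpNorm` in the definition of the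
Wiener integral uses the sup norm. The linear equivalence bounds each by a multiple of the other. -/
theorem tendsto_toL2Path_iff {u : ℕ → ℝ → Fin m → ℝ}
    (hu : ∀ q, MemLp (u q) 2 (volume.restrict (Icc (0 : ℝ) 1)))
    (hv : MemLp v 2 (volume.restrict (Icc (0 : ℝ) 1))) :
    Tendsto (fun q => toL2Path (u q)) atTop (𝓝 (toL2Path v)) ↔
      Tendsto (fun q => eLpNorm (fun s => u q s - v s) 2 (volume.restrict (Icc (0 : ℝ) 1)))
        atTop (𝓝 0) := by
  let A := (EuclideanSpace.equiv (Fin m) ℝ).symm.toContinuousLinearMap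
  let B := (EuclideanSpace.equiv (Fin m) ℝ).toContinuousLinearMap
  have h1 : ∀ q, edist (toL2Path (u q)) (toL2Path v) =
      eLpNorm (fun s => A (u q s - v s)) 2 (volume.restrict (Icc (0 : ℝ) 1)) := fun q => by
    rw [toL2Path_eq (hu q), toL2Path_eq hv, Lp.edist_toLp_toLp]
    rfl
  rw [tendsto_iff_edist_tendsto_0]
  simp_rw [h1]
  constructor
  · intro h
    have h2 : ∀ q, eLpNorm (fun s => u q s - v s) 2 (volume.restrict (Icc (0 : ℝ) 1)) ≤
        ENNReal.ofReal ‖B‖ *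
          eLpNorm (fun s => A (u q s - v s)) 2 (volume.restrict (Icc (0 : ℝ) 1)) := fun q =>
      eLpNorm_le_mul_eLpNorm_of_ae_le_mul
        (ae_of_all _ fun s => B.le_opNorm (A (u q s - v s))) 2
    refine tendsto_of_tendsto_of_tendsto_of_le_of_le tendsto_const_nhds ?_ (fun _ => zero_le) h2
    simpa only [mul_zero] using ENNReal.Tendsto.const_mul h (Or.inr ENNReal.ofReal_ne_top)
  · intro h
    have h2 : ∀ q, eLpNorm (fun s => A (u q s - v s)) 2 (volume.restrict (Icc (0 : ℝ) 1)) ≤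
        ENNReal.ofReal ‖A‖ *
          eLpNorm (fun s => u q s - v s) 2 (volume.restrict (Icc (0 : ℝ) 1)) := fun q =>
      eLpNorm_le_mul_eLpNorm_of_ae_le_mul (ae_of_all _ fun s => A.le_opNorm (u q s - v s)) 2
    refine tendsto_of_tendsto_of_tendsto_of_le_of_le tendsto_const_nhds ?_ (fun _ => zero_le) h2
    simpa only [mul_zero] using ENNReal.Tendsto.const_mul h (Or.inr ENNReal.ofReal_ne_top)

theorem StepFn.memLp_eval (S : StepFn m) :
    MemLp S.eval 2 (volume.restrict (Icc (0 : ℝ) 1)) :=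
  MemLp.of_bound S.measurable_eval.aestronglyMeasurable _ (ae_of_all _ S.norm_eval_le)

theorem StepFn.norm_sq_toL2Path_eval (S : StepFn m) : ‖toL2Path S.eval‖ ^ 2 = S.energy := by
  rw [norm_sq_toL2Path S.memLp_eval, S.integral_sum_sq_eval]

end L2Path

/-! ### The Wiener integral on `L²([0,1], ℝ^m)` -/

section WienerIntegral

variable {Ω : Type*} [MeasurableSpace Ω] {m : ℕ}

/-- `Y` is a version of the Wiener integral of the class `w`. -/
def IsL2WienerIntegral (W : I → Ω → Fin m → ℝ) (P : Measure Ω) (w : L2Path m) (Y : Ω → ℝ) : Prop :=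
  MemLp Y 2 P ∧ ∃ S : ℕ → StepFn m,
    Tendsto (fun q => toL2Path (S q).eval) atTop (𝓝 w) ∧
    Tendsto (fun q => eLpNorm (fun ω => (S q).integral W ω - Y ω) 2 P) atTop (𝓝 0)

variable {W : I → Ω → Fin m → ℝ} {P : Measure Ω}

theorem isWienerIntegral_iff {v : ℝ → Fin m → ℝ} {Y : Ω → ℝ}
    (hv : MemLp v 2 (volume.restrict (Icc (0 : ℝ) 1))) :
    IsWienerIntegral W P v Y ↔ IsL2WienerIntegral W P (toL2Path v) Y := by
  simp only [IsWienerIntegral, IsL2WienerIntegral,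
    tendsto_toL2Path_iff (fun q => StepFn.memLp_eval _) hv]

namespace IsL2WienerIntegral

theorem congr {w : L2Path m} {Y Y' : Ω → ℝ} (h : IsL2WienerIntegral W P w Y) (hY : Y =ᵐ[P] Y') :
    IsL2WienerIntegral W P w Y' := by
  obtain ⟨h1, S, h2, h3⟩ := h
  refine ⟨(memLp_congr_ae hY).1 h1, S, h2, ?_⟩
  convert h3 using 2 with q
  refine eLpNorm_congr_ae ?_
  filter_upwards [hY] with ω hω
  rw [hω]

theorem aestronglyMeasurable_integral [IsProbabilityMeasure P] (hW : IsWienerProcess W P)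
    (S : StepFn m) : AEStronglyMeasurable (S.integral W) P :=
  (hW.hasLaw_integral S).aemeasurable.aestronglyMeasurable

/-- The operation from which `smul`, `add`, `sub` and `sum` are derived. Approximating step
functions are combined over a common refinement of their subdivisions. -/
theorem add_smul [IsProbabilityMeasure P] (hW : IsWienerProcess W P) {w₁ w₂ : L2Path m}
    {Y₁ Y₂ : Ω → ℝ} (h₁ : IsL2WienerIntegral W P w₁ Y₁) (h₂ : IsL2WienerIntegral W P w₂ Y₂)
    (r : ℝ) : IsL2WienerIntegral W P (w₁ + r • w₂) (fun ω => Y₁ ω + r * Y₂ ω) := by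
  obtain ⟨hY₁, S₁, hw₁, hS₁⟩ := h₁
  obtain ⟨hY₂, S₂, hw₂, hS₂⟩ := h₂
  choose S hS using fun q => (S₁ q).exists_add_smul (S₂ q) r
  refine ⟨hY₁.add (hY₂.const_mul r), S, ?_, ?_⟩
  · have : ∀ q, toL2Path (S q).eval = toL2Path (S₁ q).eval + r • toL2Path (S₂ q).eval := fun q => by
      rw [← toL2Path_smul r (S₂ q).memLp_eval,
        ← toL2Path_add (S₁ q).memLp_eval (w := fun t => r • (S₂ q).eval t)
          ((S₂ q).memLp_eval.const_smul r)]
      exact congrArg toL2Path (funext fun s => StepFn.eval_eq_of_integral_eq (hS q) s)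
    simp_rw [this]
    exact hw₁.add (hw₂.const_smul r)
  · have hle : ∀ q, eLpNorm (fun ω => (S q).integral W ω - (Y₁ ω + r * Y₂ ω)) 2 P ≤
        eLpNorm (fun ω => (S₁ q).integral W ω - Y₁ ω) 2 P +
          ENNReal.ofReal ‖r‖ * eLpNorm (fun ω => (S₂ q).integral W ω - Y₂ ω) 2 P := fun q => by
      have he : (fun ω => (S q).integral W ω - (Y₁ ω + r * Y₂ ω)) =
          (fun ω => (S₁ q).integral W ω - Y₁ ω) +
            r • fun ω => (S₂ q).integral W ω - Y₂ ω := by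
        ext ω
        have : (S q).integral W ω = (S₁ q).integral W ω + r * (S₂ q).integral W ω :=
          hS q fun t => W t ω
        simp only [this, Pi.add_apply, Pi.smul_apply, smul_eq_mul]
        ring
      rw [he]
      refine (eLpNorm_add_le ((aestronglyMeasurable_integral hW _).sub hY₁.1)
        (((aestronglyMeasurable_integral hW _).sub hY₂.1).const_smul r) (by norm_num)).trans ?_
      rw [eLpNorm_const_smul, ofReal_norm]
      rfl
    refine tendsto_of_tendsto_of_tendsto_of_le_of_le tendsto_const_nhds ?_ (fun _ => zero_le) hle
    simpa only [mul_zero, add_zero] using hS₁.add (ENNReal.Tendsto.const_mul hS₂ (Or.inr ENNReal.ofReal_ne_top))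

theorem zero : IsL2WienerIntegral W P 0 (fun _ => 0) := by
  refine ⟨MemLp.zero, fun _ => ⟨0, fun _ => 0, monotone_const, 0⟩, ?_, ?_⟩
  · have : ∀ s, (⟨0, fun _ => 0, monotone_const, 0⟩ : StepFn m).eval s = 0 := fun s => by
      simp [StepFn.eval]
    simp only [funext this, toL2Path_zero, tendsto_const_nhds]
  · simp [StepFn.integral]

theorem smul [IsProbabilityMeasure P] (hW : IsWienerProcess W P) {w : L2Path m}
    {Y : Ω → ℝ} (h : IsL2WienerIntegral W P w Y) (r : ℝ) :
    IsL2WienerIntegral W P (r • w) (fun ω => r * Y ω) := by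
  simpa using zero.add_smul hW h r

theorem add [IsProbabilityMeasure P] (hW : IsWienerProcess W P) {w₁ w₂ : L2Path m}
    {Y₁ Y₂ : Ω → ℝ} (h₁ : IsL2WienerIntegral W P w₁ Y₁) (h₂ : IsL2WienerIntegral W P w₂ Y₂) :
    IsL2WienerIntegral W P (w₁ + w₂) (fun ω => Y₁ ω + Y₂ ω) := by
  simpa using h₁.add_smul hW h₂ 1

theorem sub [IsProbabilityMeasure P] (hW : IsWienerProcess W P) {w₁ w₂ : L2Path m}
    {Y₁ Y₂ : Ω → ℝ} (h₁ : IsL2WienerIntegral W P w₁ Y₁) (h₂ : IsL2WienerIntegral W P w₂ Y₂) :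
    IsL2WienerIntegral W P (w₁ - w₂) (fun ω => Y₁ ω - Y₂ ω) := by
  simpa [sub_eq_add_neg] using h₁.add_smul hW h₂ (-1)

theorem sum [IsProbabilityMeasure P] (hW : IsWienerProcess W P) {ι : Type*} (s : Finset ι)
    {w : ι → L2Path m} {Y : ι → Ω → ℝ} (h : ∀ i ∈ s, IsL2WienerIntegral W P (w i) (Y i)) :
    IsL2WienerIntegral W P (∑ i ∈ s, w i) (fun ω => ∑ i ∈ s, Y i ω) := by
  classical
  induction s using Finset.induction_on with
  | empty => simpa using zero
  | insert a s ha ih =>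
    simp only [Finset.sum_insert ha]
    exact (h a (Finset.mem_insert_self a s)).add hW
      (ih fun i hi => h i (Finset.mem_insert_of_mem hi))

end IsL2WienerIntegral

end WienerIntegral

/-! ### Gaussian laws of Wiener integrals -/

/-- Dominated convergence: the integrand has modulus one. -/
theorem tendsto_charFun_map_of_ae_tendsto {Ω : Type*} [MeasurableSpace Ω] {P : Measure Ω}
    [IsProbabilityMeasure P] {Y : ℕ → Ω → ℝ} {Y' : Ω → ℝ} (hY : ∀ q, AEMeasurable (Y q) P)
    (hY' : AEMeasurable Y' P) (h : ∀ᵐ ω ∂P, Tendsto (fun q => Y q ω) atTop (𝓝 (Y' ω))) (θ : ℝ) :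
    Tendsto (fun q => charFun (P.map (Y q)) θ) atTop (𝓝 (charFun (P.map Y') θ)) := by
  have hm : Measurable fun x : ℝ => Complex.exp (θ * x * Complex.I) := by fun_prop
  simp_rw [charFun_apply_real]
  rw [integral_map hY' hm.aestronglyMeasurable]
  simp_rw [fun q => integral_map (hY q) hm.aestronglyMeasurable]
  refine tendsto_integral_of_dominated_convergence (fun _ => 1)
    (fun q => (hm.comp_aemeasurable (hY q)).aestronglyMeasurable) (integrable_const _)
    (fun q => ae_of_all _ fun ω => ?_) ?_
  · have := Complex.norm_exp_ofReal_mul_I (θ * Y q ω)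
    push_cast at this
    exact this.le
  · filter_upwards [h] with ω hω
    have hc : Continuous fun x : ℝ => Complex.exp (θ * x * Complex.I) := by fun_prop
    exact (hc.tendsto _).comp hω

theorem charFun_map_of_hasLaw_gaussianReal {Ω : Type*} [MeasurableSpace Ω] {P : Measure Ω}
    {Y : Ω → ℝ} {v : ℝ} (hv : 0 ≤ v) (h : HasLaw Y (gaussianReal 0 v.toNNReal) P) (θ : ℝ) :
    charFun (P.map Y) θ = Complex.exp (-(v * θ ^ 2 / 2) : ℝ) := by
  rw [h.map_eq, charFun_gaussianReal, Real.coe_toNNReal v hv]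
  congr 1
  push_cast
  ring

section WienerIntegral

variable {Ω : Type*} [MeasurableSpace Ω] {m : ℕ} {W : I → Ω → Fin m → ℝ} {P : Measure Ω}
  [IsProbabilityMeasure P]

namespace IsL2WienerIntegral

/-- Convergence in $L^2(\Omega)$ gives an almost surely convergent subsequence, along which the
Gaussian characteristic functions of the elementary integrals converge to the one with variance
$\|w\|^2$. -/
theorem hasLaw (hW : IsWienerProcess W P) {w : L2Path m} {Y : Ω → ℝ}
    (h : IsL2WienerIntegral W P w Y) :
    HasLaw Y (gaussianReal 0 (‖w‖ ^ 2).toNNReal) P := by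
  obtain ⟨hY, S, hw, hS⟩ := h
  have hSm : ∀ q, AEMeasurable ((S q).integral W) P := fun q => (hW.hasLaw_integral _).aemeasurable
  have hYm : AEMeasurable Y P := hY.1.aemeasurable
  have hS' : Tendsto (fun q => eLpNorm ((S q).integral W - Y) 2 P) atTop (𝓝 0) := hS
  obtain ⟨ns, hns, hae⟩ := (tendstoInMeasure_of_tendsto_eLpNorm (by norm_num)
    (fun q => (hSm q).aestronglyMeasurable) hY.1 hS').exists_seq_tendsto_ae
  refine ⟨hYm, ?_⟩
  have := Measure.isProbabilityMeasure_map (μ := P) hYm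
  refine Measure.ext_of_charFun (funext fun θ => ?_)
  refine tendsto_nhds_unique
    (tendsto_charFun_map_of_ae_tendsto (fun q => hSm (ns q)) hYm hae θ) ?_
  have h1 : ∀ q, charFun (P.map ((S (ns q)).integral W)) θ =
      Complex.exp (-(‖toL2Path (S (ns q)).eval‖ ^ 2 * θ ^ 2 / 2) : ℝ) := fun q => by
    refine charFun_map_of_hasLaw_gaussianReal (sq_nonneg _) ?_ θ
    rw [StepFn.norm_sq_toL2Path_eval]
    exact hW.hasLaw_integral _
  simp_rw [h1]
  have h2 : charFun (gaussianReal 0 (‖w‖ ^ 2).toNNReal) θ =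
      Complex.exp (-(‖w‖ ^ 2 * θ ^ 2 / 2) : ℝ) := by
    rw [charFun_gaussianReal, Real.coe_toNNReal _ (sq_nonneg _)]
    congr 1
    push_cast
    ring
  rw [h2]
  have hc : Continuous fun x : L2Path m => Complex.exp (-(‖x‖ ^ 2 * θ ^ 2 / 2) : ℝ) := by fun_prop
  exact (hc.tendsto w).comp (hw.comp hns.tendsto_atTop)

theorem charFun_map (hW : IsWienerProcess W P) {w : L2Path m} {Y : Ω → ℝ}
    (h : IsL2WienerIntegral W P w Y) (θ : ℝ) :
    charFun (P.map Y) θ = Complex.exp (-(‖w‖ ^ 2 * θ ^ 2 / 2) : ℝ) :=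
  charFun_map_of_hasLaw_gaussianReal (sq_nonneg _) (h.hasLaw hW) θ

theorem integral_eq_zero (hW : IsWienerProcess W P) {w : L2Path m} {Y : Ω → ℝ}
    (h : IsL2WienerIntegral W P w Y) : ∫ ω, Y ω ∂P = 0 := by
  rw [(h.hasLaw hW).integral_eq, integral_id_gaussianReal]

theorem variance_eq (hW : IsWienerProcess W P) {w : L2Path m} {Y : Ω → ℝ}
    (h : IsL2WienerIntegral W P w Y) : Var[Y; P] = ‖w‖ ^ 2 := by
  rw [(h.hasLaw hW).variance_eq, variance_id_gaussianReal, Real.coe_toNNReal _ (sq_nonneg _)]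

/-- Polarization of the variance formula. -/
theorem covariance_eq (hW : IsWienerProcess W P) {w₁ w₂ : L2Path m} {Y₁ Y₂ : Ω → ℝ}
    (h₁ : IsL2WienerIntegral W P w₁ Y₁) (h₂ : IsL2WienerIntegral W P w₂ Y₂) :
    cov[Y₁, Y₂; P] = inner ℝ w₁ w₂ := by
  have h := variance_add h₁.1 h₂.1
  rw [h₁.variance_eq hW, h₂.variance_eq hW] at h
  have h' := (h₁.add hW h₂).variance_eq hW
  rw [show (fun ω => Y₁ ω + Y₂ ω) = Y₁ + Y₂ from rfl, h, norm_add_sq_real] at h'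
  linarith

/-- A linear functional of finitely many Wiener integrals is again a Wiener integral, hence
Gaussian. -/
theorem isGaussianProcess (hW : IsWienerProcess W P) {T : Type*} {w : T → L2Path m}
    {Y : T → Ω → ℝ} (h : ∀ t, IsL2WienerIntegral W P (w t) (Y t)) : IsGaussianProcess Y P := by
  refine ⟨fun J => ⟨isGaussian_of_map_eq_gaussianReal fun L => ?_⟩⟩
  classical
  have hm : AEMeasurable (fun ω => J.restrict fun t => Y t ω) P :=
    aemeasurable_pi_lambda _ fun t => (h t).1.1.aemeasurable
  have h1 := sum hW (Finset.univ : Finset J) fun t _ => (h t).smul hW (L (Pi.single t 1))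
  refine ⟨0, (‖∑ t : J, L (Pi.single t 1) • w t‖ ^ 2).toNNReal, ?_⟩
  rw [AEMeasurable.map_map_of_aemeasurable (by fun_prop) hm, ← (h1.hasLaw hW).map_eq]
  congr 1
  ext ω
  have : (J.restrict fun t => Y t ω) = ∑ t : J, Y t ω • Pi.single t (1 : ℝ) := by
    ext t
    simp [Finset.sum_apply, Pi.single_apply]
  rw [Function.comp_apply, this, map_sum]
  simp [mul_comm]

end IsL2WienerIntegral

end WienerIntegral

/-! ### The flow and the functions `g`, `f`, `h` -/

section

attribute [local instance] Matrix.linftyOpNormedRing Matrix.linftyOpNormedAlgebra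

/-- The field is Lipschitz with constant a bound of $\|\alpha\|$ on the compact interval, so
uniqueness holds forwards on $[t_0,1]$ and backwards on $[0,t_0]$. The $\ell^\infty$ operator norm
is the one compatible with the sup norm on vectors. -/
theorem eqOn_of_hasDerivWithinAt_mulVec {d : ℕ} {α : ℝ → Matrix (Fin d) (Fin d) ℝ}
    (hα : ContinuousOn α (Icc 0 1)) {y z : ℝ → Fin d → ℝ}
    (hy : ∀ t ∈ Icc (0 : ℝ) 1, HasDerivWithinAt y (α t *ᵥ y t) (Icc 0 1) t)
    (hz : ∀ t ∈ Icc (0 : ℝ) 1, HasDerivWithinAt z (α t *ᵥ z t) (Icc 0 1) t)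
    {t₀ : ℝ} (ht₀ : t₀ ∈ Icc (0 : ℝ) 1) (h : y t₀ = z t₀) : EqOn y z (Icc 0 1) := by
  obtain ⟨C, hC⟩ := isCompact_Icc.exists_bound_of_continuousOn hα
  have hlip : ∀ t ∈ Icc (0 : ℝ) 1,
      LipschitzOnWith C.toNNReal (fun x : Fin d → ℝ => α t *ᵥ x) univ := fun t ht => by
    refine LipschitzOnWith.of_dist_le_mul fun x _ x' _ => ?_
    rw [dist_eq_norm, dist_eq_norm, ← Matrix.mulVec_sub]
    refine (Matrix.linfty_opNorm_mulVec _ _).trans ?_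
    gcongr
    exact (hC t ht).trans (Real.le_coe_toNNReal C)
  have hyc : ContinuousOn y (Icc 0 1) := fun t ht => (hy t ht).continuousWithinAt
  have hzc : ContinuousOn z (Icc 0 1) := fun t ht => (hz t ht).continuousWithinAt
  have hl : Icc 0 t₀ ⊆ Icc (0 : ℝ) 1 := Icc_subset_Icc_right ht₀.2
  have hr : Icc t₀ 1 ⊆ Icc (0 : ℝ) 1 := Icc_subset_Icc_left ht₀.1
  have h1 : EqOn y z (Icc 0 t₀) := by
    refine ODE_solution_unique_of_mem_Icc_left (v := fun t x => α t *ᵥ x) (s := fun _ => univ)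
      (K := C.toNNReal) (fun t ht => hlip t (hl ⟨ht.1.le, ht.2⟩)) (hyc.mono hl) (fun t ht => ?_)
      (fun _ _ => trivial) (hzc.mono hl) (fun t ht => ?_) (fun _ _ => trivial) h
    · exact (hy t (hl ⟨ht.1.le, ht.2⟩)).mono_of_mem_nhdsWithin
        (Icc_mem_nhdsLE_of_mem ⟨ht.1, ht.2.trans ht₀.2⟩)
    · exact (hz t (hl ⟨ht.1.le, ht.2⟩)).mono_of_mem_nhdsWithin
        (Icc_mem_nhdsLE_of_mem ⟨ht.1, ht.2.trans ht₀.2⟩)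
  have h2 : EqOn y z (Icc t₀ 1) := by
    refine ODE_solution_unique_of_mem_Icc_right (v := fun t x => α t *ᵥ x) (s := fun _ => univ)
      (K := C.toNNReal) (fun t ht => hlip t (hr ⟨ht.1, ht.2.le⟩)) (hyc.mono hr) (fun t ht => ?_)
      (fun _ _ => trivial) (hzc.mono hr) (fun t ht => ?_) (fun _ _ => trivial) h
    · exact (hy t (hr ⟨ht.1, ht.2.le⟩)).mono_of_mem_nhdsWithin
        (Icc_mem_nhdsGE_of_mem ⟨ht₀.1.trans ht.1, ht.2⟩)
    · exact (hz t (hr ⟨ht.1, ht.2.le⟩)).mono_of_mem_nhdsWithin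
        (Icc_mem_nhdsGE_of_mem ⟨ht₀.1.trans ht.1, ht.2⟩)
  intro t ht
  rcases le_total t t₀ with h' | h'
  · exact h1 ⟨ht.1, h'⟩
  · exact h2 ⟨h', ht.2⟩

end

/-- As functions of $w$, the columns of both sides solve the same equation and agree at $w=v$. -/
theorem IsFlow.mul {d : ℕ} {α : ℝ → Matrix (Fin d) (Fin d) ℝ} (hα : ContinuousOn α (Icc 0 1))
    {F : ℝ → ℝ → Matrix (Fin d) (Fin d) ℝ} (hF : IsFlow α F) {u v w : ℝ}
    (hu : u ∈ Icc (0 : ℝ) 1) (hv : v ∈ Icc (0 : ℝ) 1) (hw : w ∈ Icc (0 : ℝ) 1) :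
    F v w * F u v = F u w := by
  ext i j
  have h := eqOn_of_hasDerivWithinAt_mulVec hα (y := fun s a => (F v s * F u v) a j)
    (z := fun s a => F u s a j) (fun t ht => ?_) (fun t ht => ?_) hv ?_
  · exact congrFun (h hw) i
  · rw [hasDerivWithinAt_pi]
    intro a
    have : HasDerivWithinAt (fun s => ∑ b, F v s a b * F u v b j)
        (∑ b, (α t * F v t) a b * F u v b j) (Icc 0 1) t :=
      HasDerivWithinAt.fun_sum fun b _ => ((hF v hv).2 t ht a b).mul_const _
    have e : (α t *ᵥ fun a => (F v t * F u v) a j) a = ∑ b, (α t * F v t) a b * F u v b j := by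
      rw [← Matrix.mul_apply, Matrix.mul_assoc, Matrix.mul_apply]
      rfl
    rw [e]
    exact this
  · rw [hasDerivWithinAt_pi]
    intro a
    exact (hF u hu).2 t ht a j
  · ext a
    simp [(hF v hv).1]

namespace GaussMarkov

variable {d m : ℕ} (G : GaussMarkov d m)

theorem F_mul_F {u v w : ℝ} (hu : u ∈ Icc (0 : ℝ) 1) (hv : v ∈ Icc (0 : ℝ) 1)
    (hw : w ∈ Icc (0 : ℝ) 1) : G.F v w * G.F u v = G.F u w :=
  G.isFlow_F.mul G.continuousOn_α hu hv hw

theorem F_zero_mul_g {t : ℝ} (ht : t ∈ Icc (0 : ℝ) 1) : G.F t 0 * G.g t = 1 := by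
  have h0 : (0 : ℝ) ∈ Icc (0 : ℝ) 1 := ⟨le_rfl, zero_le_one⟩
  rw [g, G.F_mul_F h0 ht h0, (G.isFlow_F 0 h0).1]

theorem isUnit_det_g {t : ℝ} (ht : t ∈ Icc (0 : ℝ) 1) : IsUnit (G.g t).det :=
  Matrix.isUnit_det_of_left_inverse (G.F_zero_mul_g ht)

theorem inv_g {t : ℝ} (ht : t ∈ Icc (0 : ℝ) 1) : (G.g t)⁻¹ = G.F t 0 :=
  Matrix.inv_eq_left_inv (G.F_zero_mul_g ht)

theorem F_eq {u v : ℝ} (hu : u ∈ Icc (0 : ℝ) 1) (hv : v ∈ Icc (0 : ℝ) 1) :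
    G.F u v = G.g v * (G.g u)⁻¹ := by
  have h0 : (0 : ℝ) ∈ Icc (0 : ℝ) 1 := ⟨le_rfl, zero_le_one⟩
  rw [G.inv_g hu, g, G.F_mul_F hu h0 hv]

theorem continuousOn_g : ContinuousOn G.g (Icc 0 1) := by
  have h0 : (0 : ℝ) ∈ Icc (0 : ℝ) 1 := ⟨le_rfl, zero_le_one⟩
  refine continuousOn_pi.2 fun i => continuousOn_pi.2 fun j => fun t ht => ?_
  exact ((G.isFlow_F 0 h0).2 t ht i j).continuousWithinAt

/-- `IsFlow` says nothing about regularity in the first argument, so continuity of $t\mapsto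
F(t,0)$, which enters $f$, is obtained from $F(t,0)=g(t)^{-1}$ and the adjugate formula. -/
theorem continuousOn_inv_g : ContinuousOn (fun t => (G.g t)⁻¹) (Icc 0 1) := by
  have h1 : ContinuousOn (fun t => ((G.g t).det)⁻¹ • (G.g t).adjugate) (Icc 0 1) := by
    refine ContinuousOn.smul (ContinuousOn.inv₀ ?_ fun t ht => (G.isUnit_det_g ht).ne_zero) ?_
    · exact (Continuous.matrix_det continuous_id).comp_continuousOn G.continuousOn_g
    · exact (Continuous.matrix_adjugate continuous_id).comp_continuousOn G.continuousOn_g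
  refine h1.congr fun t _ => ?_
  simp only [Matrix.inv_def, Ring.inverse_eq_inv']

theorem continuousOn_f : ContinuousOn G.f (Icc 0 1) := by
  have h : ContinuousOn (fun t => (G.g t)⁻¹ * G.sqrtΓ t) (Icc 0 1) :=
    (Continuous.matrix_mul continuous_fst continuous_snd).comp_continuousOn
      (G.continuousOn_inv_g.prodMk G.continuousOn_sqrtΓ)
  refine h.congr fun t ht => ?_
  simp only [f, G.inv_g ht]

theorem F_mul_Γ_mul_F {u w : ℝ} (hu : u ∈ Icc (0 : ℝ) 1) (hw : w ∈ Icc (0 : ℝ) 1) :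
    G.F w u * G.Γ w * (G.F w u)ᵀ = G.g u * (G.f w * (G.f w)ᵀ) * (G.g u)ᵀ := by
  rw [G.F_eq hw hu, G.inv_g hw, f, Γ]
  simp only [Matrix.transpose_mul, Matrix.mul_assoc]

theorem h_apply {s t : ℝ} (i j : Fin d) :
    G.h s t i j = ∫ w in s..t, (G.f w * (G.f w)ᵀ) i j := by
  simp only [h, hAt, Matrix.of_apply, f, Γ, Matrix.transpose_mul, Matrix.mul_assoc]

theorem continuousOn_f_mul_f (i j : Fin d) :
    ContinuousOn (fun w => (G.f w * (G.f w)ᵀ) i j) (Icc 0 1) := by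
  have h : ContinuousOn (fun w => G.f w * (G.f w)ᵀ) (Icc 0 1) :=
    (Continuous.matrix_mul continuous_id (Continuous.matrix_transpose continuous_id)
      ).comp_continuousOn G.continuousOn_f
  exact continuousOn_pi.1 (continuousOn_pi.1 h i) j

theorem intervalIntegrable_f_mul_f {s t : ℝ} (hs : s ∈ Icc (0 : ℝ) 1) (ht : t ∈ Icc (0 : ℝ) 1)
    (i j : Fin d) : IntervalIntegrable (fun w => (G.f w * (G.f w)ᵀ) i j) volume s t :=
  ((G.continuousOn_f_mul_f i j).mono (uIcc_subset_Icc hs ht)).intervalIntegrable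

/-- Since $F(w,u)=g(u)F(w,0)$, changing the reference time is a congruence by the constant matrix
$g(u)$. From here on only $h=h_0$ matters. -/
theorem hAt_eq {u s t : ℝ} (hu : u ∈ Icc (0 : ℝ) 1) (hs : s ∈ Icc (0 : ℝ) 1)
    (ht : t ∈ Icc (0 : ℝ) 1) : G.hAt u s t = G.g u * G.h s t * (G.g u)ᵀ := by
  ext i j
  have h1 : G.hAt u s t i j =
      ∫ w in s..t, ∑ l, (∑ k, G.g u i k * (G.f w * (G.f w)ᵀ) k l) * G.g u j l := by
    refine intervalIntegral.integral_congr fun w hw => ?_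
    simp only [G.F_mul_Γ_mul_F hu (uIcc_subset_Icc hs ht hw)]
    rw [Matrix.mul_apply]
    simp only [Matrix.transpose_apply, Matrix.mul_apply (M := G.g u)]
  have hint : ∀ k l, IntervalIntegrable (fun w => G.g u i k * (G.f w * (G.f w)ᵀ) k l) volume s t :=
    fun k l => (G.intervalIntegrable_f_mul_f hs ht k l).const_mul _
  have hint' : ∀ l, IntervalIntegrable
      (fun w => (∑ k, G.g u i k * (G.f w * (G.f w)ᵀ) k l) * G.g u j l) volume s t := fun l => by
    refine IntervalIntegrable.mul_const ?_ _
    have := IntervalIntegrable.sum Finset.univ fun k _ => hint k l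
    simpa only [Finset.sum_fn] using this
  rw [h1, intervalIntegral.integral_finsetSum fun l _ => hint' l, Matrix.mul_apply]
  refine Finset.sum_congr rfl fun l _ => ?_
  rw [intervalIntegral.integral_mul_const, intervalIntegral.integral_finsetSum
    fun k _ => hint k l, Matrix.mul_apply]
  simp only [intervalIntegral.integral_const_mul, ← h_apply, Matrix.transpose_apply]

theorem h_add_h {s t u : ℝ} (hs : s ∈ Icc (0 : ℝ) 1) (ht : t ∈ Icc (0 : ℝ) 1)
    (hu : u ∈ Icc (0 : ℝ) 1) : G.h s t + G.h t u = G.h s u := by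
  ext i j
  simp only [Matrix.add_apply, h_apply]
  exact intervalIntegral.integral_add_adjacent_intervals
    (G.intervalIntegrable_f_mul_f hs ht i j) (G.intervalIntegrable_f_mul_f ht hu i j)

@[simp]
theorem h_self (s : ℝ) : G.h s s = 0 := by
  ext i j
  simp [h_apply]

@[simp]
theorem transpose_h (s t : ℝ) : (G.h s t)ᵀ = G.h s t := by
  ext i j
  simp only [Matrix.transpose_apply, h_apply, Matrix.mul_apply, mul_comm]

theorem continuousOn_h : ContinuousOn (fun t => G.h 0 t) (Icc 0 1) := by
  refine continuousOn_pi.2 fun i => continuousOn_pi.2 fun j => ?_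
  simp only [h_apply]
  have := intervalIntegral.continuousOn_primitive_interval' (μ := volume) (a := 0)
    (G.intervalIntegrable_f_mul_f (s := 0) (t := 1) ⟨le_rfl, zero_le_one⟩ ⟨zero_le_one, le_rfl⟩ i j)
    (by simp)
  rwa [uIcc_of_le zero_le_one] at this

variable {G}

/-- The determinant of the conditional covariance is a product with $\det h(s,t)$ as a factor. -/
theorem Nondegenerate.isUnit_det_h (hG : G.Nondegenerate) {s t : ℝ} (hs : 0 ≤ s) (hst : s < t)
    (ht : t ≤ 1) : IsUnit (G.h s t).det := by
  have hs' : s ∈ Icc (0 : ℝ) 1 := ⟨hs, hst.le.trans ht⟩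
  have ht' : t ∈ Icc (0 : ℝ) 1 := ⟨hs.trans hst.le, ht⟩
  have h1 := (hG s t hs hst ht).det_pos.ne'
  rw [condCov, G.hAt_eq hs' hs' ht'] at h1
  simp only [Matrix.det_mul] at h1
  refine isUnit_iff_ne_zero.2 fun h0 => h1 ?_
  rw [h0]
  ring

end GaussMarkov

/-! ### Combinatorics of the nested supports -/

namespace NestedSupports

variable (T : NestedSupports)

theorem exists_parent {n k : ℕ} (hn : 1 ≤ n) (hk : k < 2 ^ (n + 1 - 1)) :
    k / 2 < 2 ^ (n - 1) ∧
    ((T.l (n + 1) k = T.l n (k / 2) ∧ T.r (n + 1) k = T.m n (k / 2) ∧ k = 2 * (k / 2)) ∨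
      (T.l (n + 1) k = T.m n (k / 2) ∧ T.r (n + 1) k = T.r n (k / 2) ∧ k = 2 * (k / 2) + 1)) := by
  have hk' : k / 2 < 2 ^ (n - 1) := by
    obtain ⟨n, rfl⟩ := Nat.exists_eq_add_of_le' hn
    simp only [Nat.add_sub_cancel] at hk ⊢
    rw [pow_succ] at hk
    omega
  refine ⟨hk', ?_⟩
  rcases Nat.even_or_odd' k with ⟨j, rfl | rfl⟩
  · left
    have : 2 * j / 2 = j := by omega
    rw [this] at hk' ⊢
    exact ⟨T.l_left n j hn hk', T.r_left n j hn hk', rfl⟩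
  · right
    have : (2 * j + 1) / 2 = j := by omega
    rw [this] at hk' ⊢
    exact ⟨T.l_right n j hn hk', T.r_right n j hn hk', rfl⟩

theorem l_lt_r {n k : ℕ} (hn : 1 ≤ n) (hk : k < 2 ^ (n - 1)) : T.l n k < T.r n k :=
  (T.l_lt_m n k hn hk).trans (T.m_lt_r n k hn hk)

theorem nested {n k : ℕ} (hn : 1 ≤ n) (hk : k < 2 ^ (n + 1 - 1)) :
    T.l n (k / 2) ≤ T.l (n + 1) k ∧ T.r (n + 1) k ≤ T.r n (k / 2) := by
  obtain ⟨hk', ⟨h1, h2, -⟩ | ⟨h1, h2, -⟩⟩ := T.exists_parent hn hk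
  · exact ⟨h1.ge, h2.le.trans (T.m_lt_r n _ hn hk').le⟩
  · exact ⟨(T.l_lt_m n _ hn hk').le.trans h1.ge, h2.le⟩

/-- The ends of a support of level $n$ are available one level before its midpoint, which makes
inductions over levels possible. -/
theorem mem_endpoints_l_r {n k : ℕ} (hn : 1 ≤ n) (hk : k < 2 ^ (n - 1)) :
    T.l n k ∈ T.endpoints n ∧ T.r n k ∈ T.endpoints n := by
  induction n, hn using Nat.le_induction generalizing k with
  | base =>
    obtain rfl : k = 0 := by simpa using hk
    simp [endpoints, T.l_root, T.r_root]
  | succ n hn ih =>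
    have hmono : T.endpoints n ⊆ T.endpoints (n + 1) := by
      rintro t (⟨n', k', h1, h2, h3, h4⟩ | h)
      · exact Or.inl ⟨n', k', h1, h2.trans (Nat.lt_succ_self n), h3, h4⟩
      · exact Or.inr h
    obtain ⟨hk', ⟨h1, h2, -⟩ | ⟨h1, h2, -⟩⟩ := T.exists_parent hn hk
    · rw [h1, h2]
      exact ⟨hmono (ih hk').1, Or.inl ⟨n, _, hn, Nat.lt_succ_self n, hk', rfl⟩⟩
    · rw [h1, h2]
      exact ⟨Or.inl ⟨n, _, hn, Nat.lt_succ_self n, hk', rfl⟩, hmono (ih hk').2⟩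

theorem bounds {n k : ℕ} (hn : 1 ≤ n) (hk : k < 2 ^ (n - 1)) : 0 ≤ T.l n k ∧ T.r n k ≤ 1 := by
  induction n, hn using Nat.le_induction generalizing k with
  | base =>
    obtain rfl : k = 0 := by simpa using hk
    exact ⟨T.l_root.ge, T.r_root.le⟩
  | succ n hn ih =>
    have h := ih (T.exists_parent hn hk).1
    have h' := T.nested hn hk
    exact ⟨h.1.trans h'.1, h'.2.trans h.2⟩

theorem disjoint {n k k' : ℕ} (hn : 1 ≤ n) (hk : k < 2 ^ (n - 1)) (hk' : k' < 2 ^ (n - 1))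
    (hne : k ≠ k') : T.r n k ≤ T.l n k' ∨ T.r n k' ≤ T.l n k := by
  induction n, hn using Nat.le_induction generalizing k k' with
  | base =>
    simp only [Nat.sub_self, pow_zero, Nat.lt_one_iff] at hk hk'
    omega
  | succ n hn ih =>
    obtain ⟨h1, h2⟩ := T.exists_parent hn hk
    obtain ⟨h1', h2'⟩ := T.exists_parent hn hk'
    by_cases h : k / 2 = k' / 2
    · rw [← h] at h2'
      rcases h2 with ⟨a, b, c⟩ | ⟨a, b, c⟩ <;> rcases h2' with ⟨a', b', c'⟩ | ⟨a', b', c'⟩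
      · omega
      · left; rw [b, a']
      · right; rw [b', a]
      · omega
    · have hp := T.nested hn hk
      have hp' := T.nested hn hk'
      rcases ih h1 h1' h with h3 | h3
      · exact Or.inl (hp.2.trans (h3.trans hp'.1))
      · exact Or.inr (hp'.2.trans (h3.trans hp.1))

/-- The endpoints and the midpoint of a support of an earlier level, or of another support of the
same level, are outside a support. -/
theorem outside {n k n' k' : ℕ} (hn' : 1 ≤ n') (hnn : n' ≤ n) (hk : k < 2 ^ (n - 1))
    (hk' : k' < 2 ^ (n' - 1)) (hne : n' < n ∨ k ≠ k') {p : ℝ}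
    (hp : p = T.l n' k' ∨ p = T.m n' k' ∨ p = T.r n' k') : p ≤ T.l n k ∨ T.r n k ≤ p := by
  have hp' : T.l n' k' ≤ p ∧ p ≤ T.r n' k' := by
    have h1 := T.l_lt_m n' k' hn' hk'
    have h2 := T.m_lt_r n' k' hn' hk'
    rcases hp with rfl | rfl | rfl
    · exact ⟨le_rfl, (h1.trans h2).le⟩
    · exact ⟨h1.le, h2.le⟩
    · exact ⟨(h1.trans h2).le, le_rfl⟩
  induction n, hnn using Nat.le_induction generalizing k with
  | base =>
    rcases T.disjoint hn' hk hk' (hne.resolve_left (lt_irrefl _)) with h | h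
    · exact Or.inr (h.trans hp'.1)
    · exact Or.inl (hp'.2.trans h)
  | succ n hnn ih =>
    have hn := hn'.trans hnn
    obtain ⟨h1, h2⟩ := T.exists_parent hn hk
    -- If the earlier support is the parent itself, its three points are compared with its two
    -- halves directly; otherwise the claim is inherited from the parent.
    by_cases h : n' = n ∧ k / 2 = k'
    · obtain ⟨rfl, rfl⟩ := h
      have h3 := T.l_lt_m n' _ hn' hk'
      have h4 := T.m_lt_r n' _ hn' hk'
      rcases h2 with ⟨a, b, -⟩ | ⟨a, b, -⟩ <;> rw [a, b] <;> rcases hp with rfl | rfl | rfl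
      · exact Or.inl le_rfl
      · exact Or.inr le_rfl
      · exact Or.inr h4.le
      · exact Or.inl h3.le
      · exact Or.inl le_rfl
      · exact Or.inr le_rfl
    · have hp2 := T.nested hn hk
      rcases ih h1 (by omega) with h3 | h3
      · exact Or.inl (h3.trans hp2.1)
      · exact Or.inr (hp2.2.trans h3)

end NestedSupports

/-! ### Algebra of the conditional covariances -/

section Algebra

variable {n : Type*} [Fintype n] [DecidableEq n] {K : Type*} [Field K]

/-- The hypothesis simplifies to $SS^T=\gamma AC^{-1}B\gamma^T$, so
$\gamma^{-1}S=AC^{-1}B\gamma^TS^{-T}$. Since $A^{-1}+B^{-1}=B^{-1}CA^{-1}$, multiplying the two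
cancels everything but $\gamma^TS^{-T}$. It is applied with $\gamma=g(m)$, $A=h(l,m)$, $B=h(m,r)$,
$C=h(l,r)$. -/
theorem Matrix.bridge_identity {γ A B C S : Matrix n n K} (hγ : IsUnit γ.det) (hA : IsUnit A.det)
    (hB : IsUnit B.det) (hC : IsUnit C.det) (hABC : A + B = C)
    (hS : S * Sᵀ = γ * A * γᵀ * (γ * C * γᵀ)⁻¹ * (γ * B * γᵀ)) :
    IsUnit S.det ∧ A⁻¹ * γ⁻¹ * S + B⁻¹ * γ⁻¹ * S = γᵀ * (S⁻¹)ᵀ := by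
  have hγT : IsUnit γᵀ.det := by rwa [Matrix.det_transpose]
  have h1 : S * Sᵀ = γ * (A * (C⁻¹ * (B * γᵀ))) := by
    rw [hS, Matrix.mul_inv_rev, Matrix.mul_inv_rev]
    simp only [Matrix.mul_assoc]
    rw [Matrix.mul_nonsing_inv_cancel_left _ _ hγT, Matrix.nonsing_inv_mul_cancel_left _ _ hγ]
  have hSu : IsUnit S.det := by
    have h2 := congrArg Matrix.det h1
    simp only [Matrix.det_mul, Matrix.det_transpose] at h2
    have hCi : IsUnit (C⁻¹).det := Matrix.isUnit_nonsing_inv_det C hC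
    refine isUnit_of_mul_isUnit_left (y := S.det) ?_
    rw [h2]
    exact hγ.mul (hA.mul (hCi.mul (hB.mul hγ)))
  have hST : IsUnit Sᵀ.det := by rwa [Matrix.det_transpose]
  refine ⟨hSu, ?_⟩
  have h3 : γ⁻¹ * S = A * (C⁻¹ * (B * (γᵀ * (S⁻¹)ᵀ))) := by
    have h4 : S = S * Sᵀ * (S⁻¹)ᵀ := by
      rw [Matrix.mul_assoc, ← Matrix.transpose_mul, Matrix.nonsing_inv_mul _ hSu,
        Matrix.transpose_one, Matrix.mul_one]
    conv_lhs => rw [h4, h1]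
    simp only [Matrix.mul_assoc]
    rw [Matrix.nonsing_inv_mul_cancel_left _ _ hγ]
  have h5 : A⁻¹ + B⁻¹ = B⁻¹ * (C * A⁻¹) := by
    rw [← hABC, Matrix.add_mul, Matrix.mul_nonsing_inv _ hA, Matrix.mul_add, Matrix.mul_one,
      Matrix.nonsing_inv_mul_cancel_left _ _ hB, add_comm]
  rw [Matrix.mul_assoc, Matrix.mul_assoc, ← Matrix.add_mul, h5, h3]
  simp only [Matrix.mul_assoc]
  rw [Matrix.nonsing_inv_mul_cancel_left _ _ hA, Matrix.mul_nonsing_inv_cancel_left _ _ hC,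
    Matrix.nonsing_inv_mul_cancel_left _ _ hB]

end Algebra

theorem Idx.zero_or_pos (i : Idx) : i = ⟨0, 0⟩ ∨ 1 ≤ i.1 := by
  obtain ⟨n, k⟩ := i
  rcases Nat.eq_zero_or_pos n with rfl | h
  · left
    congr 1
    exact Subsingleton.elim (α := Fin 1) k 0
  · exact Or.inr h

/-! ### The matrices $L$, $R$, $M$ and the values of $\psi$ at the endpoints -/

namespace GaussMarkov

variable {d m : ℕ} {G : GaussMarkov d m} {T : NestedSupports}
  {sg : Idx → Matrix (Fin d) (Fin d) ℝ}

section

variable {i : Idx}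

theorem _root_.NestedSupports.l_mem (hi : 1 ≤ i.1) : T.l i.1 i.2 ∈ Icc (0 : ℝ) 1 :=
  ⟨(T.bounds hi i.2.2).1, (T.l_lt_r hi i.2.2).le.trans (T.bounds hi i.2.2).2⟩

theorem _root_.NestedSupports.r_mem (hi : 1 ≤ i.1) : T.r i.1 i.2 ∈ Icc (0 : ℝ) 1 :=
  ⟨(T.bounds hi i.2.2).1.trans (T.l_lt_r hi i.2.2).le, (T.bounds hi i.2.2).2⟩

theorem _root_.NestedSupports.m_mem (hi : 1 ≤ i.1) : T.m i.1 i.2 ∈ Icc (0 : ℝ) 1 :=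
  ⟨(T.bounds hi i.2.2).1.trans (T.l_lt_m _ _ hi i.2.2).le,
    (T.m_lt_r _ _ hi i.2.2).le.trans (T.bounds hi i.2.2).2⟩

theorem isUnit_det_h_l_m (hG : G.Nondegenerate) (hi : 1 ≤ i.1) :
    IsUnit (G.h (T.l i.1 i.2) (T.m i.1 i.2)).det :=
  hG.isUnit_det_h (NestedSupports.l_mem hi).1 (T.l_lt_m _ _ hi i.2.2) (NestedSupports.m_mem hi).2

theorem isUnit_det_h_m_r (hG : G.Nondegenerate) (hi : 1 ≤ i.1) :
    IsUnit (G.h (T.m i.1 i.2) (T.r i.1 i.2)).det :=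
  hG.isUnit_det_h (NestedSupports.m_mem hi).1 (T.m_lt_r _ _ hi i.2.2) (NestedSupports.r_mem hi).2

theorem bridge (hG : G.Nondegenerate) (hsg : ∀ i, sg i * (sg i)ᵀ = G.bridgeCov T i)
    (hi : 1 ≤ i.1) :
    IsUnit (sg i).det ∧ G.L T sg i + G.R T sg i = G.M T sg i := by
  have hl := NestedSupports.l_mem (T := T) hi
  have hm := NestedSupports.m_mem (T := T) hi
  have hr := NestedSupports.r_mem (T := T) hi
  have h := hsg i
  rw [bridgeCov, if_neg (by omega), G.hAt_eq hm hl hm, G.hAt_eq hm hl hr, G.hAt_eq hm hm hr] at h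
  have := Matrix.bridge_identity (G.isUnit_det_g hm) (isUnit_det_h_l_m hG hi)
    (isUnit_det_h_m_r hG hi) (hG.isUnit_det_h hl.1 (T.l_lt_r hi i.2.2) hr.2)
    (G.h_add_h hl hm hr) h
  rw [L, if_neg (by omega), R, M]
  exact this

theorem h_l_m_mul_L (hG : G.Nondegenerate) (hi : 1 ≤ i.1) :
    G.h (T.l i.1 i.2) (T.m i.1 i.2) * G.L T sg i = (G.g (T.m i.1 i.2))⁻¹ * sg i := by
  rw [L, if_neg (by omega), Matrix.mul_assoc,
    Matrix.mul_nonsing_inv_cancel_left _ _ (isUnit_det_h_l_m hG hi)]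

theorem h_m_r_mul_R (hG : G.Nondegenerate) (hi : 1 ≤ i.1) :
    G.h (T.m i.1 i.2) (T.r i.1 i.2) * G.R T sg i = (G.g (T.m i.1 i.2))⁻¹ * sg i := by
  rw [R, Matrix.mul_assoc, Matrix.mul_nonsing_inv_cancel_left _ _ (isUnit_det_h_m_r hG hi)]

theorem transpose_M_mul (hG : G.Nondegenerate) (hsg : ∀ i, sg i * (sg i)ᵀ = G.bridgeCov T i)
    (hi : 1 ≤ i.1) : (G.M T sg i)ᵀ * ((G.g (T.m i.1 i.2))⁻¹ * sg i) = 1 := by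
  rw [M, Matrix.transpose_mul, Matrix.transpose_transpose, Matrix.transpose_transpose,
    Matrix.mul_assoc, Matrix.mul_nonsing_inv_cancel_left _ _
      (G.isUnit_det_g (NestedSupports.m_mem hi)),
    Matrix.nonsing_inv_mul _ (bridge hG hsg hi).1]

theorem isUnit_det_M (hG : G.Nondegenerate) (hsg : ∀ i, sg i * (sg i)ᵀ = G.bridgeCov T i)
    (hi : 1 ≤ i.1) : IsUnit (G.M T sg i).det := by
  rw [← Matrix.det_transpose]
  exact Matrix.isUnit_det_of_right_inverse (transpose_M_mul hG hsg hi)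

theorem transpose_L_zero_mul (hG : G.Nondegenerate)
    (hsg : ∀ i, sg i * (sg i)ᵀ = G.bridgeCov T i) :
    (G.L T sg ⟨0, 0⟩)ᵀ * (G.h 0 1 * G.L T sg ⟨0, 0⟩) = 1 := by
  have h1 : (1 : ℝ) ∈ Icc (0 : ℝ) 1 := ⟨zero_le_one, le_rfl⟩
  have hγ := G.isUnit_det_g h1
  have hγT : IsUnit (G.g 1)ᵀ.det := by rwa [Matrix.det_transpose]
  have hH := hG.isUnit_det_h le_rfl zero_lt_one le_rfl
  have h := hsg ⟨0, 0⟩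
  rw [bridgeCov, if_pos rfl] at h
  have hL : G.L T sg ⟨0, 0⟩ = (G.h 0 1)⁻¹ * ((G.g 1)⁻¹ * sg ⟨0, 0⟩) := by
    rw [L, if_pos rfl, Matrix.mul_assoc]
  -- A one-sided inverse of a square matrix is two-sided; exchanging the factors brings
  -- $\sigma\sigma^T$ together, which `h` evaluates.
  rw [hL, Matrix.mul_nonsing_inv_cancel_left _ _ hH, ← Matrix.mul_assoc, mul_eq_one_comm]
  simp only [Matrix.transpose_mul, Matrix.transpose_nonsing_inv, transpose_h]
  rw [Matrix.mul_assoc, Matrix.mul_assoc, ← Matrix.mul_assoc (sg _), h]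
  simp only [Matrix.mul_assoc]
  rw [Matrix.mul_nonsing_inv_cancel_left _ _ hγT, Matrix.mul_nonsing_inv_cancel_left _ _ hH,
    Matrix.mul_nonsing_inv _ hγ]

theorem isUnit_det_L_zero (hG : G.Nondegenerate)
    (hsg : ∀ i, sg i * (sg i)ᵀ = G.bridgeCov T i) : IsUnit (G.L T sg ⟨0, 0⟩).det := by
  rw [← Matrix.det_transpose]
  exact Matrix.isUnit_det_of_right_inverse (transpose_L_zero_mul hG hsg)

theorem ψ_eq_zero_of_outside (hi : 1 ≤ i.1) {t : ℝ}
    (ht : t ≤ T.l i.1 i.2 ∨ T.r i.1 i.2 ≤ t) : G.ψ T sg i t = 0 := by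
  have h1 := T.l_lt_m _ _ hi i.2.2
  have h2 := T.m_lt_r _ _ hi i.2.2
  rw [ψ, if_neg (by omega)]
  rcases ht with ht | ht
  · split_ifs with h3 h4
    · rw [le_antisymm ht h3.1, h_self, Matrix.mul_zero, Matrix.zero_mul]
    · linarith
    · rfl
  · split_ifs with h3 h4
    · linarith
    · rw [le_antisymm h4.2 ht, h_self, Matrix.mul_zero, Matrix.zero_mul]
    · rfl

end

/-! ### The Green kernels as elements of `L²` -/

/-- The function `s ↦ 1_{[0,t]}(s) f(s)ᵀ c`. -/
noncomputable def green (G : GaussMarkov d m) (t : ℝ) (c : Fin d → ℝ) (s : ℝ) : Fin m → ℝ :=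
  (Icc 0 t).indicator (fun s => (G.f s)ᵀ *ᵥ c) s

variable (G)

theorem memLp_green (t : ℝ) (c : Fin d → ℝ) :
    MemLp (G.green t c) 2 (volume.restrict (Icc (0 : ℝ) 1)) := by
  have h : ContinuousOn (fun s => (G.f s)ᵀ *ᵥ c) (Icc 0 1) :=
    (Continuous.matrix_mulVec (Continuous.matrix_transpose continuous_id)
      continuous_const).comp_continuousOn G.continuousOn_f
  obtain ⟨C, hC⟩ := isCompact_Icc.exists_bound_of_continuousOn h
  refine MemLp.indicator measurableSet_Icc (MemLp.of_bound
    (h.aestronglyMeasurable measurableSet_Icc) C ?_)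
  filter_upwards [ae_restrict_mem measurableSet_Icc] with s hs using hC s hs

/-- The class in `L²` of `s ↦ 1_{[0,t]}(s) f(s)ᵀ c`, as a linear function of `c`. -/
noncomputable def greenL2 (t : ℝ) : (Fin d → ℝ) →ₗ[ℝ] L2Path m where
  toFun c := toL2Path (G.green t c)
  map_add' c c' := by
    rw [← toL2Path_add (G.memLp_green t c) (G.memLp_green t c')]
    congr 1
    ext s : 1
    simp only [green, Matrix.mulVec_add, indicator_add]
  map_smul' r c := by
    rw [RingHom.id_apply, ← toL2Path_smul r (G.memLp_green t c)]
    congr 1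
    ext s : 1
    simp only [green, Matrix.mulVec_smul]
    exact indicator_const_smul_apply _ r _ s

theorem greenL2_apply (t : ℝ) (c : Fin d → ℝ) : G.greenL2 t c = toL2Path (G.green t c) := rfl

theorem k_row_eq (t s : ℝ) (a : Fin d) : G.k t s a = G.green t (G.g t a) s := by
  unfold k green
  by_cases h : s ∈ Icc 0 t
  · rw [if_pos (show 0 ≤ s ∧ s ≤ t from h), indicator_of_mem h]
    ext b
    simp [Matrix.mul_apply, Matrix.mulVec, dotProduct, mul_comm]
  · rw [if_neg (show ¬ (0 ≤ s ∧ s ≤ t) from h), indicator_of_notMem h]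
    rfl

/-- Both functions are supported up to $\min(t,s)$, where the integrand is $c^Tff^Tc'$. -/
theorem inner_greenL2 {t s : ℝ} (ht : t ∈ Icc (0 : ℝ) 1) (hs : s ∈ Icc (0 : ℝ) 1)
    (c c' : Fin d → ℝ) :
    inner ℝ (G.greenL2 t c) (G.greenL2 s c') = c ⬝ᵥ (G.h 0 (min t s) *ᵥ c') := by
  have h0 : (0 : ℝ) ∈ Icc (0 : ℝ) 1 := ⟨le_rfl, zero_le_one⟩
  have hmin : min t s ∈ Icc (0 : ℝ) 1 := ⟨le_min ht.1 hs.1, (min_le_left _ _).trans ht.2⟩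
  rw [greenL2_apply, greenL2_apply, inner_toL2Path (G.memLp_green t c) (G.memLp_green s c')]
  have h1 : ∀ u, G.green t c u ⬝ᵥ G.green s c' u = (Icc 0 (min t s)).indicator
      (fun u => ∑ i, ∑ j, c i * ((G.f u * (G.f u)ᵀ) i j * c' j)) u := fun u => by
    have h2 : ((G.f u)ᵀ *ᵥ c) ⬝ᵥ ((G.f u)ᵀ *ᵥ c') =
        ∑ i, ∑ j, c i * ((G.f u * (G.f u)ᵀ) i j * c' j) := by
      rw [Matrix.mulVec_transpose, ← Matrix.dotProduct_mulVec, Matrix.mulVec_mulVec]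
      simp only [dotProduct, Matrix.mulVec, Finset.mul_sum]
    simp only [green]
    by_cases hu : u ∈ Icc 0 t <;> by_cases hu' : u ∈ Icc 0 s
    · have : u ∈ Icc 0 (min t s) := ⟨hu.1, le_min hu.2 hu'.2⟩
      rw [indicator_of_mem hu, indicator_of_mem hu', indicator_of_mem this, h2]
    · have : u ∉ Icc 0 (min t s) := fun h => hu' ⟨h.1, h.2.trans (min_le_right _ _)⟩
      rw [indicator_of_notMem hu', indicator_of_notMem this, dotProduct_zero]
    · have : u ∉ Icc 0 (min t s) := fun h => hu ⟨h.1, h.2.trans (min_le_left _ _)⟩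
      rw [indicator_of_notMem hu, indicator_of_notMem this, zero_dotProduct]
    · have : u ∉ Icc 0 (min t s) := fun h => hu ⟨h.1, h.2.trans (min_le_left _ _)⟩
      rw [indicator_of_notMem hu, indicator_of_notMem this, zero_dotProduct]
  simp_rw [h1]
  rw [integral_indicator measurableSet_Icc, Measure.restrict_restrict measurableSet_Icc,
    inter_eq_left.2 (Icc_subset_Icc_right hmin.2), integral_Icc_eq_integral_Ioc,
    ← intervalIntegral.integral_of_le hmin.1]
  have hint : ∀ i j, IntervalIntegrable (fun u => c i * ((G.f u * (G.f u)ᵀ) i j * c' j)) volume 0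
      (min t s) := fun i j =>
    ((G.intervalIntegrable_f_mul_f h0 hmin i j).mul_const _).const_mul _
  rw [intervalIntegral.integral_finsetSum fun i _ => by
    simpa only [Finset.sum_fn] using IntervalIntegrable.sum Finset.univ fun j _ => hint i j]
  simp only [dotProduct, Matrix.mulVec, Finset.mul_sum]
  refine Finset.sum_congr rfl fun i _ => ?_
  rw [intervalIntegral.integral_finsetSum fun j _ => hint i j]
  refine Finset.sum_congr rfl fun j _ => ?_
  rw [intervalIntegral.integral_const_mul, intervalIntegral.integral_mul_const, h_apply]

end GaussMarkov

namespace GaussMarkov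

variable {d m : ℕ} {G : GaussMarkov d m} {T : NestedSupports}
  {sg : Idx → Matrix (Fin d) (Fin d) ℝ}

/-! ### The orthonormal system -/

theorem green_of_le {t s : ℝ} (hs : 0 ≤ s) (hst : s ≤ t) (c : Fin d → ℝ) :
    G.green t c s = (G.f s)ᵀ *ᵥ c :=
  indicator_of_mem (show s ∈ Icc 0 t from ⟨hs, hst⟩) _

theorem green_of_lt {t s : ℝ} (hst : t < s) (c : Fin d → ℝ) :
    G.green t c s = 0 := indicator_of_notMem (fun h => hst.not_ge (Set.mem_Icc.1 h).2) _

theorem transpose_mul_apply_eq (A : Matrix (Fin d) (Fin m) ℝ) (B : Matrix (Fin d) (Fin d) ℝ)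
    (b : Fin m) (j : Fin d) : (Aᵀ * B) b j = (Aᵀ *ᵥ Bᵀ j) b := rfl

theorem φcol_zero_ae_eq (j : Fin d) :
    G.φcol T sg ⟨0, 0⟩ j =ᵐ[volume.restrict (Icc (0 : ℝ) 1)]
      G.green 1 ((G.L T sg ⟨0, 0⟩)ᵀ j) := by
  filter_upwards [ae_restrict_mem measurableSet_Icc] with s hs
  rw [green_of_le hs.1 hs.2]
  ext b
  rw [φcol, φ, if_pos rfl, transpose_mul_apply_eq]

/-- With $M=L+R$ the coefficient of $f^T$ is $M-L-R=0$ before $l$, $M-R=L$ between $l$ and $m$, and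
$-R$ between $m$ and $r$. The three points are discarded because `green` uses closed intervals and
$\phi$ half-open ones. -/
theorem φcol_ae_eq (hG : G.Nondegenerate) (hsg : ∀ i, sg i * (sg i)ᵀ = G.bridgeCov T i)
    {i : Idx} (hi : 1 ≤ i.1) (j : Fin d) :
    G.φcol T sg i j =ᵐ[volume.restrict (Icc (0 : ℝ) 1)] fun s =>
      G.green (T.m i.1 i.2) ((G.M T sg i)ᵀ j) s + (-1 : ℝ) • G.green (T.l i.1 i.2)
        ((G.L T sg i)ᵀ j) s + (-1 : ℝ) • G.green (T.r i.1 i.2) ((G.R T sg i)ᵀ j) s := by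
  have hM : (G.M T sg i)ᵀ j = (G.L T sg i)ᵀ j + (G.R T sg i)ᵀ j := by
    rw [← (bridge hG hsg hi).2, Matrix.transpose_add]
    rfl
  have h1 := T.l_lt_m _ _ hi i.2.2
  have h2 := T.m_lt_r _ _ hi i.2.2
  have hne : ∀ p : ℝ, ∀ᵐ s ∂(volume.restrict (Icc (0 : ℝ) 1)), s ≠ p := fun p =>
    ae_restrict_of_ae (Measure.ae_ne volume p)
  filter_upwards [ae_restrict_mem measurableSet_Icc, hne (T.l i.1 i.2), hne (T.m i.1 i.2),
    hne (T.r i.1 i.2)] with s hs hl hm hr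
  rw [hM]
  ext b
  rw [φcol, φ, if_neg (by omega)]
  rcases lt_or_gt_of_ne hl with hl | hl
  · rw [if_neg (fun h => hl.not_ge h.1), if_neg (fun h => (hl.trans h1).not_ge h.1),
      green_of_le hs.1 (hl.trans h1).le, green_of_le hs.1 hl.le,
      green_of_le hs.1 (hl.trans (h1.trans h2)).le, Matrix.mulVec_add]
    simp
  · rcases lt_or_gt_of_ne hm with hm | hm
    · rw [if_pos ⟨hl.le, hm⟩, green_of_le hs.1 hm.le, green_of_lt hl,
        green_of_le hs.1 (hm.trans h2).le, transpose_mul_apply_eq, Matrix.mulVec_add]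
      simp
    · rw [if_neg (fun h => hm.not_gt h.2)]
      rcases lt_or_gt_of_ne hr with hr | hr
      · rw [if_pos ⟨hm.le, hr⟩, green_of_lt hm, green_of_lt hl, green_of_le hs.1 hr.le,
          Matrix.neg_apply, transpose_mul_apply_eq]
        simp
      · rw [if_neg (fun h => hr.not_gt h.2), green_of_lt hm, green_of_lt hl, green_of_lt hr]
        simp

theorem memLp_φcol (hG : G.Nondegenerate) (hsg : ∀ i, sg i * (sg i)ᵀ = G.bridgeCov T i)
    (i : Idx) (j : Fin d) : MemLp (G.φcol T sg i j) 2 (volume.restrict (Icc (0 : ℝ) 1)) := by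
  rcases i.zero_or_pos with rfl | hi
  · exact (memLp_congr_ae (φcol_zero_ae_eq j)).2 (G.memLp_green _ _)
  · exact (memLp_congr_ae (φcol_ae_eq hG hsg hi j)).2
      (((G.memLp_green _ _).add ((G.memLp_green _ _).const_smul (-1 : ℝ))).add
        ((G.memLp_green _ _).const_smul (-1 : ℝ)))

theorem toL2Path_φcol_zero (j : Fin d) :
    toL2Path (G.φcol T sg ⟨0, 0⟩ j) = G.greenL2 1 ((G.L T sg ⟨0, 0⟩)ᵀ j) := by
  rw [toL2Path_congr (φcol_zero_ae_eq j), greenL2_apply]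

theorem toL2Path_φcol (hG : G.Nondegenerate) (hsg : ∀ i, sg i * (sg i)ᵀ = G.bridgeCov T i)
    {i : Idx} (hi : 1 ≤ i.1) (j : Fin d) :
    toL2Path (G.φcol T sg i j) = G.greenL2 (T.m i.1 i.2) ((G.M T sg i)ᵀ j) -
      G.greenL2 (T.l i.1 i.2) ((G.L T sg i)ᵀ j) - G.greenL2 (T.r i.1 i.2) ((G.R T sg i)ᵀ j) := by
  have hm := G.memLp_green (T.m i.1 i.2) ((G.M T sg i)ᵀ j)
  have hl := G.memLp_green (T.l i.1 i.2) ((G.L T sg i)ᵀ j)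
  have hr := G.memLp_green (T.r i.1 i.2) ((G.R T sg i)ᵀ j)
  rw [toL2Path_congr (φcol_ae_eq hG hsg hi j),
    toL2Path_add (v := fun s => G.green (T.m i.1 i.2) ((G.M T sg i)ᵀ j) s + (-1 : ℝ) •
      G.green (T.l i.1 i.2) ((G.L T sg i)ᵀ j) s) (hm.add (hl.const_smul (-1 : ℝ)))
      (w := fun s => (-1 : ℝ) • G.green (T.r i.1 i.2) ((G.R T sg i)ᵀ j) s)
      (hr.const_smul (-1 : ℝ)), toL2Path_add (w := fun s => (-1 : ℝ) • G.green (T.l i.1 i.2)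
        ((G.L T sg i)ᵀ j) s) hm (hl.const_smul (-1 : ℝ)), toL2Path_smul _ hl,
    toL2Path_smul _ hr]
  simp only [greenL2_apply]
  module

/-- The path `t ↦ g(t) ∫₀ᵗ f(s) w(s) ds` of the class `w`. -/
noncomputable def path (G : GaussMarkov d m) (w : L2Path m) (t : I) (a : Fin d) : ℝ :=
  inner ℝ w (G.greenL2 t (G.g t a))

theorem greenL2_eq_sum (t : ℝ) (c : Fin d → ℝ) :
    G.greenL2 t c = ∑ a, c a • G.greenL2 t (Pi.single a 1) := by
  conv_lhs => rw [pi_eq_sum_univ' c, map_sum]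
  refine Finset.sum_congr rfl fun a _ => ?_
  rw [map_smul]

theorem inv_g_mulVec_path (w : L2Path m) (t : I) :
    (G.g t)⁻¹ *ᵥ G.path w t = fun a => inner ℝ w (G.greenL2 t (Pi.single a 1)) := by
  have h : G.path w t = G.g t *ᵥ fun a => inner ℝ w (G.greenL2 t (Pi.single a 1)) := by
    ext a
    rw [path, greenL2_eq_sum, inner_sum]
    refine Finset.sum_congr rfl fun b _ => ?_
    rw [inner_smul_right]
  rw [h, Matrix.mulVec_mulVec, Matrix.nonsing_inv_mul _ (G.isUnit_det_g t.2), Matrix.one_mulVec]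

theorem transpose_mulVec_inner_greenL2 (A : Matrix (Fin d) (Fin d) ℝ) (w : L2Path m) (t : ℝ)
    (j : Fin d) : (Aᵀ *ᵥ fun a => inner ℝ w (G.greenL2 t (Pi.single a 1))) j =
      inner ℝ w (G.greenL2 t (Aᵀ j)) := by
  rw [greenL2_eq_sum t (Aᵀ j), inner_sum]
  simp only [Matrix.mulVec, dotProduct, inner_smul_right]

/-- Entry $a$ of $g(t)^{-1}\,\mathrm{path}\,w(t)$ is the pairing of $w$ with the Green function at
$t$ in direction $e_a$, and $\Delta$ combines these with the same matrices as $\phi$ does. -/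
theorem Δ_path (hG : G.Nondegenerate) (hsg : ∀ i, sg i * (sg i)ᵀ = G.bridgeCov T i) (i : Idx)
    (w : L2Path m) (j : Fin d) :
    G.Δ T sg i (G.path w) j = inner ℝ (toL2Path (G.φcol T sg i j)) w := by
  have key : ∀ t ∈ Icc (0 : ℝ) 1, (G.g t)⁻¹ *ᵥ G.path w (projIcc 0 1 zero_le_one t) =
      fun a => inner ℝ w (G.greenL2 t (Pi.single a 1)) := fun t ht => by
    rw [projIcc_of_mem _ ht]
    exact inv_g_mulVec_path w ⟨t, ht⟩
  rw [real_inner_comm]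
  rcases i.zero_or_pos with rfl | hi
  · rw [Δ, if_pos rfl]
    simp only [key 1 ⟨zero_le_one, le_rfl⟩]
    rw [transpose_mulVec_inner_greenL2,
      toL2Path_φcol_zero]
  · rw [Δ, if_neg (by omega)]
    simp only [key _ (NestedSupports.m_mem hi), key _ (NestedSupports.l_mem hi),
      key _ (NestedSupports.r_mem hi), Pi.sub_apply, transpose_mulVec_inner_greenL2]
    rw [toL2Path_φcol hG hsg hi, inner_sub_right, inner_sub_right]

/-- The path of a column of $\phi$ is the corresponding column of $\psi$, computed from the kernel
$h(0,\min(s,t))$. To the right of $m$ the identity `hLR`, both sides being $g(m)^{-1}\sigma$, trades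
$h(l,m)L$ for $h(m,r)R$. -/
theorem inner_φcol_greenL2 (hG : G.Nondegenerate) (hsg : ∀ i, sg i * (sg i)ᵀ = G.bridgeCov T i)
    (i : Idx) (j : Fin d) {t : ℝ} (ht : t ∈ Icc (0 : ℝ) 1) (a : Fin d) :
    inner ℝ (toL2Path (G.φcol T sg i j)) (G.greenL2 t (G.g t a)) = G.ψ T sg i t a j := by
  have h0 : (0 : ℝ) ∈ Icc (0 : ℝ) 1 := ⟨le_rfl, zero_le_one⟩
  have h1 : (1 : ℝ) ∈ Icc (0 : ℝ) 1 := ⟨zero_le_one, le_rfl⟩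
  have key : ∀ (A : Matrix (Fin d) (Fin d) ℝ) (s : ℝ), s ∈ Icc (0 : ℝ) 1 →
      inner ℝ (G.greenL2 s (Aᵀ j)) (G.greenL2 t (G.g t a)) =
        (G.g t * (G.h 0 (min s t) * A)) a j := fun A s hs => by
    rw [G.inner_greenL2 hs ht]
    have : (G.g t * (G.h 0 (min s t) * A))ᵀ = Aᵀ * (G.h 0 (min s t) * (G.g t)ᵀ) := by
      simp only [Matrix.transpose_mul, transpose_h, Matrix.mul_assoc]
    rw [← Matrix.transpose_apply (G.g t * (G.h 0 (min s t) * A)), this]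
    rfl
  rcases i.zero_or_pos with rfl | hi
  · rw [toL2Path_φcol_zero, key _ 1 h1, ψ, if_pos rfl, min_eq_right ht.2, Matrix.mul_assoc]
  · have hl := NestedSupports.l_mem (T := T) hi
    have hm := NestedSupports.m_mem (T := T) hi
    have hr := NestedSupports.r_mem (T := T) hi
    have hlm := T.l_lt_m _ _ hi i.2.2
    have hmr := T.m_lt_r _ _ hi i.2.2
    have hLR : G.h (T.l i.1 i.2) (T.m i.1 i.2) * G.L T sg i =
        G.h (T.m i.1 i.2) (T.r i.1 i.2) * G.R T sg i := by
      rw [h_l_m_mul_L hG hi, h_m_r_mul_R hG hi]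
    rw [toL2Path_φcol hG hsg hi, inner_sub_left, inner_sub_left, key _ _ hm, key _ _ hl,
      key _ _ hr, ← Matrix.sub_apply, ← Matrix.sub_apply, ← Matrix.mul_sub, ← Matrix.mul_sub,
      ← (bridge hG hsg hi).2, ψ, if_neg (by omega)]
    have hd : ∀ {u v : ℝ}, u ∈ Icc (0 : ℝ) 1 → v ∈ Icc (0 : ℝ) 1 → G.h u v = G.h 0 v - G.h 0 u :=
      fun hu hv => by rw [← G.h_add_h h0 hu hv, add_sub_cancel_left]
    rw [hd hl hm, hd hm hr, Matrix.sub_mul, Matrix.sub_mul] at hLR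
    rcases lt_or_ge t (T.l i.1 i.2) with h | h
    · rw [if_neg (fun h' => h.not_ge h'.1), if_neg (fun h' => (h.trans hlm).not_ge h'.1),
        min_eq_right h.le, min_eq_right (h.trans hlm).le, min_eq_right (h.trans (hlm.trans hmr)).le,
        Matrix.mul_add, add_sub_cancel_left, sub_self, Matrix.mul_zero]
    rcases le_or_gt t (T.m i.1 i.2) with h' | h'
    · rw [if_pos ⟨h, h'⟩, min_eq_right h', min_eq_left h, min_eq_right (h'.trans hmr.le), hd hl ht,
        Matrix.mul_assoc, Matrix.sub_mul, Matrix.mul_add, add_sub_right_comm, add_sub_cancel_right]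
    · rw [if_neg (fun h => h'.not_ge h.2), min_eq_left h'.le, min_eq_left h, Matrix.mul_add,
        add_sub_right_comm, hLR, sub_add_cancel]
      rcases le_or_gt t (T.r i.1 i.2) with h'' | h''
      · rw [if_pos ⟨h'.le, h''⟩, min_eq_right h'', hd ht hr, Matrix.mul_assoc, Matrix.sub_mul]
      · rw [if_neg (fun h => h''.not_ge h.2), min_eq_left h''.le, sub_self, Matrix.mul_zero]

theorem ψcol_eq_path (hG : G.Nondegenerate) (hsg : ∀ i, sg i * (sg i)ᵀ = G.bridgeCov T i)
    (i : Idx) (j : Fin d) : G.ψcol T sg i j = G.path (toL2Path (G.φcol T sg i j)) := by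
  ext t a
  rw [ψcol, path, inner_φcol_greenL2 hG hsg i j t.2]

/-- For $n\ge1$, $\psi$ vanishes at $l$ and $r$ and equals $\sigma$ at $m$, where
$M^Tg(m)^{-1}\sigma=I$. -/
theorem Δ_ψcol_self (hG : G.Nondegenerate) (hsg : ∀ i, sg i * (sg i)ᵀ = G.bridgeCov T i)
    (i : Idx) (j j' : Fin d) :
    G.Δ T sg i (G.ψcol T sg i j) j' = (1 : Matrix (Fin d) (Fin d) ℝ) j' j := by
  have key : ∀ t ∈ Icc (0 : ℝ) 1, ∀ A : Matrix (Fin d) (Fin d) ℝ, G.ψ T sg i t = G.g t * A →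
      (G.g t)⁻¹ *ᵥ G.ψcol T sg i j (projIcc 0 1 zero_le_one t) = fun a => A a j := by
    intro t ht A hA
    have : G.ψcol T sg i j (projIcc 0 1 zero_le_one t) = fun a => (G.g t * A) a j := by
      ext a
      rw [projIcc_of_mem _ ht, ψcol, hA]
    rw [this]
    ext a
    change ((G.g t)⁻¹ * (G.g t * A)) a j = A a j
    rw [Matrix.nonsing_inv_mul_cancel_left _ _ (G.isUnit_det_g ht)]
  rcases i.zero_or_pos with rfl | hi
  · rw [Δ, if_pos rfl]
    simp only [key 1 ⟨zero_le_one, le_rfl⟩ (G.h 0 1 * G.L T sg ⟨0, 0⟩)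
      (by rw [ψ, if_pos rfl, Matrix.mul_assoc])]
    rw [← transpose_L_zero_mul hG hsg]
    rfl
  · have hlm := T.l_lt_m _ _ hi i.2.2
    rw [Δ, if_neg (by omega)]
    simp only [key _ (NestedSupports.m_mem hi) ((G.g (T.m i.1 i.2))⁻¹ * sg i)
      (by rw [ψ, if_neg (by omega), if_pos ⟨hlm.le, le_rfl⟩, Matrix.mul_assoc,
        h_l_m_mul_L hG hi]),
      key _ (NestedSupports.l_mem hi) 0
      (by rw [ψ_eq_zero_of_outside hi (Or.inl le_rfl), Matrix.mul_zero]),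
      key _ (NestedSupports.r_mem hi) 0
      (by rw [ψ_eq_zero_of_outside hi (Or.inr le_rfl), Matrix.mul_zero])]
    rw [← transpose_M_mul hG hsg hi]
    simp only [Matrix.zero_apply, Pi.sub_apply]
    rw [show (fun _ : Fin d => (0 : ℝ)) = 0 from rfl, Matrix.mulVec_zero, Matrix.mulVec_zero]
    simp only [Pi.zero_apply, sub_zero]
    rfl

/-- The points evaluated by a functional of an earlier level, or of another support of the same
level, are outside the support of $\psi$. -/
theorem Δ_ψcol_of_le {i i' : Idx} (hne : i' ≠ i) (hle : i'.1 ≤ i.1) (j : Fin d) :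
    G.Δ T sg i' (G.ψcol T sg i j) = 0 := by
  have hi : 1 ≤ i.1 := by
    rcases i.zero_or_pos with rfl | hi
    · rcases i'.zero_or_pos with rfl | hi'
      · exact absurd rfl hne
      · exact hi'.trans hle
    · exact hi
  have key : ∀ t ∈ Icc (0 : ℝ) 1, (t ≤ T.l i.1 i.2 ∨ T.r i.1 i.2 ≤ t) →
      (G.g t)⁻¹ *ᵥ G.ψcol T sg i j (projIcc 0 1 zero_le_one t) = 0 := by
    intro t ht h
    have : G.ψcol T sg i j (projIcc 0 1 zero_le_one t) = 0 := by
      ext a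
      rw [projIcc_of_mem _ ht, ψcol, ψ_eq_zero_of_outside hi h]
      rfl
    rw [this, Matrix.mulVec_zero]
  rcases i'.zero_or_pos with rfl | hi'
  · rw [Δ, if_pos rfl]
    simp only [key 1 ⟨zero_le_one, le_rfl⟩ (Or.inr (T.bounds hi i.2.2).2), Matrix.mulVec_zero]
  · have hne' : i'.1 < i.1 ∨ (i.2 : ℕ) ≠ i'.2 := by
      by_contra! h
      obtain ⟨n, k⟩ := i
      obtain ⟨n', k'⟩ := i'
      obtain rfl : n' = n := le_antisymm hle h.1
      exact hne (congrArg (Sigma.mk n') (Fin.ext h.2.symm))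
    have hout := fun p hp => T.outside (p := p) hi' hle i.2.2 i'.2.2 hne' hp
    rw [Δ, if_neg (by omega)]
    simp only [key _ (NestedSupports.m_mem hi') (hout _ (Or.inr (Or.inl rfl))),
      key _ (NestedSupports.l_mem hi') (hout _ (Or.inl rfl)),
      key _ (NestedSupports.r_mem hi') (hout _ (Or.inr (Or.inr rfl))), Matrix.mulVec_zero,
      sub_zero]

/-- The inner product equals $\Delta_{i'}(\psi_i)$, and its symmetry allows the shallower index to
be put on the functional. -/
theorem orthonormal_φcol (hG : G.Nondegenerate) (hsg : ∀ i, sg i * (sg i)ᵀ = G.bridgeCov T i) :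
    Orthonormal ℝ fun p : Idx × Fin d => toL2Path (G.φcol T sg p.1 p.2) := by
  classical
  have key : ∀ i i' j j', i'.1 ≤ i.1 →
      inner ℝ (toL2Path (G.φcol T sg i' j')) (toL2Path (G.φcol T sg i j)) =
        if (i', j') = (i, j) then (1 : ℝ) else 0 := by
    intro i i' j j' hle
    rw [← Δ_path hG hsg i', ← ψcol_eq_path hG hsg]
    by_cases h : i' = i
    · subst h
      rw [Δ_ψcol_self hG hsg, Matrix.one_apply]
      simp
    · rw [Δ_ψcol_of_le h hle, if_neg (by simp [h])]
      rfl
  rw [orthonormal_iff_ite]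
  rintro ⟨i, j⟩ ⟨i', j'⟩
  rcases le_total i.1 i'.1 with h | h
  · exact key i' i j' j h
  · rw [real_inner_comm, key i i' j j' h]
    simp only [eq_comm]

theorem Δ_ψcol (hG : G.Nondegenerate) (hsg : ∀ i, sg i * (sg i)ᵀ = G.bridgeCov T i)
    (i i' : Idx) (j j' : Fin d) :
    G.Δ T sg i' (G.ψcol T sg i j) j' = if (i', j') = (i, j) then 1 else 0 := by
  rw [ψcol_eq_path hG hsg, Δ_path hG hsg]
  exact (orthonormal_iff_ite.1 (orthonormal_φcol hG hsg)) (i', j') (i, j)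

end GaussMarkov

namespace GaussMarkov

variable {d m : ℕ} {G : GaussMarkov d m} {T : NestedSupports}
  {sg : Idx → Matrix (Fin d) (Fin d) ℝ}

/-! ### Paths -/

theorem greenL2_zero (c : Fin d → ℝ) : G.greenL2 0 c = 0 := by
  have h0 : (0 : ℝ) ∈ Icc (0 : ℝ) 1 := ⟨le_rfl, zero_le_one⟩
  rw [← norm_eq_zero, ← sq_eq_zero_iff, ← real_inner_self_eq_norm_sq, G.inner_greenL2 h0 h0,
    min_self, h_self, Matrix.zero_mulVec, dotProduct_zero]

theorem path_zero (w : L2Path m) : G.path w 0 = 0 := by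
  ext a
  simp [path, greenL2_zero]

theorem path_sub (w w' : L2Path m) : G.path (w - w') = G.path w - G.path w' := by
  ext t a
  simp [path, inner_sub_left]

theorem continuous_path_greenL2 {s : ℝ} (hs : s ∈ Icc (0 : ℝ) 1) (c : Fin d → ℝ) :
    Continuous (G.path (G.greenL2 s c)) := by
  have hH : Continuous fun t : I => G.h 0 t :=
    continuousOn_iff_continuous_domRestrict.1 G.continuousOn_h
  have hg : Continuous fun t : I => G.g t :=
    continuousOn_iff_continuous_domRestrict.1 G.continuousOn_g
  have hmin : Continuous fun t : I => G.h 0 (min s t) :=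
    hH.comp (f := fun t : I => min (⟨s, hs⟩ : I) t) (by fun_prop)
  refine continuous_pi fun a => ?_
  have : (fun t : I => G.path (G.greenL2 s c) t a) =
      fun t : I => c ⬝ᵥ (G.h 0 (min s t) *ᵥ G.g t a) := by
    ext t
    rw [path, G.inner_greenL2 hs t.2]
  rw [this]
  exact continuous_const.dotProduct (hmin.matrix_mulVec ((continuous_apply a).comp hg))

theorem continuous_path_φcol (hG : G.Nondegenerate)
    (hsg : ∀ i, sg i * (sg i)ᵀ = G.bridgeCov T i) (i : Idx) (j : Fin d) :
    Continuous (G.path (toL2Path (G.φcol T sg i j))) := by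
  rcases i.zero_or_pos with rfl | hi
  · rw [toL2Path_φcol_zero]
    exact continuous_path_greenL2 ⟨zero_le_one, le_rfl⟩ _
  · rw [toL2Path_φcol hG hsg hi, path_sub, path_sub]
    exact ((continuous_path_greenL2 (NestedSupports.m_mem hi) _).sub
      (continuous_path_greenL2 (NestedSupports.l_mem hi) _)).sub
      (continuous_path_greenL2 (NestedSupports.r_mem hi) _)

theorem continuous_ψcol (hG : G.Nondegenerate)
    (hsg : ∀ i, sg i * (sg i)ᵀ = G.bridgeCov T i) (i : Idx) (j : Fin d) :
    Continuous (G.ψcol T sg i j) := by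
  rw [ψcol_eq_path hG hsg]
  exact continuous_path_φcol hG hsg i j

/-! ### The coefficients -/

theorem Δ_add (i : Idx) (u v : I → Fin d → ℝ) :
    G.Δ T sg i (u + v) = G.Δ T sg i u + G.Δ T sg i v := by
  unfold Δ
  simp only [Pi.add_apply, Matrix.mulVec_add]
  split_ifs
  · rfl
  · abel

theorem Δ_smul (i : Idx) (r : ℝ) (u : I → Fin d → ℝ) :
    G.Δ T sg i (r • u) = r • G.Δ T sg i u := by
  unfold Δ
  simp only [Pi.smul_apply, Matrix.mulVec_smul]
  split_ifs
  · rfl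
  · simp only [smul_sub]

theorem Δ_zero (i : Idx) : G.Δ T sg i 0 = 0 := by
  simpa using Δ_smul (G := G) (T := T) (sg := sg) i 0 0

theorem Δ_sub (i : Idx) (u v : I → Fin d → ℝ) :
    G.Δ T sg i (u - v) = G.Δ T sg i u - G.Δ T sg i v := by
  have := Δ_add (G := G) (T := T) (sg := sg) i u ((-1 : ℝ) • v)
  rw [Δ_smul] at this
  simpa [sub_eq_add_neg] using this

theorem Δ_sum {ι : Type*} (s : Finset ι) (i : Idx) (u : ι → I → Fin d → ℝ) :
    G.Δ T sg i (∑ k ∈ s, u k) = ∑ k ∈ s, G.Δ T sg i (u k) := by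
  classical
  induction s using Finset.induction_on with
  | empty => simp [Δ_zero]
  | insert a s ha ih => rw [Finset.sum_insert ha, Finset.sum_insert ha, Δ_add, ih]

theorem continuous_Δ (i : Idx) : Continuous fun u : C(I, Fin d → ℝ) => G.Δ T sg i u := by
  have h (t : ℝ) : Continuous fun u : C(I, Fin d → ℝ) =>
      (G.g t)⁻¹ *ᵥ u (projIcc 0 1 zero_le_one t) :=
    continuous_const.matrix_mulVec (continuous_eval_const _)
  unfold Δ
  by_cases hi : i.1 = 0
  · simp only [if_pos hi]
    exact continuous_const.matrix_mulVec (h 1)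
  · simp only [if_neg hi]
    exact ((continuous_const.matrix_mulVec (h _)).sub (continuous_const.matrix_mulVec (h _))).sub
      (continuous_const.matrix_mulVec (h _))

/-! ### The space `E` -/

variable (G T sg) in
/-- The space `E` as a subspace of the space of continuous paths. -/
noncomputable def ESubmodule : Submodule ℝ C(I, Fin d → ℝ) where
  carrier := G.E T sg
  zero_mem' := by
    refine ⟨rfl, ?_⟩
    have : ∀ i, G.Δ T sg i ((0 : C(I, Fin d → ℝ)) : I → Fin d → ℝ) = 0 := fun i => Δ_zero i
    simp only [this, Pi.zero_apply, ne_eq, OfNat.ofNat_ne_zero, not_false_eq_true, zero_pow,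
      Finset.sum_const_zero]
    exact summable_zero
  add_mem' := by
    rintro u v ⟨hu0, hu⟩ ⟨hv0, hv⟩
    refine ⟨by simp [hu0, hv0], ?_⟩
    have : ∀ i, G.Δ T sg i (u + v : C(I, Fin d → ℝ)) = G.Δ T sg i u + G.Δ T sg i v :=
      fun i => Δ_add i u v
    refine Summable.of_nonneg_of_le (fun i => Finset.sum_nonneg fun a _ => sq_nonneg _)
      (fun i => ?_) ((hu.mul_left 2).add (hv.mul_left 2))
    rw [Finset.mul_sum, Finset.mul_sum, ← Finset.sum_add_distrib]
    refine Finset.sum_le_sum fun a _ => ?_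
    rw [this i, Pi.add_apply]
    nlinarith [sq_nonneg (G.Δ T sg i u a - G.Δ T sg i v a)]
  smul_mem' := by
    rintro r u ⟨hu0, hu⟩
    refine ⟨by simp [hu0], ?_⟩
    have : ∀ i, G.Δ T sg i (r • u : C(I, Fin d → ℝ)) = r • G.Δ T sg i u :=
      fun i => Δ_smul i r u
    refine (hu.mul_left (r ^ 2)).congr fun i => ?_
    rw [this i, Finset.mul_sum]
    refine Finset.sum_congr rfl fun a _ => ?_
    rw [Pi.smul_apply, smul_eq_mul, mul_pow]

theorem mem_ESubmodule {u : C(I, Fin d → ℝ)} : u ∈ G.ESubmodule T sg ↔ u ∈ G.E T sg := Iff.rfl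

theorem coe_ESubmodule : (G.ESubmodule T sg : Set C(I, Fin d → ℝ)) = G.E T sg := rfl

/-- Bessel's inequality, the coefficients being inner products with an orthonormal family. -/
theorem summable_sq_Δ_path (hG : G.Nondegenerate)
    (hsg : ∀ i, sg i * (sg i)ᵀ = G.bridgeCov T i) (w : L2Path m) :
    Summable fun i : Idx => ∑ a, (G.Δ T sg i (G.path w) a) ^ 2 := by
  have h := (orthonormal_φcol hG hsg).inner_products_summable (x := w)
  have h2 := h.prod
  refine h2.congr fun i => ?_
  rw [tsum_fintype]
  refine Finset.sum_congr rfl fun a _ => ?_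
  rw [Δ_path hG hsg, Real.norm_eq_abs, sq_abs]

theorem path_mem_E (hG : G.Nondegenerate) (hsg : ∀ i, sg i * (sg i)ᵀ = G.bridgeCov T i)
    (w : L2Path m) (hw : Continuous (G.path w)) :
    (⟨G.path w, hw⟩ : C(I, Fin d → ℝ)) ∈ G.E T sg :=
  ⟨path_zero w, summable_sq_Δ_path hG hsg w⟩

/-! ### The operator `𝓛` and the inner product -/

theorem toL2Path_φ_mulVec (hG : G.Nondegenerate)
    (hsg : ∀ i, sg i * (sg i)ᵀ = G.bridgeCov T i) (i : Idx) (c : Fin d → ℝ) :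
    toL2Path (fun t => G.φ T sg i t *ᵥ c) = ∑ j, c j • toL2Path (G.φcol T sg i j) := by
  simp_rw [← toL2Path_smul _ (memLp_φcol hG hsg i _)]
  rw [← toL2Path_sum (u := fun j t => c j • G.φcol T sg i j t) _
    fun j _ => (memLp_φcol hG hsg i j).const_smul (c j)]
  congr 1
  ext t b
  simp [Matrix.mulVec, dotProduct, φcol, mul_comm]

theorem Lop_eq (hG : G.Nondegenerate) (hsg : ∀ i, sg i * (sg i)ᵀ = G.bridgeCov T i)
    (u : I → Fin d → ℝ) :
    G.Lop T sg u = ∑' i, ∑ j, G.Δ T sg i u j • toL2Path (G.φcol T sg i j) := by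
  simp only [Lop, toL2Path_φ_mulVec hG hsg]

theorem summable_Lop (hG : G.Nondegenerate) (hsg : ∀ i, sg i * (sg i)ᵀ = G.bridgeCov T i)
    {u : I → Fin d → ℝ} (hu : Summable fun i : Idx => ∑ a, (G.Δ T sg i u a) ^ 2) :
    Summable fun i => ∑ j, G.Δ T sg i u j • toL2Path (G.φcol T sg i j) := by
  have h1 : Summable fun p : Idx × Fin d => ‖G.Δ T sg p.1 u p.2‖ ^ 2 := by
    rw [summable_prod_of_nonneg fun p => sq_nonneg _]
    refine ⟨fun i => (hasSum_fintype _).summable, hu.congr fun i => ?_⟩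
    rw [tsum_fintype]
    simp only [Real.norm_eq_abs, sq_abs]
  have h2 := ((orthonormal_φcol hG hsg).orthogonalFamily.summable_iff_norm_sq_summable
    (fun p : Idx × Fin d => G.Δ T sg p.1 u p.2)).2 h1
  refine h2.prod.congr fun i => ?_
  rw [tsum_fintype]
  simp

theorem inner_φcol_Lop (hG : G.Nondegenerate) (hsg : ∀ i, sg i * (sg i)ᵀ = G.bridgeCov T i)
    {u : I → Fin d → ℝ} (hu : Summable fun i : Idx => ∑ a, (G.Δ T sg i u a) ^ 2)
    (i : Idx) (j : Fin d) :
    inner ℝ (toL2Path (G.φcol T sg i j)) (G.Lop T sg u) = G.Δ T sg i u j := by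
  rw [Lop_eq hG hsg]
  have h1 := ((summable_Lop hG hsg hu).hasSum.mapL
    (innerSL ℝ (toL2Path (G.φcol T sg i j)))).tsum_eq
  rw [innerSL_apply_apply] at h1
  rw [← h1]
  have h2 : ∀ i', innerSL ℝ (toL2Path (G.φcol T sg i j))
      (∑ j', G.Δ T sg i' u j' • toL2Path (G.φcol T sg i' j')) =
        ∑ j', G.Δ T sg i' u j' * if (i, j) = (i', j') then 1 else 0 := fun i' => by
    rw [innerSL_apply_apply, inner_sum]
    refine Finset.sum_congr rfl fun j' _ => ?_
    rw [inner_smul_right]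
    congr 1
    exact (orthonormal_iff_ite.1 (orthonormal_φcol hG hsg)) (i, j) (i', j')
  simp_rw [h2]
  rw [tsum_eq_single i fun i' hi' => by simp [hi'.symm]]
  simp

theorem Lop_ψcol (hG : G.Nondegenerate) (hsg : ∀ i, sg i * (sg i)ᵀ = G.bridgeCov T i)
    (i : Idx) (j : Fin d) : G.Lop T sg (G.ψcol T sg i j) = toL2Path (G.φcol T sg i j) := by
  rw [Lop_eq hG hsg]
  simp_rw [Δ_ψcol hG hsg]
  rw [tsum_eq_single i fun i' hi' => by simp [hi']]
  simp

theorem ip_ψcol (hG : G.Nondegenerate) (hsg : ∀ i, sg i * (sg i)ᵀ = G.bridgeCov T i)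
    {u : C(I, Fin d → ℝ)} (hu : u ∈ G.E T sg) (i : Idx) (j : Fin d) :
    G.ip T sg (G.ψcol T sg i j) u = G.Δ T sg i u j := by
  rw [ip, Lop_ψcol hG hsg, inner_φcol_Lop hG hsg hu.2]

/-! ### The extended pairing -/

/-- On $\mathcal E$ the pairing coincides with $\Delta$, a finite combination of point evaluations,
which is continuous for uniform convergence. -/
theorem tendsto_ip_ψcol (hG : G.Nondegenerate) (hsg : ∀ i, sg i * (sg i)ᵀ = G.bridgeCov T i)
    (x : C(I, Fin d → ℝ)) (i : Idx) (j : Fin d) :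
    Tendsto (fun u : C(I, Fin d → ℝ) => G.ip T sg (G.ψcol T sg i j) u) (𝓝[G.E T sg] x)
      (𝓝 (G.Δ T sg i x j)) := by
  have h : Tendsto (fun u : C(I, Fin d → ℝ) => G.Δ T sg i u j) (𝓝[G.E T sg] x)
      (𝓝 (G.Δ T sg i x j)) :=
    (((continuous_apply j).comp (continuous_Δ i)).tendsto x).mono_left nhdsWithin_le_nhds
  refine h.congr' ?_
  filter_upwards [self_mem_nhdsWithin] with u hu
  rw [ip_ψcol hG hsg hu]

theorem hasExtInner_ψcol (hG : G.Nondegenerate) (hsg : ∀ i, sg i * (sg i)ᵀ = G.bridgeCov T i)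
    {x : C(I, Fin d → ℝ)} (hx : x ∈ closure (G.E T sg)) (i : Idx) (j : Fin d) :
    G.HasExtInner T sg (G.ψcol T sg i j) x (G.Δ T sg i x j) :=
  ⟨hx, tendsto_ip_ψcol hG hsg x i j⟩

theorem extP_eq (hG : G.Nondegenerate) (hsg : ∀ i, sg i * (sg i)ᵀ = G.bridgeCov T i)
    {x : C(I, Fin d → ℝ)} (hx : x ∈ closure (G.E T sg)) (i : Idx) :
    G.extP T sg i x = G.Δ T sg i x := by
  ext j
  exact extendFrom_eq hx (tendsto_ip_ψcol hG hsg x i j)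

/-! ### The finite-dimensional projections of a path -/

/-- The path `∑_{n < N} ψ_{n,k} Δ(u)_{n,k}`. -/
noncomputable def partialSum (hG : G.Nondegenerate)
    (hsg : ∀ i, sg i * (sg i)ᵀ = G.bridgeCov T i) (N : ℕ) (u : C(I, Fin d → ℝ)) :
    C(I, Fin d → ℝ) :=
  ∑ i ∈ idxBelow N, ∑ j, G.Δ T sg i u j •
    (⟨G.ψcol T sg i j, continuous_ψcol hG hsg i j⟩ : C(I, Fin d → ℝ))

theorem partialSum_apply (hG : G.Nondegenerate)
    (hsg : ∀ i, sg i * (sg i)ᵀ = G.bridgeCov T i) (N : ℕ) (u : C(I, Fin d → ℝ)) (t : I) :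
    partialSum hG hsg N u t = ∑ i ∈ idxBelow N, G.ψ T sg i t *ᵥ G.Δ T sg i u := by
  ext a
  simp [partialSum, ContinuousMap.sum_apply, Matrix.mulVec, dotProduct, ψcol, mul_comm]

theorem ψcol_mem_ESubmodule (hG : G.Nondegenerate)
    (hsg : ∀ i, sg i * (sg i)ᵀ = G.bridgeCov T i) (i : Idx) (j : Fin d) :
    (⟨G.ψcol T sg i j, continuous_ψcol hG hsg i j⟩ : C(I, Fin d → ℝ)) ∈ G.ESubmodule T sg := by
  have h := path_mem_E hG hsg _ (continuous_path_φcol hG hsg i j)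
  simp only [← ψcol_eq_path hG hsg] at h
  exact h

theorem Δ_partialSum (hG : G.Nondegenerate) (hsg : ∀ i, sg i * (sg i)ᵀ = G.bridgeCov T i)
    (N : ℕ) (u : C(I, Fin d → ℝ)) (i : Idx) :
    G.Δ T sg i (partialSum hG hsg N u) = if i ∈ idxBelow N then G.Δ T sg i u else 0 := by
  have h : (partialSum hG hsg N u : I → Fin d → ℝ) =
      ∑ i ∈ idxBelow N, ∑ j, G.Δ T sg i u j • G.ψcol T sg i j := by
    simp [partialSum]
  rw [h, Δ_sum]
  simp_rw [Δ_sum, Δ_smul]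
  ext j'
  simp only [Finset.sum_apply, Pi.smul_apply, Δ_ψcol hG hsg, smul_eq_mul]
  by_cases hi : i ∈ idxBelow N
  · rw [Finset.sum_eq_single_of_mem i hi fun i' _ hi' => by simp [hi'.symm], if_pos hi]
    simp
  · rw [if_neg hi]
    refine Finset.sum_eq_zero fun i' hi' => Finset.sum_eq_zero fun j _ => ?_
    have : i ≠ i' := fun h => hi (h ▸ hi')
    simp [this]

theorem partialSum_mem_EN (hG : G.Nondegenerate)
    (hsg : ∀ i, sg i * (sg i)ᵀ = G.bridgeCov T i) (N : ℕ) (u : C(I, Fin d → ℝ)) :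
    partialSum hG hsg N u ∈ G.EN T sg N := by
  refine ⟨?_, ?_⟩
  · rw [← mem_ESubmodule]
    exact Submodule.sum_mem _ fun i _ => Submodule.sum_mem _ fun j _ =>
      Submodule.smul_mem _ _ (ψcol_mem_ESubmodule hG hsg i j)
  · rw [Lop_eq hG hsg, tsum_eq_sum (s := idxBelow N)]
    · exact Submodule.sum_mem _ fun i hi => Submodule.sum_mem _ fun j _ =>
        Submodule.smul_mem _ _ (Submodule.subset_span ⟨i, hi, j, rfl⟩)
    · intro i hi
      rw [Δ_partialSum, if_neg hi]
      simp

/-- The path and its partial sum have the same coefficients below level $N$, so the columns of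
$\psi$ pair to zero with the difference. -/
theorem isOrthProj_partialSum (hG : G.Nondegenerate)
    (hsg : ∀ i, sg i * (sg i)ᵀ = G.bridgeCov T i) (N : ℕ) {x : C(I, Fin d → ℝ)}
    (hx : x ∈ closure (G.E T sg)) : G.IsOrthProj T sg N x (partialSum hG hsg N x) := by
  have hmem := partialSum_mem_EN hG hsg N x
  refine ⟨hmem, fun v hv => ⟨?_, ?_⟩⟩
  · rw [← coe_ESubmodule, ← Submodule.topologicalClosure_coe] at hx ⊢
    exact Submodule.sub_mem _ hx (Submodule.le_topologicalClosure _ hmem.1)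
  · have hv' := hv.2
    unfold ip
    -- The pairing depends on `v` only through $\mathcal L[v]$, so the induction over the span can
    -- run in $L^2$.
    generalize G.Lop T sg v = w at hv'
    induction hv' using Submodule.span_induction with
    | mem w hw =>
      obtain ⟨i, hi, j, rfl⟩ := hw
      have h := tendsto_ip_ψcol hG hsg (x - partialSum hG hsg N x) i j
      have h0 : G.Δ T sg i (x - partialSum hG hsg N x : C(I, Fin d → ℝ)) = 0 := by
        rw [ContinuousMap.coe_sub, Δ_sub, Δ_partialSum, if_pos hi, sub_self]
      simpa only [h0, Pi.zero_apply, ip, Lop_ψcol hG hsg] using h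
    | zero => simpa using tendsto_const_nhds
    | add w w' _ _ h h' => simpa [inner_add_left] using h.add h'
    | smul r w _ h => simpa [inner_smul_left] using h.const_mul r

end GaussMarkov

/-! ### Countably many functionals detect membership in a closed subspace -/

/-- The functionals norm the classes in $V/K$ of a dense sequence. If all of them vanish at $x$ and
$y$ is a term of the sequence near $x$, then $\|[y]\|=-\varphi_n(x-y)\le\|x-y\|$, so $\|[x]\|$ is
arbitrarily small. -/
theorem Submodule.exists_seq_dual_mem_closure {V : Type*} [NormedAddCommGroup V] [NormedSpace ℝ V]
    [TopologicalSpace.SeparableSpace V] (K : Submodule ℝ V) :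
    ∃ φ : ℕ → StrongDual ℝ V, (∀ n, ∀ u ∈ K, φ n u = 0) ∧
      ∀ x, (∀ n, φ n x = 0) → x ∈ closure (K : Set V) := by
  choose g hg1 hg2 using fun n : ℕ => exists_dual_vector'' ℝ
    (Submodule.Quotient.mk (TopologicalSpace.denseSeq V n) : V ⧸ K)
  refine ⟨fun n => (g n).comp K.mkQL, fun n u hu => ?_, fun x hx => ?_⟩
  · have : K.mkQL u = 0 := (Submodule.Quotient.mk_eq_zero K).2 hu
    simp [this]
  · have hx0 : ‖(Submodule.Quotient.mk x : V ⧸ K)‖ = 0 := by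
      refine le_antisymm (le_of_forall_pos_le_add fun ε hε => ?_) (norm_nonneg _)
      obtain ⟨n, hn⟩ := (TopologicalSpace.denseRange_denseSeq V).exists_dist_lt x (half_pos hε)
      set y := TopologicalSpace.denseSeq V n
      rw [dist_eq_norm] at hn
      have h1 : (Submodule.Quotient.mk x : V ⧸ K) =
          Submodule.Quotient.mk y + Submodule.Quotient.mk (x - y) := by
        rw [← Submodule.Quotient.mk_add, add_sub_cancel]
      have h2 : ‖(Submodule.Quotient.mk (x - y) : V ⧸ K)‖ ≤ ‖x - y‖ :=
        Submodule.Quotient.norm_mk_le _ _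
      have h3 : ‖(Submodule.Quotient.mk y : V ⧸ K)‖ ≤ ‖x - y‖ := by
        have h4 : g n (Submodule.Quotient.mk y) = -g n (Submodule.Quotient.mk (x - y)) := by
          have : g n (Submodule.Quotient.mk x) = 0 := hx n
          rw [h1, map_add] at this
          linarith
        have h5 : ‖(Submodule.Quotient.mk y : V ⧸ K)‖ =
            -g n (Submodule.Quotient.mk (x - y)) := by
          rw [← h4]
          exact (hg2 n).symm
        rw [h5]
        refine (neg_le_abs _).trans (((g n).le_opNorm _).trans ?_)
        calc ‖g n‖ * ‖(Submodule.Quotient.mk (x - y) : V ⧸ K)‖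
            ≤ 1 * ‖x - y‖ := by gcongr; exact hg1 n
          _ = ‖x - y‖ := one_mul _
      calc ‖(Submodule.Quotient.mk x : V ⧸ K)‖
          ≤ ‖(Submodule.Quotient.mk y : V ⧸ K)‖ + ‖(Submodule.Quotient.mk (x - y) : V ⧸ K)‖ := by
            rw [h1]; exact norm_add_le _ _
        _ ≤ 0 + ε := by linarith
    exact QuotientAddGroup.norm_mk_eq_zero_iff_mem_closure.1 hx0

/-! ### Weakly null sequences of Wiener integrals -/

/-- Let $\chi$ be the characteristic function of the limit and $a_k$ that of $Y_k$. The cross term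
$\langle w_n,w_k\rangle$ disappears as $n\to\infty$, so $Y'-Y_k$ has characteristic function $\chi
a_k$. Letting $k\to\infty$ gives $1=\chi^2$, and $\chi\ge0$ as a limit of positive numbers, so
$\chi=1$. No bound on $\|w_n\|$ is required. -/
theorem IsL2WienerIntegral.ae_eq_zero_of_tendsto {Ω : Type*} [MeasurableSpace Ω] {m : ℕ}
    {W : I → Ω → Fin m → ℝ} {P : Measure Ω} [IsProbabilityMeasure P] (hW : IsWienerProcess W P)
    {w : ℕ → L2Path m} {Y : ℕ → Ω → ℝ} {Y' : Ω → ℝ}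
    (h : ∀ n, IsL2WienerIntegral W P (w n) (Y n))
    (hw : ∀ k, Tendsto (fun n => inner ℝ (w n) (w k)) atTop (𝓝 0))
    (hY : ∀ ω, Tendsto (fun n => Y n ω) atTop (𝓝 (Y' ω))) : Y' =ᵐ[P] 0 := by
  have hYm : ∀ n, AEMeasurable (Y n) P := fun n => (h n).1.1.aemeasurable
  have hYm' : AEMeasurable Y' P := aemeasurable_of_tendsto_metrizable_ae' hYm (ae_of_all _ hY)
  have key : ∀ θ : ℝ, charFun (P.map Y') θ = 1 := by
    intro θ
    set a : ℕ → ℝ := fun n => Real.exp (-(‖w n‖ ^ 2 * θ ^ 2 / 2)) with ha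
    have h1 : Tendsto (fun n => (a n : ℂ)) atTop (𝓝 (charFun (P.map Y') θ)) := by
      refine (tendsto_charFun_map_of_ae_tendsto hYm hYm' (ae_of_all _ hY) θ).congr fun n => ?_
      rw [(h n).charFun_map hW, ha, Complex.ofReal_exp]
    have h2 : ∀ k, charFun (P.map (fun ω => Y' ω - Y k ω)) θ =
        charFun (P.map Y') θ * a k := by
      intro k
      refine tendsto_nhds_unique (tendsto_charFun_map_of_ae_tendsto
        (fun n => (hYm n).sub (hYm k)) (hYm'.sub (hYm k))
        (ae_of_all _ fun ω => (hY ω).sub_const _) θ) ?_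
      have h3 : Tendsto (fun n => (a n : ℂ) * a k *
          (Real.exp (inner ℝ (w n) (w k) * θ ^ 2) : ℝ)) atTop
          (𝓝 (charFun (P.map Y') θ * a k * (Real.exp (0 * θ ^ 2) : ℝ))) := by
        refine (h1.mul_const _).mul ?_
        exact ((Complex.continuous_ofReal.comp Real.continuous_exp).tendsto _).comp
          ((hw k).mul_const _)
      simp only [zero_mul, Real.exp_zero, Complex.ofReal_one, mul_one] at h3
      refine h3.congr fun n => ?_
      have h4 := ((h n).sub hW (h k)).charFun_map hW θ
      change _ = charFun (P.map (fun ω => Y n ω - Y k ω)) θ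
      rw [h4, ← Complex.ofReal_exp, ← Complex.ofReal_mul, ← Complex.ofReal_mul, ha,
        ← Real.exp_add, ← Real.exp_add, norm_sub_sq_real]
      congr 2
      ring
    have h5 : Tendsto (fun k => charFun (P.map (fun ω => Y' ω - Y k ω)) θ) atTop
        (𝓝 (charFun (P.map fun _ => (0 : ℝ)) θ)) :=
      tendsto_charFun_map_of_ae_tendsto (fun k => hYm'.sub (hYm k)) aemeasurable_const
        (ae_of_all _ fun ω => by simpa using (hY ω).const_sub (Y' ω)) θ
    rw [Measure.map_const, measure_univ, one_smul, charFun_dirac] at h5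
    simp only [inner_zero_left, Complex.ofReal_zero, zero_mul, Complex.exp_zero] at h5
    simp_rw [h2] at h5
    -- Here $k\to\infty$, with $Y'-Y_k\to0$ on the left.
    have h6 : charFun (P.map Y') θ * charFun (P.map Y') θ = 1 :=
      tendsto_nhds_unique (h1.const_mul _) h5
    have h7 : 0 ≤ (charFun (P.map Y') θ).re := by
      have := (Complex.continuous_re.tendsto _).comp h1
      exact ge_of_tendsto' this fun n => (Real.exp_pos _).le
    rcases mul_self_eq_one_iff.1 h6 with h8 | h8
    · exact h8
    · rw [h8] at h7
      norm_num at h7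
  have := Measure.isProbabilityMeasure_map (μ := P) hYm'
  have hd : P.map Y' = Measure.dirac 0 := by
    refine Measure.ext_of_charFun (funext fun θ => ?_)
    rw [key, charFun_dirac]
    simp
  have h2 : ∀ᵐ x ∂(P.map Y'), x = 0 := by
    rw [hd, ae_dirac_eq]
    exact rfl
  exact ae_of_ae_map hYm' h2

/-! ### The paths of the process are in the closure of `E` -/

namespace GaussMarkov

variable {d m : ℕ} {G : GaussMarkov d m} {T : NestedSupports}
  {sg : Idx → Matrix (Fin d) (Fin d) ℝ} {Ω : Type*} [MeasurableSpace Ω] {P : Measure Ω}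
  {W : I → Ω → Fin m → ℝ} {X : Ω → C(I, Fin d → ℝ)}

theorem isL2WienerIntegral_process
    (hX : ∀ (t : I) (a : Fin d),
      IsWienerIntegral W P (fun s => G.k t s a) (fun ω => X ω t a)) (t : I) (a : Fin d) :
    IsL2WienerIntegral W P (G.greenL2 t (G.g t a)) (fun ω => X ω t a) := by
  have h := hX t a
  simp only [k_row_eq] at h
  exact (isWienerIntegral_iff (G.memLp_green _ _)).1 h

/-- A Bernstein polynomial depends on finitely many values of the path, so a functional of it is a
finite combination of values of $X$. -/
theorem map_bernsteinApproximation (φ : StrongDual ℝ C(I, Fin d → ℝ)) (n : ℕ)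
    (x : C(I, Fin d → ℝ)) : φ (bernsteinApproximation n x) = ∑ k : Fin (n + 1), ∑ a,
      φ (bernstein n k • .const _ (Pi.single a 1)) * x (bernstein.z k) a := by
  rw [bernsteinApproximation, map_sum]
  refine Finset.sum_congr rfl fun k _ => ?_
  have : bernstein n k • ContinuousMap.const I (x (bernstein.z k)) =
      ∑ a, x (bernstein.z k) a • (bernstein n k • ContinuousMap.const I
        (Pi.single a 1 : Fin d → ℝ)) := by
    ext t b
    simp [ContinuousMap.sum_apply, Finset.sum_apply, Pi.single_apply, mul_comm]
  rw [this, map_sum]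
  refine Finset.sum_congr rfl fun a _ => ?_
  rw [map_smul, smul_eq_mul, mul_comm]

/-- The functional applied to the Bernstein polynomials of $X$ is the Wiener integral of `w n`, and
$\langle w_n,\cdot\rangle$ at a Green function is the functional at the Bernstein polynomials of
that function's path. This path is in $\mathcal E$, so these pairings tend to zero; each `w k` is a
finite combination of Green functions. -/
theorem ae_dual_eq_zero [IsProbabilityMeasure P] (hG : G.Nondegenerate)
    (hsg : ∀ i, sg i * (sg i)ᵀ = G.bridgeCov T i) (hW : IsWienerProcess W P)
    (hX : ∀ (t : I) (a : Fin d),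
      IsWienerIntegral W P (fun s => G.k t s a) (fun ω => X ω t a))
    (φ : StrongDual ℝ C(I, Fin d → ℝ)) (hφ : ∀ u ∈ G.E T sg, φ u = 0) :
    ∀ᵐ ω ∂P, φ (X ω) = 0 := by
  set b : (n : ℕ) → Fin (n + 1) → Fin d → ℝ := fun n k a =>
    φ (bernstein n k • .const _ (Pi.single a 1)) with hb
  set w : ℕ → L2Path m := fun n => ∑ k : Fin (n + 1), ∑ a,
    b n k a • G.greenL2 (bernstein.z k : I) (G.g (bernstein.z k : I) a) with hw
  have hconv : ∀ x : C(I, Fin d → ℝ),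
      Tendsto (fun n => φ (bernsteinApproximation n x)) atTop (𝓝 (φ x)) := fun x =>
    (φ.continuous.tendsto x).comp (bernsteinApproximation_uniform x)
  have hgreen : ∀ (t : I) (c : Fin d → ℝ),
      Tendsto (fun n => inner ℝ (w n) (G.greenL2 t c)) atTop (𝓝 0) := fun t c => by
    have hc := continuous_path_greenL2 (G := G) t.2 c
    have h1 := hconv ⟨G.path (G.greenL2 t c), hc⟩
    rw [hφ _ (path_mem_E hG hsg _ hc)] at h1
    refine h1.congr fun n => ?_
    rw [map_bernsteinApproximation, hw, sum_inner]
    refine Finset.sum_congr rfl fun k _ => ?_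
    rw [sum_inner]
    refine Finset.sum_congr rfl fun a _ => ?_
    rw [real_inner_smul_left, real_inner_comm]
    rfl
  refine IsL2WienerIntegral.ae_eq_zero_of_tendsto hW (w := w)
    (Y := fun n ω => φ (bernsteinApproximation n (X ω))) (fun n => ?_) (fun k => ?_)
    fun ω => hconv (X ω)
  · simp only [map_bernsteinApproximation]
    exact IsL2WienerIntegral.sum hW _ fun k _ => IsL2WienerIntegral.sum hW _ fun a _ =>
      (isL2WienerIntegral_process hX _ a).smul hW _
  · have : (fun n => inner ℝ (w n) (w k)) = fun n => ∑ j : Fin (k + 1), ∑ a, b k j a *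
        inner ℝ (w n) (G.greenL2 (bernstein.z j : I) (G.g (bernstein.z j : I) a)) := by
      ext n
      have hk : w k = ∑ j : Fin (k + 1), ∑ a,
        b k j a • G.greenL2 (bernstein.z j : I) (G.g (bernstein.z j : I) a) := rfl
      rw [hk]
      simp only [inner_sum, real_inner_smul_right]
    rw [this]
    have h3 := tendsto_finsetSum Finset.univ fun (j : Fin (k + 1)) _ =>
      tendsto_finsetSum Finset.univ fun (a : Fin d) _ =>
        (hgreen (bernstein.z j) (G.g (bernstein.z j : I) a)).const_mul (b k j a)
    simpa only [mul_zero, Finset.sum_const_zero] using h3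

theorem ae_mem_closure_E [IsProbabilityMeasure P] (hG : G.Nondegenerate)
    (hsg : ∀ i, sg i * (sg i)ᵀ = G.bridgeCov T i) (hW : IsWienerProcess W P)
    (hX : ∀ (t : I) (a : Fin d),
      IsWienerIntegral W P (fun s => G.k t s a) (fun ω => X ω t a)) :
    ∀ᵐ ω ∂P, X ω ∈ closure (G.E T sg) := by
  obtain ⟨φ, h1, h2⟩ := (G.ESubmodule T sg).exists_seq_dual_mem_closure
  filter_upwards [ae_all_iff.2 fun n => ae_dual_eq_zero hG hsg hW hX (φ n) (h1 n)] with ω hω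
  exact h2 _ hω

end GaussMarkov

theorem NestedSupports.endpoints_mono (T : NestedSupports) : Monotone T.endpoints := by
  rintro N N' h t (⟨n, k, h1, h2, h3⟩ | h')
  · exact Or.inl ⟨n, k, h1, h2.trans_le h, h3⟩
  · exact Or.inr h'

theorem mem_idxBelow {N : ℕ} {i : Idx} : i ∈ idxBelow N ↔ i.1 < N := by simp [idxBelow]

namespace GaussMarkov

variable {d m : ℕ} {G : GaussMarkov d m} {T : NestedSupports}
  {sg : Idx → Matrix (Fin d) (Fin d) ℝ}

/-! ### The span of the Green functions at the endpoints -/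

/-- The columns of an invertible matrix span all directions. -/
theorem greenL2_mem_of_isUnit_det {S : Submodule ℝ (L2Path m)} {t : ℝ}
    {A : Matrix (Fin d) (Fin d) ℝ} (hA : IsUnit A.det) (h : ∀ j, G.greenL2 t (Aᵀ j) ∈ S)
    (c : Fin d → ℝ) : G.greenL2 t c ∈ S := by
  have hc : c = ∑ j, (A⁻¹ *ᵥ c) j • Aᵀ j := by
    have h1 : A *ᵥ (A⁻¹ *ᵥ c) = c := by
      rw [Matrix.mulVec_mulVec, Matrix.mul_nonsing_inv _ hA, Matrix.one_mulVec]
    conv_lhs => rw [← h1]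
    ext a
    simp [Matrix.mulVec, dotProduct, Finset.sum_apply, mul_comm]
  rw [hc, map_sum]
  exact S.sum_mem fun j _ => by
    rw [map_smul]
    exact S.smul_mem _ (h j)

theorem toL2Path_φcol_mem_L2fN {N : ℕ} {i : Idx} (hi : i.1 < N) (j : Fin d) :
    toL2Path (G.φcol T sg i j) ∈ G.L2fN T sg N :=
  Submodule.subset_span ⟨i, mem_idxBelow.2 hi, j, rfl⟩

theorem L2fN_mono : Monotone (G.L2fN T sg) := fun N N' h =>
  Submodule.span_le.2 (by
    rintro _ ⟨i, hi, j, rfl⟩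
    exact toL2Path_φcol_mem_L2fN ((mem_idxBelow.1 hi).trans_le h) j)

/-- By induction on the level: since $M$ is invertible, the formula for $\phi_{n,k}$ can be solved
for the Green functions at $m$ in terms of $\phi_{n,k}$ and those at the older points $l$ and $r$.
-/
theorem greenL2_mem_L2fN (hG : G.Nondegenerate) (hsg : ∀ i, sg i * (sg i)ᵀ = G.bridgeCov T i)
    {N : ℕ} (hN : 1 ≤ N) {t : ℝ} (ht : t ∈ T.endpoints N) (c : Fin d → ℝ) :
    G.greenL2 t c ∈ G.L2fN T sg N := by
  have h01 : ∀ N, 1 ≤ N → ∀ t ∈ ({0, 1} : Set ℝ), ∀ c, G.greenL2 t c ∈ G.L2fN T sg N := by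
    rintro N hN _ (rfl | rfl) c
    · rw [greenL2_zero]
      exact Submodule.zero_mem _
    · refine greenL2_mem_of_isUnit_det (isUnit_det_L_zero hG hsg) (fun j => ?_) c
      rw [← toL2Path_φcol_zero]
      exact toL2Path_φcol_mem_L2fN hN j
  induction N, hN using Nat.le_induction generalizing t c with
  | base =>
    rcases ht with ⟨n, k, h1, h2, -⟩ | ht
    · omega
    · exact h01 1 le_rfl t ht c
  | succ N hN ih =>
    rcases ht with ⟨n, k, h1, h2, hk, rfl⟩ | ht
    · rcases Nat.lt_succ_iff_lt_or_eq.1 h2 with h3 | rfl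
      · exact L2fN_mono N.le_succ (ih (Or.inl ⟨n, k, h1, h3, hk, rfl⟩) c)
      · let i : Idx := ⟨n, k, hk⟩
        refine greenL2_mem_of_isUnit_det (isUnit_det_M hG hsg (i := i) h1) (fun j => ?_) c
        have h3 := toL2Path_φcol hG hsg (i := i) h1 j
        rw [sub_sub, eq_sub_iff_add_eq] at h3
        have hlr := T.mem_endpoints_l_r h1 hk
        have h4 : G.greenL2 (T.m n k) ((G.M T sg i)ᵀ j) = _ := h3.symm
        rw [h4]
        exact Submodule.add_mem _ (toL2Path_φcol_mem_L2fN (Nat.lt_succ_self n) j)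
          (Submodule.add_mem _ (L2fN_mono n.le_succ (ih hlr.1 _))
            (L2fN_mono n.le_succ (ih hlr.2 _)))
    · exact h01 _ (hN.trans N.le_succ) t ht c

theorem kN_row_eq (N : ℕ) (t : ℝ) (a : Fin d) : (fun s => G.kN T sg N t s a) =
    fun s => ∑ i ∈ idxBelow N, ∑ j, G.ψ T sg i t a j • G.φcol T sg i j s := by
  ext s b
  rw [kN, Matrix.sum_apply, Finset.sum_apply]
  refine Finset.sum_congr rfl fun i _ => ?_
  simp [Matrix.mul_apply, Finset.sum_apply, φcol]

theorem memLp_kN (hG : G.Nondegenerate) (hsg : ∀ i, sg i * (sg i)ᵀ = G.bridgeCov T i) (N : ℕ)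
    (t : ℝ) (a : Fin d) :
    MemLp (fun s => G.kN T sg N t s a) 2 (volume.restrict (Icc (0 : ℝ) 1)) := by
  rw [kN_row_eq]
  exact memLp_finsetSum _ fun i _ => memLp_finsetSum _ fun j _ =>
    (memLp_φcol hG hsg i j).const_smul (G.ψ T sg i t a j)

theorem toL2Path_kN (hG : G.Nondegenerate) (hsg : ∀ i, sg i * (sg i)ᵀ = G.bridgeCov T i) (N : ℕ)
    (t : ℝ) (a : Fin d) : toL2Path (fun s => G.kN T sg N t s a) =
      ∑ i ∈ idxBelow N, ∑ j, G.ψ T sg i t a j • toL2Path (G.φcol T sg i j) := by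
  have h : ∀ i j, MemLp (fun s => G.ψ T sg i t a j • G.φcol T sg i j s) 2
      (volume.restrict (Icc (0 : ℝ) 1)) := fun i j =>
    (memLp_φcol hG hsg i j).const_smul (G.ψ T sg i t a j)
  rw [kN_row_eq, toL2Path_sum _ fun i _ => memLp_finsetSum _ fun j _ => h i j]
  refine Finset.sum_congr rfl fun i _ => ?_
  rw [toL2Path_sum _ fun j _ => h i j]
  exact Finset.sum_congr rfl fun j _ => toL2Path_smul _ (memLp_φcol hG hsg i j)

/-- Row $a$ of $k_N(t,\cdot)$ is the orthogonal projection of row $a$ of $k(t,\cdot)$, as the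
entries of $\psi(t)$ are its coefficients in the orthonormal system. -/
theorem inner_sub_kN (hG : G.Nondegenerate) (hsg : ∀ i, sg i * (sg i)ᵀ = G.bridgeCov T i) (N : ℕ)
    {t : ℝ} (ht : t ∈ Icc (0 : ℝ) 1) (a : Fin d) {w : L2Path m} (hw : w ∈ G.L2fN T sg N) :
    inner ℝ (G.greenL2 t (G.g t a) - toL2Path (fun s => G.kN T sg N t s a)) w = 0 := by
  induction hw using Submodule.span_induction with
  | mem w hw =>
    obtain ⟨i, hi, j, rfl⟩ := hw
    rw [inner_sub_left, real_inner_comm, inner_φcol_greenL2 hG hsg i j ht,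
      toL2Path_kN hG hsg N t a,
      sub_eq_zero, sum_inner]
    have h1 : ∀ i' j', inner ℝ (toL2Path (G.φcol T sg i' j')) (toL2Path (G.φcol T sg i j)) =
        if (i', j') = (i, j) then (1 : ℝ) else 0 := fun i' j' =>
      (orthonormal_iff_ite.1 (orthonormal_φcol hG hsg)) (i', j') (i, j)
    simp only [sum_inner, real_inner_smul_left, h1]
    rw [Finset.sum_eq_single_of_mem i hi fun i' _ hi' => by simp [hi']]
    simp
  | zero => simp
  | add w w' _ _ h h' => rw [inner_add_right, h, h', add_zero]
  | smul r w _ h => rw [inner_smul_right, h, mul_zero]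

/-! ### The conditioned process -/

variable {Ω : Type*} {X : Ω → C(I, Fin d → ℝ)}

theorem measurable_endpointSigma {N : ℕ} {t : ℝ} (ht : t ∈ T.endpoints N)
    (ht' : t ∈ Icc (0 : ℝ) 1) :
    Measurable[endpointSigma T X N] fun ω => X ω (projIcc 0 1 zero_le_one t) := by
  rw [projIcc_of_mem _ ht']
  exact measurable_iff_comap_le.2 (le_iSup₂_of_le (⟨t, ht'⟩ : I) ht le_rfl)

theorem measurable_Δ {N : ℕ} {i : Idx} (hi : i.1 < N) :
    Measurable[endpointSigma T X N] fun ω => G.Δ T sg i (X ω) := by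
  have key : ∀ (A B : Matrix (Fin d) (Fin d) ℝ) (t : ℝ), t ∈ T.endpoints N → t ∈ Icc (0 : ℝ) 1 →
      Measurable[endpointSigma T X N]
        fun ω => A *ᵥ (B *ᵥ X ω (projIcc 0 1 zero_le_one t)) := fun A B t ht ht' => by
    have hc : Continuous fun x : Fin d → ℝ => A *ᵥ (B *ᵥ x) :=
      continuous_const.matrix_mulVec (continuous_const.matrix_mulVec continuous_id)
    exact hc.measurable.comp (measurable_endpointSigma ht ht')
  rcases i.zero_or_pos with rfl | hi'
  · simp only [Δ, if_pos]
    exact key _ _ 1 (by simp [NestedSupports.endpoints]) ⟨zero_le_one, le_rfl⟩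
  · simp only [Δ, if_neg (show i.1 ≠ 0 by omega)]
    have hlr := T.mem_endpoints_l_r hi' i.2.2
    exact ((key _ _ _ (Or.inl ⟨i.1, i.2, hi', hi, i.2.2, rfl⟩) (NestedSupports.m_mem hi')).sub
      (key _ _ _ (T.endpoints_mono hi.le hlr.1) (NestedSupports.l_mem hi'))).sub
      (key _ _ _ (T.endpoints_mono hi.le hlr.2) (NestedSupports.r_mem hi'))

theorem measurable_partialSum (hG : G.Nondegenerate)
    (hsg : ∀ i, sg i * (sg i)ᵀ = G.bridgeCov T i) (N : ℕ) (t : I) (a : Fin d) :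
    Measurable[endpointSigma T X N] fun ω => partialSum hG hsg N (X ω) t a := by
  simp only [partialSum_apply, Finset.sum_apply]
  refine Finset.measurable_sum _ fun i hi => ?_
  have hc : Continuous fun x : Fin d → ℝ => (G.ψ T sg i t *ᵥ x) a :=
    (continuous_apply a).comp (continuous_const.matrix_mulVec continuous_id)
  exact hc.measurable.comp (measurable_Δ (mem_idxBelow.1 hi))

variable [MeasurableSpace Ω] {P : Measure Ω} {W : I → Ω → Fin m → ℝ}

theorem isL2WienerIntegral_inv_g [IsProbabilityMeasure P] (hW : IsWienerProcess W P)
    (hX : ∀ (t : I) (a : Fin d),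
      IsWienerIntegral W P (fun s => G.k t s a) (fun ω => X ω t a)) {t : ℝ}
    (ht : t ∈ Icc (0 : ℝ) 1) (c : Fin d → ℝ) :
    IsL2WienerIntegral W P (G.greenL2 t c)
      (fun ω => c ⬝ᵥ ((G.g t)⁻¹ *ᵥ X ω (projIcc 0 1 zero_le_one t))) := by
  have h := IsL2WienerIntegral.sum hW Finset.univ fun a _ =>
    (isL2WienerIntegral_process hX ⟨t, ht⟩ a).smul hW ((c ᵥ* (G.g t)⁻¹) a)
  have h1 : ∑ a, (c ᵥ* (G.g t)⁻¹) a • G.greenL2 t (G.g t a) = G.greenL2 t c := by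
    have h2 : c = ∑ a, (c ᵥ* (G.g t)⁻¹) a • G.g t a := by
      have h3 : (c ᵥ* (G.g t)⁻¹) ᵥ* G.g t = c := by
        rw [Matrix.vecMul_vecMul, Matrix.nonsing_inv_mul _ (G.isUnit_det_g ht), Matrix.vecMul_one]
      conv_lhs => rw [← h3]
      ext b
      simp [Matrix.vecMul, dotProduct, Finset.sum_apply]
    conv_rhs => rw [h2, map_sum]
    simp only [map_smul]
  rw [projIcc_of_mem _ ht]
  simp only [Matrix.dotProduct_mulVec]
  rw [← h1]
  exact h

/-- The random counterpart of `Δ_path`: $\Delta(X)$ combines Wiener integrals of Green functions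
exactly as $\phi$ combines the Green functions. -/
theorem isL2WienerIntegral_Δ [IsProbabilityMeasure P] (hG : G.Nondegenerate)
    (hsg : ∀ i, sg i * (sg i)ᵀ = G.bridgeCov T i) (hW : IsWienerProcess W P)
    (hX : ∀ (t : I) (a : Fin d),
      IsWienerIntegral W P (fun s => G.k t s a) (fun ω => X ω t a)) (i : Idx) (j : Fin d) :
    IsL2WienerIntegral W P (toL2Path (G.φcol T sg i j)) (fun ω => G.Δ T sg i (X ω) j) := by
  rcases i.zero_or_pos with rfl | hi
  · rw [toL2Path_φcol_zero]
    exact isL2WienerIntegral_inv_g hW hX ⟨zero_le_one, le_rfl⟩ _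
  · rw [toL2Path_φcol hG hsg hi]
    simp only [Δ, if_neg (show i.1 ≠ 0 by omega)]
    exact ((isL2WienerIntegral_inv_g hW hX (NestedSupports.m_mem hi) _).sub hW
      (isL2WienerIntegral_inv_g hW hX (NestedSupports.l_mem hi) _)).sub hW
      (isL2WienerIntegral_inv_g hW hX (NestedSupports.r_mem hi) _)

theorem isL2WienerIntegral_partialSum [IsProbabilityMeasure P] (hG : G.Nondegenerate)
    (hsg : ∀ i, sg i * (sg i)ᵀ = G.bridgeCov T i) (hW : IsWienerProcess W P)
    (hX : ∀ (t : I) (a : Fin d),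
      IsWienerIntegral W P (fun s => G.k t s a) (fun ω => X ω t a)) (N : ℕ) (t : I) (a : Fin d) :
    IsL2WienerIntegral W P (toL2Path (fun s => G.kN T sg N t s a))
      (fun ω => partialSum hG hsg N (X ω) t a) := by
  rw [toL2Path_kN hG hsg N t a]
  have h := IsL2WienerIntegral.sum hW (idxBelow N) fun i _ =>
    IsL2WienerIntegral.sum hW Finset.univ fun j _ =>
      (isL2WienerIntegral_Δ hG hsg hW hX i j).smul hW (G.ψ T sg i t a j)
  simp only [partialSum_apply, Finset.sum_apply]
  exact h

theorem endpointSigma_le (hXm : ∀ t, Measurable fun ω => X ω t) (N : ℕ) :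
    endpointSigma T X N ≤ ‹MeasurableSpace Ω› :=
  iSup₂_le fun t _ => (hXm t).comap_le

/-- The partial sum depends only on the values at the endpoints. The remainder $R$ is jointly
Gaussian and uncorrelated with these, hence independent of $\mathcal F_N$, and its conditional
expectation is its mean, zero. -/
theorem condExp_process [IsProbabilityMeasure P] (hG : G.Nondegenerate)
    (hsg : ∀ i, sg i * (sg i)ᵀ = G.bridgeCov T i) (hW : IsWienerProcess W P)
    (hXm : ∀ t, Measurable fun ω => X ω t)
    (hX : ∀ (t : I) (a : Fin d),
      IsWienerIntegral W P (fun s => G.k t s a) (fun ω => X ω t a))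
    {N : ℕ} (hN : 1 ≤ N) (t : I) (a : Fin d) :
    (fun ω => partialSum hG hsg N (X ω) t a) =ᵐ[P]
      P[fun ω => X ω t a | endpointSigma T X N] := by
  set Z : Ω → ℝ := fun ω => partialSum hG hsg N (X ω) t a with hZ
  set R : Ω → ℝ := fun ω => X ω t a - Z ω with hR
  have hle := endpointSigma_le (T := T) hXm N
  have hZI := isL2WienerIntegral_partialSum hG hsg hW hX N t a
  have hRI : IsL2WienerIntegral W P _ R := (isL2WienerIntegral_process hX t a).sub hW hZI
  have hZm : Measurable[endpointSigma T X N] Z := measurable_partialSum hG hsg N t a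
  have hRm : Measurable R := ((measurable_pi_apply a).comp (hXm t)).sub (hZm.mono hle le_rfl)
  let Y : {s : I // (s : ℝ) ∈ T.endpoints N} × Fin d → Ω → ℝ := fun p ω => X ω p.1 p.2
  have hYI : ∀ p, IsL2WienerIntegral W P (G.greenL2 (p.1 : I) (G.g (p.1 : I) p.2)) (Y p) :=
    fun p => isL2WienerIntegral_process hX p.1 p.2
  -- The independence criterion concerns two processes; the single variable $R$ is viewed as one
  -- indexed by `Unit`.
  have hind : IndepFun (fun ω (_ : Unit) => R ω) (fun ω p => Y p ω) P := by
    refine IsGaussianProcess.indepFun_of_covariance_eq_zero (X := fun _ : Unit => R)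
      (IsL2WienerIntegral.isGaussianProcess hW (w := Sum.elim
        (fun _ => G.greenL2 t (G.g t a) - toL2Path fun s => G.kN T sg N t s a)
        fun p => G.greenL2 (p.1 : I) (G.g (p.1 : I) p.2)) ?_)
      (fun _ => hRm.aemeasurable) (fun p => (hYI p).1.1.aemeasurable) fun _ p => ?_
    · rintro (_ | p)
      · exact hRI
      · exact hYI p
    · rw [hRI.covariance_eq hW (hYI p)]
      exact inner_sub_kN hG hsg N t.2 a (greenL2_mem_L2fN hG hsg hN p.1.2 _)
  have hindR : IndepFun R (fun ω p => Y p ω) P :=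
    hind.comp (measurable_pi_apply ()) measurable_id
  have hle' : endpointSigma T X N ≤ MeasurableSpace.comap (fun ω p => Y p ω) inferInstance := by
    refine iSup₂_le fun s hs => Measurable.comap_le ?_
    exact (measurable_pi_lambda (fun (y : {s : I // (s : ℝ) ∈ T.endpoints N} × Fin d → ℝ) b =>
      y (⟨s, hs⟩, b)) fun b => measurable_pi_apply _).comp (comap_measurable _)
  have hcond : P[R | endpointSigma T X N] =ᵐ[P] fun _ => ∫ ω, R ω ∂P :=
    condExp_indep_eq hRm.comap_le hle (comap_measurable R).stronglyMeasurable
      (indep_of_indep_of_le_right hindR hle')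
  have hsum : (fun ω => X ω t a) = R + Z := by
    ext ω
    simp [hR]
  have hZi : Integrable Z P := hZI.1.integrable one_le_two
  have hadd := condExp_add (hRI.1.integrable one_le_two) hZi (endpointSigma T X N)
  rw [condExp_of_stronglyMeasurable hle hZm.stronglyMeasurable hZi] at hadd
  rw [hsum]
  filter_upwards [hadd, hcond] with ω h1 h2
  rw [h1, Pi.add_apply, h2, hRI.integral_eq_zero hW, zero_add]

theorem isConditioned_partialSum [IsProbabilityMeasure P] (hG : G.Nondegenerate)
    (hsg : ∀ i, sg i * (sg i)ᵀ = G.bridgeCov T i) (hW : IsWienerProcess W P)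
    (hXm : ∀ t, Measurable fun ω => X ω t)
    (hX : ∀ (t : I) (a : Fin d),
      IsWienerIntegral W P (fun s => G.k t s a) (fun ω => X ω t a)) :
    IsConditioned T P X fun N ω => partialSum hG hsg N (X ω) :=
  fun _ hN t a => condExp_process hG hsg hW hXm hX hN t a

end GaussMarkov

/-! ### Uniqueness of the continuous versions, and the theorem -/

/-- Almost sure equality at each time becomes simultaneous on a countable dense set of times and for
all $N$; continuity extends it to all times. Any versions can thus be replaced by the explicit
partial sums. -/
theorem IsConditioned.ae_eq {Ω : Type*} [MeasurableSpace Ω] {d : ℕ} {T : NestedSupports}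
    {P : Measure Ω} {X : Ω → C(I, Fin d → ℝ)} {Z Z' : ℕ → Ω → C(I, Fin d → ℝ)}
    (hZ : IsConditioned T P X Z) (hZ' : IsConditioned T P X Z') :
    ∀ᵐ ω ∂P, ∀ N, 1 ≤ N → Z N ω = Z' N ω := by
  rw [ae_all_iff]
  intro N
  by_cases hN : 1 ≤ N
  swap
  · simp [hN]
  have h : ∀ᵐ ω ∂P, ∀ n a, Z N ω (TopologicalSpace.denseSeq I n) a =
      Z' N ω (TopologicalSpace.denseSeq I n) a :=
    ae_all_iff.2 fun n => ae_all_iff.2 fun a => (hZ N hN _ a).trans (hZ' N hN _ a).symm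
  filter_upwards [h] with ω hω _
  refine DFunLike.coe_injective ((TopologicalSpace.denseRange_denseSeq I).equalizer
    (Z N ω).continuous (Z' N ω).continuous (funext fun n => funext fun a => hω n a))

theorem mainTheorem8 {d m : ℕ} (G : GaussMarkov d m) (hG : G.Nondegenerate) (T : NestedSupports)
    (sg : Idx → Matrix (Fin d) (Fin d) ℝ) (hsg : ∀ i, sg i * (sg i)ᵀ = G.bridgeCov T i)
    {Ω : Type*} [MeasurableSpace Ω] (P : Measure Ω) [IsProbabilityMeasure P]
    (W : I → Ω → Fin m → ℝ) (hW : IsWienerProcess W P)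
    (X : Ω → C(I, Fin d → ℝ)) (hXm : ∀ t, Measurable fun ω => X ω t)
    (hX : ∀ (t : I) (a : Fin d),
      IsWienerIntegral W P (fun s => G.k t s a) (fun ω => X ω t a)) :
    (∀ x ∈ G.E T sg, ∀ (i : Idx) (j : Fin d),
      G.HasExtInner T sg (G.ψcol T sg i j) x (G.ip T sg (G.ψcol T sg i j) x)) ∧
    (∃ Z : ℕ → Ω → C(I, Fin d → ℝ), IsConditioned T P X Z) ∧
    ∀ Z : ℕ → Ω → C(I, Fin d → ℝ), IsConditioned T P X Z →
      (∀ N, 1 ≤ N → ∀ (t : I) (a : Fin d),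
        IsWienerIntegral W P (fun s => G.kN T sg N t s a) (fun ω => Z N ω t a)) ∧
      (∀ (i : Idx) (j : Fin d),
        IsWienerIntegral W P (G.φcol T sg i j) (fun ω => G.extP T sg i (X ω) j)) ∧
      ∀ᵐ ω ∂P,
        (∀ (i : Idx) (j : Fin d),
          G.HasExtInner T sg (G.ψcol T sg i j) (X ω) (G.extP T sg i (X ω) j)) ∧
        ∀ N, 1 ≤ N →
          G.IsOrthProj T sg N (X ω) (Z N ω) ∧
          (∀ t : I, Z N ω t = ∑ i ∈ idxBelow N, G.ψ T sg i t *ᵥ G.extP T sg i (X ω)) ∧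
          ∀ i ∈ idxBelow N, ∀ j : Fin d,
            G.ip T sg (G.ψcol T sg i j) (Z N ω) = G.extP T sg i (X ω) j := by
  have hcond := GaussMarkov.isConditioned_partialSum hG hsg hW hXm hX
  have hcl := GaussMarkov.ae_mem_closure_E hG hsg hW hX
  refine ⟨fun x hx i j => ?_, ⟨_, hcond⟩, fun Z hZ => ⟨fun N hN t a => ?_, fun i j => ?_, ?_⟩⟩
  · rw [GaussMarkov.ip_ψcol hG hsg hx]
    exact GaussMarkov.hasExtInner_ψcol hG hsg (subset_closure hx) i j
  · rw [isWienerIntegral_iff (GaussMarkov.memLp_kN hG hsg N t a)]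
    exact (GaussMarkov.isL2WienerIntegral_partialSum hG hsg hW hX N t a).congr
      ((hcond N hN t a).trans (hZ N hN t a).symm)
  · rw [isWienerIntegral_iff (GaussMarkov.memLp_φcol hG hsg i j)]
    refine (GaussMarkov.isL2WienerIntegral_Δ hG hsg hW hX i j).congr ?_
    filter_upwards [hcl] with ω hω
    rw [GaussMarkov.extP_eq hG hsg hω]
  · filter_upwards [hcl, hZ.ae_eq hcond] with ω hω hZω
    simp only [GaussMarkov.extP_eq hG hsg hω]
    refine ⟨GaussMarkov.hasExtInner_ψcol hG hsg hω, fun N hN => ?_⟩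
    rw [hZω N hN]
    refine ⟨GaussMarkov.isOrthProj_partialSum hG hsg N hω,
      GaussMarkov.partialSum_apply hG hsg N (X ω), fun i hi j => ?_⟩
    rw [GaussMarkov.ip_ψcol hG hsg (GaussMarkov.partialSum_mem_EN hG hsg N _).1,
      GaussMarkov.Δ_partialSum, if_pos hi]
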